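/- Let $P$ be a finite set of processes and $\Sigma$ a finite alphabet, both numbered, $P=\{0,\dots,k-1\}$ and $\Sigma=\{0,\dots,s-1\}$. A *message sequence chart* (MSC) over $P$ and $\Sigma$ is a pair $M=((w_p)_{p\in P},\lhd)$ of words $w_p\in\Sigma^*$, not all empty, and a relation $\lhd$ on the set of events $E=\bigcup_p E_p$, $E_p=\{p\}\times\{1,\dots,|w_p|\}$. Write $(p,i)\to(p,i+1)$ for consecutive events of a process. It is required that $\lhd$ only relates events of distinct processes; that $\to\cup\lhd$ is acyclic, so that $\le\;=(\to\cup\lhd)^*$ is a partial order; that each event belongs to at most one pair of $\lhd$; and that for $e\lhd f$ and $e'\lhd f'$ with $e,e'\in E_p$ and $f,f'\in E_q$ one has $e\to^*e'$ iff $f\to^*f'$. An event that belongs to no pair of $\lhd$ is called internal. A *communicating finite-state machine* (CFM) $\mathcal A$ over $P$ and $\Sigma$ consists of a finite set $\mathit{Msg}$ of messages, for each process $p$ a finite set $S_p$ of states with an initial state $\iota_p$ and a transition relation $\Delta_p\subseteq S_p\times(\Sigma\cup\Sigma\times\{!,?\}\times\mathit{Msg}\times(P\setminus\{p\}))\times S_p$,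 and a set $\mathit{Acc}\subseteq\prod_p S_p$. A run of $\mathcal A$ on $M$ assigns to every event $e\in E_p$ a transition in $\Delta_p$ that carries the label of $e$, such that on each process the first transition starts in $\iota_p$ and consecutive transitions fit together; internal events have internal transitions (those with action in $\Sigma$); and if $e\lhd f$ with $e\in E_p$, $f\in E_q$, then for some message $m$ the transition of $e$ sends $m$ to $q$ (action $(a,!,m,q)$) and the transition of $f$ receives $m$ from $p$ (action $(b,?,m,p)$). The run is accepting if the tuple of the last states of all processes ($\iota_p$ if $E_p=\emptyset$) belongs to $\mathit{Acc}$. $L(\mathcal A)$ is the set of the MSCs on which $\mathcal A$ has an accepting run. $\mathrm{EMSO}^2[\to,\lhd,\le]$ is the set of formulas $\exists X_1\dots\exists X_n.\,\psi$ ($n\ge 0$, each $X_i$ ranging over sets of events), where $\psi$ is built from the atoms $p(x)$ ("$x$ is on process $p$"), $a(x)$ ("$x$ has label $a$"), $x\in X$, $x=y$, $x\to y$, $x\lhd y$, $x\le y$ by $\vee$, $\neg$ and $\exists x$ (ranging over events), and uses only two first-order variables, which may be reused. The size $|\varphi|$ is the length of $\varphi$ as a string, each variable, process name and letter counting as one symbol.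 For a sentence $\varphi$, $L(\varphi)$ is the set of the MSCs that satisfy $\varphi$. **Theorem.** There are a constant $C$ and an algorithm (a computable function) that, for all $k$ and $s$, given $k$, $s$ and a sentence $\varphi\in\mathrm{EMSO}^2[\to,\lhd,\le]$ over $P$ and $\Sigma$, outputs an explicit description of a CFM $\mathcal A_\varphi$ over $P$ and $\Sigma$ such that $L(\mathcal A_\varphi)=L(\varphi)$ and every process of $\mathcal A_\varphi$ has at most $2^{2^{C\,(|\varphi|+|P|\log_2|P|)}}$ states, where $0\log_2 0=0$. The constant $C$ depends neither on $P$ nor on $\Sigma$ nor on $\varphi$. -/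

import Mathlib

namespace CFMLogic

/-! ## Message sequence charts -/

/-- The events of a family of words `w`: pairs of a process and a position (counted from `0`). -/
abbrev Event {P Lab : Type} (w : P → List Lab) : Type := Σ p : P, Fin (w p).length

/-- The process edge relation: `f` is the next event after `e` on the same process. -/
def ProcEdge {P Lab : Type} {w : P → List Lab} (e f : Event w) : Prop :=
  e.1 = f.1 ∧ e.2.val + 1 = f.2.val

/-- Message sequence charts over the processes `P` and the labels `Lab`. -/
structure MSC (P Lab : Type) where
  /-- the word executed by each process -/
  word : P → List Lab
  /-- at least one of the words is non-empty -/
  nonempty : ∃ p, word p ≠ []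
  /-- the message edges -/
  msg : Event word → Event word → Prop
  /-- message edges connect distinct processes -/
  msg_ne : ∀ e f, msg e f → e.1 ≠ f.1
  /-- the union of process edges and message edges is acyclic -/
  acyclic : ∀ e, ¬ Relation.TransGen (fun e f => ProcEdge e f ∨ msg e f) e e
  /-- each event is part of at most one message edge -/
  msg_unique : ∀ e f e' f', msg e f → msg e' f' →
    (e = e' ∨ e = f' ∨ f = e' ∨ f = f') → e = e' ∧ f = f'
  /-- channels are FIFO -/
  fifo : ∀ e f e' f', msg e f → msg e' f' → e.1 = e'.1 → f.1 = f'.1 →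
    (Relation.ReflTransGen ProcEdge e e' ↔ Relation.ReflTransGen ProcEdge f f')

namespace MSC

variable {P Lab : Type}

/-- The events of a chart. -/
abbrev E (M : MSC P Lab) : Type := Event M.word

/-- The label from `Lab` of an event. -/
def label (M : MSC P Lab) (e : M.E) : Lab := (M.word e.1).get e.2

/-- The partial order of a chart. -/
def le (M : MSC P Lab) : M.E → M.E → Prop :=
  Relation.ReflTransGen (fun e f => ProcEdge e f ∨ M.msg e f)

/-- An event that does not belong to a message edge. -/
def Internal (M : MSC P Lab) (e : M.E) : Prop := ∀ f, ¬ M.msg e f ∧ ¬ M.msg f e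

end MSC

/-! ## Communicating finite-state machines -/

/-- The actions of process `p`: internal actions, sending message `m` to process `q`, and
receiving message `m` from process `q`, each with a label `a`. -/
inductive Action {P : Type} (p : P) (Lab Msg : Type) : Type
  | internal (a : Lab) : Action p Lab Msg
  | send (a : Lab) (m : Msg) (q : {q : P // q ≠ p}) : Action p Lab Msg
  | receive (a : Lab) (m : Msg) (q : {q : P // q ≠ p}) : Action p Lab Msg

/-- The label of an action. -/
def Action.label {P : Type} {p : P} {Lab Msg : Type} : Action p Lab Msg → Lab
  | .internal a => a
  | .send a _ _ => a
  | .receive a _ _ => a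

/-- Transitions of process `p` with states `S`. -/
structure Transition {P : Type} (p : P) (Lab Msg S : Type) : Type where
  source : S
  action : Action p Lab Msg
  target : S

/-- Communicating finite-state machines over the processes `P` and the labels `Lab`. -/
structure CFM (P Lab : Type) where
  /-- the messages -/
  Msg : Type
  finite_msg : Finite Msg
  /-- the states of each process -/
  State : P → Type
  finite_state : ∀ p, Finite (State p)
  /-- the initial state of each process -/
  init : ∀ p, State p
  /-- the transition relation of each process -/
  trans : ∀ p, Set (Transition p Lab Msg (State p))
  /-- the global accepting states -/
  Acc : Set (∀ p, State p)

namespace CFM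

variable {P Lab : Type}

/-- Runs of `A` on the chart `M`. -/
structure Run (A : CFM P Lab) (M : MSC P Lab) where
  /-- the transition executed at each event -/
  tr : ∀ e : M.E, Transition e.1 Lab A.Msg (A.State e.1)
  tr_mem : ∀ e, tr e ∈ A.trans e.1
  label_eq : ∀ e, (tr e).action.label = M.label e
  source_first : ∀ (p : P) (h : 0 < (M.word p).length), (tr ⟨p, ⟨0, h⟩⟩).source = A.init p
  target_eq_source : ∀ (p : P) (i : ℕ) (h : i + 1 < (M.word p).length),
    (tr ⟨p, ⟨i, Nat.lt_of_succ_lt h⟩⟩).target = (tr ⟨p, ⟨i + 1, h⟩⟩).source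
  internal : ∀ e, M.Internal e → ∃ a, (tr e).action = .internal a
  message : ∀ (e f : M.E) (h : M.msg e f), ∃ a b m,
    (tr e).action = .send a m ⟨f.1, (M.msg_ne e f h).symm⟩ ∧
    (tr f).action = .receive b m ⟨e.1, M.msg_ne e f h⟩

/-- The state of process `p` at the end of a run: the target of its last transition, or its
initial state if it has no event. -/
def Run.final {A : CFM P Lab} {M : MSC P Lab} (r : A.Run M) (p : P) : A.State p :=
  if h : 0 < (M.word p).length then
    (r.tr ⟨p, ⟨(M.word p).length - 1, Nat.sub_lt h Nat.one_pos⟩⟩).target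
  else A.init p

/-- The language of a machine: the charts on which it has an accepting run. -/
def language (A : CFM P Lab) : Set (MSC P Lab) :=
  {M | ∃ r : A.Run M, r.final ∈ A.Acc}

end CFM

/-! ## Monadic second-order logic -/

/-- Formulas of monadic second-order logic over charts. First-order variables and second-order
variables are numbered by `ℕ`. -/
inductive MSO (P Lab : Type) : Type
  /-- `x` is on process `p` -/
  | proc (p : P) (x : ℕ) : MSO P Lab
  /-- `x` has label `a` -/
  | label (a : Lab) (x : ℕ) : MSO P Lab
  /-- `x ∈ X` -/
  | mem (x X : ℕ) : MSO P Lab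
  /-- `x = y` -/
  | eq (x y : ℕ) : MSO P Lab
  /-- there is a process edge from `x` to `y` -/
  | edge (x y : ℕ) : MSO P Lab
  /-- there is a message edge from `x` to `y` -/
  | msg (x y : ℕ) : MSO P Lab
  /-- `x ≤ y` -/
  | le (x y : ℕ) : MSO P Lab
  | or (φ ψ : MSO P Lab) : MSO P Lab
  | not (φ : MSO P Lab) : MSO P Lab
  /-- first-order quantification `∃ x, φ` -/
  | exFO (x : ℕ) (φ : MSO P Lab) : MSO P Lab
  /-- second-order quantification `∃ X, φ` -/
  | exSO (X : ℕ) (φ : MSO P Lab) : MSO P Lab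

/-- The symbols of which formulas consist. -/
inductive Symbol (P Lab : Type) : Type
  | proc (p : P) | letter (a : Lab) | foVar (x : ℕ) | soVar (X : ℕ)
  | mem | eq | edge | msg | le | or | not | ex

namespace MSO

variable {P Lab : Type}

/-- Satisfaction of a formula under an assignment of events to first-order variables and of sets
of events to second-order variables. -/
def Sat (M : MSC P Lab) : (ℕ → M.E) → (ℕ → Set M.E) → MSO P Lab → Prop
  | v, _, proc p x => (v x).1 = p
  | v, _, label a x => M.label (v x) = a
  | v, V, mem x X => v x ∈ V X
  | v, _, eq x y => v x = v y
  | v, _, edge x y => ProcEdge (v x) (v y)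
  | v, _, msg x y => M.msg (v x) (v y)
  | v, _, le x y => M.le (v x) (v y)
  | v, V, or φ ψ => Sat M v V φ ∨ Sat M v V ψ
  | v, V, not φ => ¬ Sat M v V φ
  | v, V, exFO x φ => ∃ e : M.E, Sat M (Function.update v x e) V φ
  | v, V, exSO X φ => ∃ S : Set M.E, Sat M v (Function.update V X S) φ

/-- The free first-order variables. -/
def freeFO : MSO P Lab → Set ℕ
  | proc _ x => {x}
  | label _ x => {x}
  | mem x _ => {x}
  | eq x y => {x, y}
  | edge x y => {x, y}
  | msg x y => {x, y}
  | le x y => {x, y}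
  | or φ ψ => freeFO φ ∪ freeFO ψ
  | not φ => freeFO φ
  | exFO x φ => freeFO φ \ {x}
  | exSO _ φ => freeFO φ

/-- The free second-order variables. -/
def freeSO : MSO P Lab → Set ℕ
  | mem _ X => {X}
  | or φ ψ => freeSO φ ∪ freeSO ψ
  | not φ => freeSO φ
  | exFO _ φ => freeSO φ
  | exSO X φ => freeSO φ \ {X}
  | _ => ∅

/-- Sentences: formulas without free variables. -/
def IsSentence (φ : MSO P Lab) : Prop := φ.freeFO = ∅ ∧ φ.freeSO = ∅

/-- The two-variable fragment of first-order logic: no second-order quantifier occurs, and the only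
first-order variables are those numbered `0` and `1`. Second-order variables may occur free. -/
def IsFO2 : MSO P Lab → Prop
  | proc _ x => x < 2
  | label _ x => x < 2
  | mem x _ => x < 2
  | eq x y => x < 2 ∧ y < 2
  | edge x y => x < 2 ∧ y < 2
  | msg x y => x < 2 ∧ y < 2
  | le x y => x < 2 ∧ y < 2
  | or φ ψ => IsFO2 φ ∧ IsFO2 ψ
  | not φ => IsFO2 φ
  | exFO x φ => x < 2 ∧ IsFO2 φ
  | exSO _ _ => False

/-- Existential monadic second-order logic with two first-order variables: a (possibly empty)
block of existential second-order quantifiers in front of a formula of the two-variable fragment. -/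
def IsEMSO2 : MSO P Lab → Prop
  | exSO _ φ => IsEMSO2 φ
  | φ => IsFO2 φ

/-- The charts that satisfy a sentence. (Charts are not empty, so assignments exist; the truth of
a sentence does not depend on the assignment.) -/
def language (φ : MSO P Lab) : Set (MSC P Lab) :=
  {M | ∀ (v : ℕ → M.E) (V : ℕ → Set M.E), Sat M v V φ}

/-- A formula as a string of symbols, in prefix notation, which needs no parentheses. -/
def toSymbols : MSO P Lab → List (Symbol P Lab)
  | proc p x => [.proc p, .foVar x]
  | label a x => [.letter a, .foVar x]
  | mem x X => [.mem, .foVar x, .soVar X]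
  | eq x y => [.eq, .foVar x, .foVar y]
  | edge x y => [.edge, .foVar x, .foVar y]
  | msg x y => [.msg, .foVar x, .foVar y]
  | le x y => [.le, .foVar x, .foVar y]
  | or φ ψ => .or :: (toSymbols φ ++ toSymbols ψ)
  | not φ => .not :: toSymbols φ
  | exFO x φ => .ex :: .foVar x :: toSymbols φ
  | exSO X φ => .ex :: .soVar X :: toSymbols φ

/-- The size of a formula: its length as a string. -/
def size (φ : MSO P Lab) : ℕ := φ.toSymbols.length

end MSO

/-! ## Finite presentations, on which algorithms operate -/

/-- A pair of numbers that represents a symbol (processes and labels are numbered). -/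
def Symbol.code {k s : ℕ} : Symbol (Fin k) (Fin s) → ℕ × ℕ
  | .proc p => (0, p.val)
  | .letter a => (1, a.val)
  | .foVar x => (2, x)
  | .soVar X => (3, X)
  | .mem => (4, 0)
  | .eq => (4, 1)
  | .edge => (4, 2)
  | .msg => (4, 3)
  | .le => (4, 4)
  | .or => (4, 5)
  | .not => (4, 6)
  | .ex => (4, 7)

/-- The string of a formula as input for an algorithm. -/
def MSO.code {k s : ℕ} (φ : MSO (Fin k) (Fin s)) : List (ℕ × ℕ) :=
  φ.toSymbols.map Symbol.code

/-- Action codes: a label, and for a communication also `(true, m, q)` for sending message `m` to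
process `q`, or `(false, m, q)` for receiving message `m` from process `q`. -/
abbrev ActionCode : Type := ℕ × Option (Bool × ℕ × ℕ)

/-- The code of an action. -/
def Action.code {k s m : ℕ} {p : Fin k} : Action p (Fin s) (Fin m) → ActionCode
  | .internal a => (a.val, none)
  | .send a i q => (a.val, some (true, i.val, q.1.val))
  | .receive a i q => (a.val, some (false, i.val, q.1.val))

/-- Finite descriptions of machines, consisting of
* the list of the numbers `n_p` such that process `p` has the states `0, …, n_p`,
* the number of messages,
* the list of the transitions, each given as process, source, action, target,
* the list of the global accepting states, each given as the list of its components. -/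
abbrev CFMCode : Type :=
  List ℕ × ℕ × List (ℕ × ℕ × ActionCode × ℕ) × List (List ℕ)

/-- The machine that is described by a finite description. The initial state of each process
is `0`. Items of the description that are out of range are disregarded. -/
def CFMCode.toCFM (k s : ℕ) (c : CFMCode) : CFM (Fin k) (Fin s) where
  Msg := Fin c.2.1
  finite_msg := inferInstance
  State := fun p => Fin (c.1.getD p.val 0 + 1)
  finite_state := fun _ => inferInstance
  init := fun _ => 0
  trans := fun p => {t | (p.val, t.source.val, t.action.code, t.target.val) ∈ c.2.2.1}
  Acc := {g | List.ofFn (fun p => (g p).val) ∈ c.2.2.2}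

end CFMLogic

open CFMLogic

/-!
Truth of a two-variable formula at an event only depends on the *types* of the events: the type of
an event is a bit string indexed by the symbols of the formula, whose bits give the values of the
monadic atoms, of the set variables and of the quantified subformulas. A sentence holds in a chart
if and only if the events have types that are correct (`mem_language_iff_typing`), and correctness
at an event `e` is determined by the set of pairs (relation of `f` to `e`, type of `f`) for the
events `f`, where there are eight possible relations (`MSC.Rel`). The second-order quantifiers are
absorbed by guessing the bits of the set variables.

Hence it suffices to construct a machine that guesses types and checks for each event which pairs
occur. The machine annotates each event by a bounded number and checks a condition that relates the
annotation to those of the neighbouring events, and a condition on the last annotations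
(`annotationMachine`). Types at neighbours can be read off directly. For the events below `e` that
are not neighbours, it counts up to two the events of given type and process in the past; dually
for the events above `e` (`CountRules.other_iff`).

The difficulty is to know whether an event `e` on process `p` is incomparable to some event of
type `t` on process `q`. The machine guesses the answer and certifies it.

A negative answer is certified by a path: the events on `p` with a negative answer and the events
of type `t` on `q` must form a chain, and in a chart, chains are the sets covered by a path
(`PathRules.comparable`, `exists_pathRules_of_chain`). A path is recognized locally, except that it
has to have at most one start, which is checked at the end of the run.

For a positive answer, `e` is incomparable to an event of type `t` on `q` if for every sequence `w`
of processes from `q` to `p` and every sequence `w'` from `p` to `q` there is such an event `f` that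
neither reaches `e` along `w` nor is reached from `e` along `w'` (`exists_incomparable`). This holds
because the events of `q` below `e` have a maximum and those above `e` a minimum, and paths to or
from these two can be chosen without repeated processes. For fixed `w` and `w'` the answers are
certified by marked events on the two processes: each process marks some events, announces its marks
to the other one along `w` or `w'`, and at each marked event and each event with a positive answer it
is exactly one mark ahead of what it knows of the other process. Then the mark of `q` with the same
number as the latest mark of `p` is the event sought (`exists_unreachable_of_rules`). Numbers of
marks need not be stored: announcing increments is enough (`SignalRules`), because channels are FIFO
and the marks can be chosen such that consecutive ones are separated by what they reach. That both
processes mark equally often is checked by the parities of these numbers (`StationRules`). Conversely,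
marks are found greedily, alternating between the last event of type `t` not reachable from the
current event and the first event with a positive answer reachable from that event
(`exists_ladder`, `exists_rules_of_unreachable`).

An annotation consists of `2 ^ O(|φ| + k * log k)` bits, as there are at most `2 ^ |φ|` types
and `2 ^ O(k * log k)` process sequences of length at most `k`, and a state of the machine is a pair of
annotations; hence the bound.
-/

namespace CFMLogic

/-! ### Closure properties of primitive recursive functions and predicates -/

attribute [fun_prop] Primrec PrimrecPred
attribute [fun_prop] Primrec.id Primrec.const Primrec.comp PrimrecPred.comp

section Primrec
variable {α β γ δ : Type} [Primcodable α] [Primcodable β] [Primcodable γ] [Primcodable δ]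

@[fun_prop] theorem primrec_fst {f : α → β × γ} (h : Primrec f) : Primrec fun a => (f a).1 :=
  Primrec.fst.comp h

@[fun_prop] theorem primrec_snd {f : α → β × γ} (h : Primrec f) : Primrec fun a => (f a).2 :=
  Primrec.snd.comp h

@[fun_prop] theorem primrec_pair {f : α → β} {g : α → γ} (h : Primrec f) (h' : Primrec g) :
    Primrec fun a => (f a, g a) := Primrec.pair h h'

@[fun_prop] theorem primrec_add {f g : α → ℕ} (h : Primrec f) (h' : Primrec g) :
    Primrec fun a => f a + g a := Primrec.nat_add.comp h h'

@[fun_prop] theorem primrec_sub {f g : α → ℕ} (h : Primrec f) (h' : Primrec g) :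
    Primrec fun a => f a - g a := Primrec.nat_sub.comp h h'

@[fun_prop] theorem primrec_div {f g : α → ℕ} (h : Primrec f) (h' : Primrec g) :
    Primrec fun a => f a / g a := Primrec.nat_div.comp h h'

@[fun_prop] theorem primrec_mod {f g : α → ℕ} (h : Primrec f) (h' : Primrec g) :
    Primrec fun a => f a % g a := Primrec.nat_mod.comp h h'

@[fun_prop] theorem primrec_pow {f g : α → ℕ} (h : Primrec f) (h' : Primrec g) :
    Primrec fun a => f a ^ g a :=
  (Primrec₂.unpaired'.1 Nat.Primrec.pow).comp h h'

@[fun_prop] theorem primrec_unpair {f : α → ℕ} (h : Primrec f) :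
    Primrec fun a => Nat.unpair (f a) := Primrec.unpair.comp h

@[fun_prop] theorem primrec_range {f : α → ℕ} (h : Primrec f) :
    Primrec fun a => List.range (f a) := Primrec.list_range.comp h

@[fun_prop] theorem primrec_length {f : α → List β} (h : Primrec f) :
    Primrec fun a => (f a).length := Primrec.list_length.comp h

@[fun_prop] theorem primrec_tail {f : α → List β} (h : Primrec f) :
    Primrec fun a => (f a).tail := Primrec.list_tail.comp h

@[fun_prop] theorem primrec_headI [Inhabited β] {f : α → List β} (h : Primrec f) :
    Primrec fun a => (f a).headI := Primrec.list_headI.comp h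

@[fun_prop] theorem primrec_cons {f : α → β} {g : α → List β} (h : Primrec f) (h' : Primrec g) :
    Primrec fun a => f a :: g a := Primrec.list_cons.comp h h'

@[fun_prop] theorem primrec_drop {f : α → ℕ} {g : α → List β} (h : Primrec f) (h' : Primrec g) :
    Primrec fun a => (g a).drop (f a) := Primrec.list_drop.comp h h'

@[fun_prop] theorem primrec_getD {f : α → List β} {g : α → ℕ} {d : β} (h : Primrec f)
    (h' : Primrec g) : Primrec fun a => (f a).getD (g a) d := (Primrec.list_getD d).comp h h'

@[fun_prop] theorem primrec_idxOf [BEq β] [LawfulBEq β] {f : α → β} {g : α → List β}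
    (h : Primrec f) (h' : Primrec g) : Primrec fun a => (g a).idxOf (f a) := by
  classical
  obtain rfl : ‹BEq β› = instBEqOfDecidableEq := lawful_beq_subsingleton _ _
  exact Primrec.list_idxOf.comp h h'

@[fun_prop] theorem primrec_map {L : α → List β} {g : α → β → γ} (h : Primrec L)
    (h' : Primrec fun x : α × β => g x.1 x.2) : Primrec fun a => (L a).map (g a) :=
  Primrec.list_map h h'

@[fun_prop] theorem primrec_flatMap {L : α → List β} {g : α → β → List γ} (h : Primrec L)
    (h' : Primrec fun x : α × β => g x.1 x.2) : Primrec fun a => (L a).flatMap (g a) :=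
  Primrec.list_flatMap h h'

@[fun_prop] theorem primrec_some {f : α → β} (h : Primrec f) : Primrec fun a => some (f a) :=
  Primrec.option_some.comp h

@[fun_prop] theorem primrec_ite {c : α → Prop} [∀ a, Decidable (c a)] {f g : α → β}
    (hc : PrimrecPred c) (hf : Primrec f) (hg : Primrec g) :
    Primrec fun a => if c a then f a else g a := Primrec.ite hc hf hg

@[fun_prop] theorem primrec_decide {c : α → Prop} [∀ a, Decidable (c a)]
    (hc : PrimrecPred c) : Primrec fun a => decide (c a) := PrimrecPred.decide hc

@[fun_prop] theorem primrec_filter {L : α → List β} {p : α → β → Prop}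
    [∀ a b, Decidable (p a b)] (h : Primrec L)
    (h' : PrimrecPred fun x : α × β => p x.1 x.2) :
    Primrec fun a => (L a).filter (fun b => decide (p a b)) := by
  have : Primrec fun a => (L a).flatMap (fun b => if p a b then [b] else []) := by
    fun_prop
  refine this.of_eq fun a => ?_
  induction L a with
  | nil => rfl
  | cons b l ih => by_cases hb : p a b <;> simp [hb, ih]

@[fun_prop] theorem primrecPred_and {f g : α → Prop} (h : PrimrecPred f) (h' : PrimrecPred g) :
    PrimrecPred fun a => f a ∧ g a := h.and h'

@[fun_prop] theorem primrecPred_or {f g : α → Prop} (h : PrimrecPred f) (h' : PrimrecPred g) :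
    PrimrecPred fun a => f a ∨ g a := h.or h'

@[fun_prop] theorem primrecPred_not {f : α → Prop} (h : PrimrecPred f) :
    PrimrecPred fun a => ¬ f a := h.not

theorem primrecPred_imp {f g : α → Prop} (h : PrimrecPred f) (h' : PrimrecPred g) :
    PrimrecPred fun a => f a → g a := (h.not.or h').of_eq fun _ => by tauto

@[fun_prop] theorem primrecPred_iff {f g : α → Prop} (h : PrimrecPred f) (h' : PrimrecPred g) :
    PrimrecPred fun a => f a ↔ g a :=
  ((primrecPred_imp h h').and (primrecPred_imp h' h)).of_eq fun _ => by tauto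

@[fun_prop] theorem primrecPred_eq {f g : α → β} (h : Primrec f) (h' : Primrec g) :
    PrimrecPred fun a => f a = g a := Primrec.eq.comp h h'

@[fun_prop] theorem primrecPred_ne {f g : α → β} (h : Primrec f) (h' : Primrec g) :
    PrimrecPred fun a => f a ≠ g a := (primrecPred_eq h h').not

@[fun_prop] theorem primrecPred_of_bool {f : α → Bool} (h : Primrec f) :
    PrimrecPred fun a => f a = true := primrecPred_eq h (Primrec.const _)

/-- `p` holds for all elements of `L`. -/
def AllIn (L : List β) (p : β → Prop) : Prop := ∀ b ∈ L, p b

/-- `p` holds for some element of `L`. -/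
def SomeIn (L : List β) (p : β → Prop) : Prop := ∃ b ∈ L, p b

/-- Implication as a constant, so that `fun_prop` does not mistake it for a function space. -/
def Imp (p q : Prop) : Prop := p → q

@[fun_prop] theorem primrecPred_Imp {f g : α → Prop} (h : PrimrecPred f) (h' : PrimrecPred g) :
    PrimrecPred fun a => Imp (f a) (g a) := primrecPred_imp h h'

@[fun_prop] theorem primrecPred_allIn {L : α → List β} {p : α → β → Prop} (h : Primrec L)
    (h' : PrimrecPred fun x : α × β => p x.1 x.2) : PrimrecPred fun a => AllIn (L a) (p a) := by
  have := PrimrecRel.forall_mem_list (R := fun (b : β) (a : α) => p a b)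
    (h'.comp (Primrec.pair Primrec.snd Primrec.fst))
  exact this.comp h Primrec.id

@[fun_prop] theorem primrecPred_someIn {L : α → List β} {p : α → β → Prop} (h : Primrec L)
    (h' : PrimrecPred fun x : α × β => p x.1 x.2) : PrimrecPred fun a => SomeIn (L a) (p a) := by
  have := PrimrecRel.exists_mem_list (R := fun (b : β) (a : α) => p a b)
    (h'.comp (Primrec.pair Primrec.snd Primrec.fst))
  exact this.comp h Primrec.id

end Primrec

/-- All lists of length `l` with entries from `L`. -/
def tuples {α : Type} (L : List α) (l : ℕ) : List (List α) :=
  Nat.rec [[]] (fun _ T => L.flatMap fun x => T.map (x :: ·)) l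

theorem mem_tuples {α : Type} {L : List α} {l : ℕ} {w : List α} :
    w ∈ tuples L l ↔ w.length = l ∧ ∀ x ∈ w, x ∈ L := by
  induction l generalizing w with
  | zero => cases w <;> simp [tuples]
  | succ l ih =>
    change w ∈ L.flatMap (fun x => (tuples L l).map (x :: ·)) ↔ _
    cases w with
    | nil => simp
    | cons a w => simp [ih]; tauto

theorem length_tuples {α : Type} (L : List α) (l : ℕ) :
    (tuples L l).length = L.length ^ l := by
  induction l with
  | zero => simp [tuples]
  | succ l ih =>
    change (L.flatMap (fun x => (tuples L l).map (x :: ·))).length = _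
    simp [List.length_flatMap, ih, pow_succ, mul_comm]

@[fun_prop] theorem primrec_tuples {α β : Type} [Primcodable α] [Primcodable β]
    {L : α → List β} {l : α → ℕ} (hL : Primrec L) (hl : Primrec l) :
    Primrec fun a => tuples (L a) (l a) := by
  unfold tuples
  refine Primrec.nat_rec' (h := fun a (y : ℕ × List (List β)) =>
    (L a).flatMap fun x => y.2.map (x :: ·)) hl (Primrec.const [[]]) ?_
  unfold Primrec₂
  fun_prop

/-! ### Machines that check local conditions on an annotation of the events -/

section Charts
variable {P Lab : Type} {M : MSC P Lab}

instance [Finite P] (w : P → List Lab) : Finite (Event w) :=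
  inferInstanceAs (Finite (Σ p : P, Fin (w p).length))

theorem Event.ext' {w : P → List Lab} {e f : Event w} (h : e.1 = f.1) (h' : e.2.val = f.2.val) :
    e = f := by
  obtain ⟨p, i⟩ := e; obtain ⟨q, j⟩ := f
  obtain rfl : p = q := h
  exact congrArg _ (Fin.ext h')

theorem ProcEdge.right_unique {w : P → List Lab} {e f g : Event w} (h : ProcEdge e f)
    (h' : ProcEdge e g) : f = g :=
  Event.ext' (h.1.symm.trans h'.1) (h.2.symm.trans h'.2)

theorem ProcEdge.left_unique {w : P → List Lab} {e f g : Event w} (h : ProcEdge e g)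
    (h' : ProcEdge f g) : e = f :=
  Event.ext' (h.1.trans h'.1.symm) (by have := h.2; have := h'.2; omega)

theorem exists_procEdge_left {w : P → List Lab} (e : Event w) :
    (∃ f, ProcEdge f e) ↔ e.2.val ≠ 0 := by
  constructor
  · rintro ⟨f, h⟩; have := h.2; omega
  · intro h
    exact ⟨⟨e.1, ⟨e.2.val - 1, by omega⟩⟩, rfl, by simp; omega⟩

theorem exists_procEdge_right {w : P → List Lab} (e : Event w) :
    (∃ f, ProcEdge e f) ↔ e.2.val + 1 < (w e.1).length := by
  obtain ⟨p, i⟩ := e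
  constructor
  · rintro ⟨⟨q, j⟩, rfl, h'⟩; simp only at h' ⊢; omega
  · intro h
    exact ⟨⟨p, ⟨i.val + 1, h⟩⟩, rfl, rfl⟩

theorem MSC.msg_right_unique {e f g : M.E} (h : M.msg e f) (h' : M.msg e g) : f = g :=
  (M.msg_unique _ _ _ _ h h' (Or.inl rfl)).2

theorem MSC.msg_left_unique {e f g : M.E} (h : M.msg e g) (h' : M.msg f g) : e = f :=
  (M.msg_unique _ _ _ _ h h' (by tauto)).1

theorem MSC.not_msg_msg {e f g : M.E} (h : M.msg e f) : ¬ M.msg f g := fun h' => by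
  have := M.msg_unique _ _ _ _ h h' (by tauto)
  exact M.msg_ne _ _ h (by rw [this.1])

/-- The last event of process `p`, as a relation. -/
def IsLast {w : P → List Lab} (p : P) (e : Event w) : Prop := e.1 = p ∧ ¬ ∃ f, ProcEdge e f

theorem IsLast.unique {w : P → List Lab} {p : P} {e f : Event w} (h : IsLast p e)
    (h' : IsLast p f) : e = f := by
  obtain ⟨q, i⟩ := e; obtain ⟨r, j⟩ := f
  obtain ⟨h1, h2⟩ := h; obtain ⟨h3, h4⟩ := h'
  rw [exists_procEdge_right] at h2 h4
  simp only at h1 h2 h3 h4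
  subst h1 h3
  exact Event.ext' rfl (by simp only; omega)

open Classical in
/-- The value of `γ` at the event with property `R`, and `0` if there is no such event. -/
noncomputable def valueAt {α : Type} (γ : α → ℕ) (R : α → Prop) : ℕ :=
  if h : ∃ f, R f then γ h.choose else 0

theorem valueAt_eq {α : Type} {γ : α → ℕ} {R : α → Prop} {f : α} (hf : R f)
    (hu : ∀ g, R g → g = f) : valueAt γ R = γ f := by
  have h : ∃ f, R f := ⟨f, hf⟩
  rw [valueAt, dif_pos h, hu _ h.choose_spec]

theorem valueAt_none {α : Type} {γ : α → ℕ} {R : α → Prop} (h : ¬ ∃ f, R f) :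
    valueAt γ R = 0 := by
  rw [valueAt, dif_neg h]

theorem valueAt_lt {α : Type} {γ : α → ℕ} {R : α → Prop} {N : ℕ} (hN : 0 < N)
    (h : ∀ e, γ e < N) : valueAt γ R < N := by
  rw [valueAt]; split_ifs
  · exact h _
  · exact hN

end Charts

/-- The arguments of a local condition on an annotated event: its process, its label, and five
annotations, namely that of the event, of its predecessor and of its successor on the process,
of the sender of the message it receives and of the receiver of the message it sends; the
annotation of a missing event is `0`. -/
abbrev LocalArgs : Type := ℕ × ℕ × ℕ × ℕ × ℕ × ℕ × ℕ

/-- The arguments of the local condition at the event `e`. -/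
noncomputable def localArgs {k s : ℕ} {M : MSC (Fin k) (Fin s)} (γ : M.E → ℕ) (e : M.E) :
    LocalArgs :=
  (e.1.val, (M.label e).val, γ e, valueAt γ (fun f => ProcEdge f e),
    valueAt γ (fun f => ProcEdge e f), valueAt γ (fun f => M.msg f e),
    valueAt γ (fun f => M.msg e f))

/-- A state is a pair of the annotation of the last event and the announced annotation of the next
event; a message is a pair of the annotation of the sender and the announced annotation of the
receiver. The condition says that a coded transition is consistent with this reading and that the
local condition holds. -/
def TransOk (loc : LocalArgs → Prop) (x : ℕ × ℕ × ActionCode × ℕ) : Prop :=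
  x.2.2.2.unpair.1 ≠ 0 ∧
  (x.2.1 = 0 ∨ x.2.1.unpair.2 = x.2.2.2.unpair.1) ∧
  (x.2.2.1.2 = none ∨
    (if (x.2.2.1.2.getD (true, 0, 0)).1 = true
      then (x.2.2.1.2.getD (true, 0, 0)).2.1.unpair.1
      else (x.2.2.1.2.getD (true, 0, 0)).2.1.unpair.2) = x.2.2.2.unpair.1) ∧
  loc (x.1, x.2.2.1.1, x.2.2.2.unpair.1, x.2.1.unpair.1, x.2.2.2.unpair.2,
    (if x.2.2.1.2 ≠ none ∧ (x.2.2.1.2.getD (true, 0, 0)).1 = false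
      then (x.2.2.1.2.getD (true, 0, 0)).2.1.unpair.1 else 0),
    (if x.2.2.1.2 ≠ none ∧ (x.2.2.1.2.getD (true, 0, 0)).1 = true
      then (x.2.2.1.2.getD (true, 0, 0)).2.1.unpair.2 else 0))

/-- The codes of all actions with labels below `s`, messages below `m` and processes below `k`. -/
def actionCodes (k s m : ℕ) : List ActionCode :=
  (List.range s).flatMap fun a => (a, none) :: (List.range m).flatMap fun i =>
    (List.range k).flatMap fun q => [(a, some (true, i, q)), (a, some (false, i, q))]

/-- The codes of all transitions, without regard to a transition relation. -/
def transCodes (k s N : ℕ) : List (ℕ × ℕ × ActionCode × ℕ) :=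
  (List.range k).flatMap fun p => (List.range (N ^ 2 + 1)).flatMap fun x =>
    (actionCodes k s (N ^ 2)).flatMap fun a => (List.range (N ^ 2 + 1)).map fun y => (p, x, a, y)

/-- The final states accepted: no process announces a further event, and the annotations of the last
events satisfy `glob`. -/
def AccOk (glob : List ℕ → Prop) (g : List ℕ) : Prop :=
  AllIn g (fun z => z.unpair.2 = 0) ∧ glob (g.map fun z => z.unpair.1)

open Classical in
/-- The machine that guesses an annotation of the events by positive numbers below `N` and checks
the local condition `loc` at all events and the condition `glob` on the last events. -/
noncomputable def annotationMachine (k s N : ℕ) (loc : LocalArgs → Prop) (glob : List ℕ → Prop) :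
    CFMCode :=
  (List.replicate k (N ^ 2), N ^ 2,
    (transCodes k s N).filter (fun x => decide (TransOk loc x)),
    (tuples (List.range (N ^ 2 + 1)) k).filter (fun g => decide (AccOk glob g)))

theorem mem_actionCodes {k s m : ℕ} {p : Fin k} (a : Action p (Fin s) (Fin m)) :
    a.code ∈ actionCodes k s m := by
  cases a <;> simp [Action.code, actionCodes]

section Machine
variable {k s N : ℕ} {loc : LocalArgs → Prop} {glob : List ℕ → Prop}

theorem annotationMachine_getD (p : Fin k) :
    (annotationMachine k s N loc glob).1.getD p.val 0 = N ^ 2 := by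
  simp [annotationMachine]

theorem annotationMachine_card (p : Fin k) :
    Nat.card ((CFMCode.toCFM k s (annotationMachine k s N loc glob)).State p) = N ^ 2 + 1 := by
  change Nat.card (Fin _) = _
  rw [Nat.card_fin, annotationMachine_getD]

/-- The number of a state of a machine given by a finite description. -/
def CFMCode.num {c : CFMCode} {p : Fin k} (x : (c.toCFM k s).State p) : ℕ :=
  Fin.val (n := c.1.getD p.val 0 + 1) x

theorem CFMCode.num_lt (p : Fin k)
    (x : ((annotationMachine k s N loc glob).toCFM k s).State p) : CFMCode.num x < N ^ 2 + 1 :=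
  (Fin.is_lt (n := (annotationMachine k s N loc glob).1.getD p.val 0 + 1) x).trans_eq
    (by rw [annotationMachine_getD])

open Classical in
theorem annotationMachine_trans (p : Fin k)
    (t : Transition p (Fin s) (Fin (N ^ 2))
      (((annotationMachine k s N loc glob).toCFM k s).State p)) :
    t ∈ ((annotationMachine k s N loc glob).toCFM k s).trans p ↔
      TransOk loc (p.val, CFMCode.num t.source, t.action.code, CFMCode.num t.target) := by
  change (_ ∈ List.filter _ _) ↔ _
  rw [List.mem_filter, decide_eq_true_iff]
  refine and_iff_right ?_
  simp only [transCodes, List.mem_flatMap, List.mem_range, List.mem_map]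
  exact ⟨_, p.2, _, CFMCode.num_lt _ t.source, _, mem_actionCodes _, _,
    CFMCode.num_lt _ t.target, rfl⟩

open Classical in
theorem annotationMachine_acc
    (g : ∀ p, ((annotationMachine k s N loc glob).toCFM k s).State p) :
    g ∈ ((annotationMachine k s N loc glob).toCFM k s).Acc ↔
      AccOk glob (List.ofFn fun p => CFMCode.num (g p)) := by
  change (_ ∈ List.filter _ _) ↔ _
  rw [List.mem_filter, decide_eq_true_iff]
  refine and_iff_right ?_
  rw [mem_tuples]
  refine ⟨by simp, fun x hx => ?_⟩
  obtain ⟨p, rfl⟩ := (List.mem_ofFn' _ _).1 hx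
  exact List.mem_range.2 (CFMCode.num_lt p _)

theorem CFM.Run.num_final {c : CFMCode} {M : MSC (Fin k) (Fin s)} (r : (c.toCFM k s).Run M)
    (p : Fin k) :
    CFMCode.num (r.final p) =
      valueAt (fun e => CFMCode.num (r.tr e).target) (fun e : M.E => IsLast p e) := by
  unfold CFM.Run.final
  split_ifs with h
  · have hl : IsLast p (⟨p, ⟨(M.word p).length - 1, by omega⟩⟩ : M.E) :=
      ⟨rfl, by rw [exists_procEdge_right]; simp only; omega⟩
    rw [valueAt_eq hl fun g hg => hg.unique hl]
  · rw [valueAt_none]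
    · rfl
    · rintro ⟨⟨q, i⟩, rfl, -⟩
      exact h (Nat.zero_lt_of_lt i.2)

/-- The annotations that an accepting run passes through satisfy both conditions. Announcements are
confirmed by the next event of the process and by the partner of a message, and the acceptance
condition excludes that a last event announces a successor. -/
theorem exists_annotation_of_run {M : MSC (Fin k) (Fin s)}
    (r : ((annotationMachine k s N loc glob).toCFM k s).Run M)
    (hr : r.final ∈ ((annotationMachine k s N loc glob).toCFM k s).Acc) :
    ∃ γ : M.E → ℕ, (∀ e, loc (localArgs γ e)) ∧
      glob (List.ofFn fun p => valueAt γ (fun e : M.E => IsLast p e)) := by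
  have ok : ∀ e, TransOk loc (e.1.val, CFMCode.num (r.tr e).source, (r.tr e).action.code,
      CFMCode.num (r.tr e).target) := fun e => (annotationMachine_trans _ _).1 (r.tr_mem e)
  obtain ⟨hacc, hglob⟩ := (annotationMachine_acc _).1 hr
  set S : M.E → ℕ := fun e => CFMCode.num (r.tr e).source with hS
  set T : M.E → ℕ := fun e => CFMCode.num (r.tr e).target with hT
  have hne : ∀ e, (T e).unpair.1 ≠ 0 := fun e => (ok e).1
  have hsrc : ∀ e f, ProcEdge e f → T e = S f := by
    rintro ⟨p, i⟩ ⟨q, j⟩ ⟨h1, h2⟩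
    obtain rfl : p = q := h1
    obtain ⟨j, hj⟩ := j
    simp only at h2
    subst h2
    exact congrArg CFMCode.num (r.target_eq_source p i.val hj)
  have hsrc0 : ∀ e, (¬ ∃ f, ProcEdge f e) → S e = 0 := by
    rintro ⟨p, ⟨i, hi⟩⟩ h
    rw [exists_procEdge_left, not_not] at h
    simp only at h
    subst h
    exact congrArg CFMCode.num (r.source_first p hi)
  have hnext : ∀ e f, ProcEdge e f → (T e).unpair.2 = (T f).unpair.1 := by
    intro e f h
    rcases (ok f).2.1 with h0 | h0
    · have h1 : T e = 0 := (hsrc e f h).trans h0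
      exact absurd (by rw [h1]; rfl) (hne e)
    · rw [hsrc e f h]; exact h0
  have hlast : ∀ e, (¬ ∃ f, ProcEdge e f) → (T e).unpair.2 = 0 := by
    intro e h
    have := hacc (CFMCode.num (r.final e.1)) ((List.mem_ofFn' _ _).2 ⟨e.1, rfl⟩)
    rw [r.num_final, valueAt_eq (f := e) ⟨rfl, h⟩ (fun g hg => hg.unique ⟨rfl, h⟩)] at this
    exact this
  have hcode : ∀ e f, M.msg e f → ∃ m : ℕ,
      (r.tr e).action.code = ((M.label e).val, some (true, m, f.1.val)) ∧
      (r.tr f).action.code = ((M.label f).val, some (false, m, e.1.val)) := by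
    intro e f h
    obtain ⟨a, b, m, h1, h2⟩ := r.message e f h
    have l1 := r.label_eq e
    have l2 := r.label_eq f
    rw [h1] at l1 ⊢
    rw [h2] at l2 ⊢
    refine ⟨Fin.val (n := N ^ 2) m, ?_, ?_⟩
    · rw [← l1]; rfl
    · rw [← l2]; rfl
  have hint : ∀ e, M.Internal e → (r.tr e).action.code = ((M.label e).val, none) := by
    intro e h
    obtain ⟨a, h1⟩ := r.internal e h
    have l1 := r.label_eq e
    rw [h1] at l1 ⊢
    rw [← l1]; rfl
  refine ⟨fun e => (T e).unpair.1, fun e => ?_, ?_⟩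
  · have hprev : (S e).unpair.1 = valueAt (fun e => (T e).unpair.1) (fun f => ProcEdge f e) := by
      by_cases h : ∃ f, ProcEdge f e
      · obtain ⟨f, hf⟩ := h
        rw [valueAt_eq (R := fun f => ProcEdge f e) hf fun g hg => hg.left_unique hf,
          hsrc f e hf]
      · rw [valueAt_none h, hsrc0 e h]; rfl
    have hnx : (T e).unpair.2 = valueAt (fun e => (T e).unpair.1) (fun f => ProcEdge e f) := by
      by_cases h : ∃ f, ProcEdge e f
      · obtain ⟨f, hf⟩ := h
        rw [valueAt_eq hf fun g hg => hg.right_unique hf, hnext e f hf]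
      · rw [valueAt_none h, hlast e h]
    have key := (ok e).2.2.2
    simp only at key
    unfold localArgs
    rw [← hprev, ← hnx]
    by_cases h1 : ∃ f, M.msg f e
    · obtain ⟨f, hf⟩ := h1
      have h2 : ¬ ∃ g, M.msg e g := fun ⟨g, hg⟩ => M.not_msg_msg hf hg
      obtain ⟨m, c1, c2⟩ := hcode f e hf
      have o1 := (ok f).2.2.1
      rw [valueAt_eq (R := fun f => M.msg f e) hf fun g hg => M.msg_left_unique hg hf,
        valueAt_none h2]
      have o2 : m.unpair.1 = (T f).unpair.1 := by simpa [c1] using o1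
      simp only [c2, Option.getD_some] at key
      simpa [o2] using key
    · by_cases h2 : ∃ g, M.msg e g
      · obtain ⟨f, hf⟩ := h2
        obtain ⟨m, c1, c2⟩ := hcode e f hf
        have o1 := (ok f).2.2.1
        rw [valueAt_eq hf fun g hg => M.msg_right_unique hg hf, valueAt_none h1]
        have o2 : m.unpair.2 = (T f).unpair.1 := by simpa [c2] using o1
        simp only [c1, Option.getD_some] at key
        simpa [o2] using key
      · rw [valueAt_none h1, valueAt_none h2]
        have c := hint e fun f => ⟨fun h => h2 ⟨f, h⟩, fun h => h1 ⟨f, h⟩⟩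
        simp only [c] at key
        simpa using key
  · rw [List.map_ofFn] at hglob
    convert hglob using 2
    funext p
    rw [Function.comp_apply, r.num_final]
    by_cases h : ∃ e : M.E, IsLast p e
    · obtain ⟨e, he⟩ := h
      rw [valueAt_eq he fun g hg => hg.unique he, valueAt_eq he fun g hg => hg.unique he]
    · rw [valueAt_none h, valueAt_none h]; rfl

theorem pair_lt_sq {a b N : ℕ} (ha : a < N) (hb : b < N) : Nat.pair a b < N ^ 2 :=
  (Nat.pair_lt_max_add_one_sq a b).trans_le (Nat.pow_le_pow_left (by omega) 2)

/-- A state of the annotation machine, given by its number. -/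
def CFMCode.state (p : Fin k) (x : ℕ) (h : x < N ^ 2 + 1) :
    ((annotationMachine k s N loc glob).toCFM k s).State p :=
  (⟨x, h.trans_eq (by rw [annotationMachine_getD])⟩ :
    Fin ((annotationMachine k s N loc glob).1.getD p.val 0 + 1))

open Classical in
/-- The action that carries the label of an event and the annotations of the sender and the receiver
of its message. -/
noncomputable def annotationAction {M : MSC (Fin k) (Fin s)} (γ : M.E → ℕ) (hγ : ∀ e, γ e < N)
    (e : M.E) : Action e.1 (Fin s) (Fin (N ^ 2)) :=
  if h : ∃ f, M.msg e f then
    .send (M.label e) ⟨Nat.pair (γ e) (γ h.choose), pair_lt_sq (hγ _) (hγ _)⟩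
      ⟨h.choose.1, (M.msg_ne _ _ h.choose_spec).symm⟩
  else if h : ∃ f, M.msg f e then
    .receive (M.label e) ⟨Nat.pair (γ h.choose) (γ e), pair_lt_sq (hγ _) (hγ _)⟩
      ⟨h.choose.1, M.msg_ne _ _ h.choose_spec⟩
  else .internal (M.label e)

theorem annotationAction_send {M : MSC (Fin k) (Fin s)} (γ : M.E → ℕ) (hγ : ∀ e, γ e < N)
    {e f : M.E} (h : M.msg e f) :
    annotationAction γ hγ e = .send (M.label e) ⟨Nat.pair (γ e) (γ f), pair_lt_sq (hγ _) (hγ _)⟩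
      ⟨f.1, (M.msg_ne _ _ h).symm⟩ := by
  have h' : ∃ f, M.msg e f := ⟨f, h⟩
  have : h'.choose = f := M.msg_right_unique h'.choose_spec h
  rw [annotationAction, dif_pos h']
  congr 1
  · rw [Fin.mk.injEq, this]
  · rw [Subtype.mk.injEq, this]

theorem annotationAction_receive {M : MSC (Fin k) (Fin s)} (γ : M.E → ℕ) (hγ : ∀ e, γ e < N)
    {e f : M.E} (h : M.msg e f) :
    annotationAction γ hγ f = .receive (M.label f)
      ⟨Nat.pair (γ e) (γ f), pair_lt_sq (hγ _) (hγ _)⟩ ⟨e.1, M.msg_ne _ _ h⟩ := by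
  have h' : ∃ e, M.msg e f := ⟨e, h⟩
  have : h'.choose = e := M.msg_left_unique h'.choose_spec h
  rw [annotationAction, dif_neg fun ⟨g, hg⟩ => M.not_msg_msg h hg, dif_pos h']
  congr 1
  · rw [Fin.mk.injEq, this]
  · rw [Subtype.mk.injEq, this]

theorem annotationAction_internal {M : MSC (Fin k) (Fin s)} (γ : M.E → ℕ) (hγ : ∀ e, γ e < N)
    {e : M.E} (h : M.Internal e) : annotationAction γ hγ e = .internal (M.label e) := by
  rw [annotationAction, dif_neg fun ⟨g, hg⟩ => (h g).1 hg, dif_neg fun ⟨g, hg⟩ => (h g).2 hg]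

open Classical in
/-- An annotation that satisfies both conditions yields an accepting run. Annotations are positive
because `0` announces that there is no next event. -/
theorem exists_run_of_annotation {M : MSC (Fin k) (Fin s)} (γ : M.E → ℕ)
    (hγ : ∀ e, γ e < N) (h0 : ∀ e, γ e ≠ 0) (hloc : ∀ e, loc (localArgs γ e))
    (hglob : glob (List.ofFn fun p => valueAt γ (fun e : M.E => IsLast p e))) :
    M ∈ ((annotationMachine k s N loc glob).toCFM k s).language := by
  have hN : 0 < N := by
    obtain ⟨p, hp⟩ := M.nonempty
    exact Nat.zero_lt_of_lt (hγ ⟨p, ⟨0, List.length_pos_iff.2 hp⟩⟩)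
  let S : M.E → ℕ := fun e => if ∃ f, ProcEdge f e then
    Nat.pair (valueAt γ (fun f => ProcEdge f e)) (γ e) else 0
  let T : M.E → ℕ := fun e => Nat.pair (γ e) (valueAt γ (fun f => ProcEdge e f))
  have hS : ∀ e, S e < N ^ 2 + 1 := fun e => by
    simp only [S]; split_ifs
    · exact (pair_lt_sq (valueAt_lt hN hγ) (hγ e)).trans (Nat.lt_succ_self _)
    · omega
  have hT : ∀ e, T e < N ^ 2 + 1 := fun e =>
    (pair_lt_sq (hγ e) (valueAt_lt hN hγ)).trans (Nat.lt_succ_self _)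
  have hST : ∀ e f, ProcEdge e f → T e = S f := fun e f h => by
    simp only [S, T]
    rw [if_pos ⟨e, h⟩, valueAt_eq h fun g hg => hg.right_unique h,
      valueAt_eq (R := fun g => ProcEdge g f) h fun g hg => hg.left_unique h]
  let r : ((annotationMachine k s N loc glob).toCFM k s).Run M :=
    { tr := fun e => ⟨CFMCode.state e.1 (S e) (hS e), annotationAction γ hγ e,
        CFMCode.state e.1 (T e) (hT e)⟩
      tr_mem := fun e => by
        refine (annotationMachine_trans _ _).2 ?_
        have hk := hloc e
        have e1 : (S e).unpair.1 = valueAt γ (fun f => ProcEdge f e) := by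
          simp only [S]; split_ifs with h
          · simp
          · rw [valueAt_none h]; rfl
        refine ⟨?_, ?_, ?_, ?_⟩
        · change (T e).unpair.1 ≠ 0
          simpa [T] using h0 e
        · change S e = 0 ∨ (S e).unpair.2 = (T e).unpair.1
          simp only [S, T]; split_ifs <;> simp
        · change (annotationAction γ hγ e).code.2 = none ∨ _ = (T e).unpair.1
          by_cases h1 : ∃ f, M.msg e f
          · obtain ⟨f, hf⟩ := h1
            right
            simp [annotationAction_send γ hγ hf, Action.code, T]
          · by_cases h2 : ∃ f, M.msg f e
            · obtain ⟨f, hf⟩ := h2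
              right
              simp [annotationAction_receive γ hγ hf, Action.code, T]
            · left
              rw [annotationAction_internal γ hγ fun f =>
                ⟨fun h => h1 ⟨f, h⟩, fun h => h2 ⟨f, h⟩⟩]
              rfl
        · change loc (e.1.val, (annotationAction γ hγ e).code.1, (T e).unpair.1, (S e).unpair.1,
            (T e).unpair.2, _, _)
          simp only [localArgs] at hk
          rw [e1]
          simp only [T, Nat.unpair_pair]
          by_cases h1 : ∃ f, M.msg e f
          · obtain ⟨f, hf⟩ := h1
            have h2 : ¬ ∃ g, M.msg g e := fun ⟨g, hg⟩ => M.not_msg_msg hg hf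
            rw [valueAt_none h2, valueAt_eq hf fun g hg => M.msg_right_unique hg hf] at hk
            simpa [annotationAction_send γ hγ hf, Action.code] using hk
          · by_cases h2 : ∃ f, M.msg f e
            · obtain ⟨f, hf⟩ := h2
              rw [valueAt_none h1, valueAt_eq (R := fun f => M.msg f e) hf
                fun g hg => M.msg_left_unique hg hf] at hk
              simpa [annotationAction_receive γ hγ hf, Action.code] using hk
            · rw [valueAt_none h1, valueAt_none h2] at hk
              simpa [annotationAction_internal γ hγ fun f =>
                ⟨fun h => h1 ⟨f, h⟩, fun h => h2 ⟨f, h⟩⟩, Action.code] using hk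
      label_eq := fun e => by
        change (annotationAction γ hγ e).label = _
        unfold annotationAction
        split_ifs <;> rfl
      source_first := fun p h => by
        refine Fin.ext ?_
        change S _ = 0
        simp only [S]
        rw [if_neg]
        rw [exists_procEdge_left]
        simp
      target_eq_source := fun p i h => by
        refine Fin.ext ?_
        exact hST _ _ ⟨rfl, rfl⟩
      internal := fun e h => ⟨_, annotationAction_internal γ hγ h⟩
      message := fun e f h =>
        ⟨_, _, _, annotationAction_send γ hγ h, annotationAction_receive γ hγ h⟩ }
  have hfin : ∀ p, CFMCode.num (r.final p) =
      Nat.pair (valueAt γ (fun e : M.E => IsLast p e)) 0 := by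
    intro p
    rw [r.num_final]
    change valueAt T _ = _
    by_cases h : ∃ e : M.E, IsLast p e
    · obtain ⟨e, he⟩ := h
      rw [valueAt_eq he fun g hg => hg.unique he, valueAt_eq he fun g hg => hg.unique he]
      simp only [T]
      rw [valueAt_none he.2]
    · rw [valueAt_none h, valueAt_none h]; rfl
  refine ⟨r, (annotationMachine_acc _).2 ⟨?_, ?_⟩⟩
  · intro x hx
    obtain ⟨p, rfl⟩ := (List.mem_ofFn' _ _).1 hx
    simp only [hfin, Nat.unpair_pair]
  · simp only [hfin, List.map_ofFn]
    convert hglob using 2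
    funext p
    simp

end Machine

section Computable
variable {α : Type} [Primcodable α]

@[fun_prop] theorem primrec_replicate {β : Type} [Primcodable β] {f : α → ℕ} {g : α → β}
    (hf : Primrec f) (hg : Primrec g) : Primrec fun a => List.replicate (f a) (g a) :=
  Primrec.of_eq (f := fun a => (List.range (f a)).map fun _ => g a) (by fun_prop)
    fun a => by simp

@[fun_prop] theorem primrec_option_getD {β : Type} [Primcodable β] {f : α → Option β} {d : β}
    (hf : Primrec f) : Primrec fun a => (f a).getD d :=
  Primrec.option_getD.comp hf (Primrec.const d)

/-- The annotation machine is computable, uniformly in conditions that depend on a parameter. -/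
theorem primrec_annotationMachine {k s N : α → ℕ} {loc : α → LocalArgs → Prop}
    {glob : α → List ℕ → Prop} (hk : Primrec k) (hs : Primrec s) (hN : Primrec N)
    (hloc : PrimrecPred fun x : α × LocalArgs => loc x.1 x.2)
    (hglob : PrimrecPred fun x : α × List ℕ => glob x.1 x.2) :
    Primrec fun a => annotationMachine (k a) (s a) (N a) (loc a) (glob a) := by
  have h1 : PrimrecPred fun x : α × (ℕ × ℕ × ActionCode × ℕ) => TransOk (loc x.1) x.2 := by
    have key : ∀ {g : α × (ℕ × ℕ × ActionCode × ℕ) → LocalArgs}, Primrec g →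
        PrimrecPred fun x => loc x.1 (g x) := fun {g} hg =>
      hloc.comp (f := fun x : α × (ℕ × ℕ × ActionCode × ℕ) => (x.1, g x)) (by fun_prop)
    unfold TransOk
    refine .and (by fun_prop) (.and (by fun_prop) (.and (by fun_prop) (key ?_)))
    fun_prop
  have h2 : PrimrecPred fun x : α × List ℕ => AccOk (glob x.1) x.2 := by
    unfold AccOk
    exact .and (by fun_prop) (hglob.comp (f := fun x : α × List ℕ =>
      (x.1, x.2.map fun z => z.unpair.1)) (by fun_prop))
  unfold annotationMachine transCodes actionCodes
  fun_prop

end Computable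

/-! ### The order of a chart and counting along a process -/

/-- The order of the events of one process. -/
def PLe {P Lab : Type} {w : P → List Lab} (e f : Event w) : Prop := e.1 = f.1 ∧ e.2.val ≤ f.2.val

section PLe
variable {P Lab : Type} {w : P → List Lab} {e f g : Event w}

theorem PLe.refl (e : Event w) : PLe e e := ⟨rfl, le_rfl⟩

theorem PLe.trans (h : PLe e f) (h' : PLe f g) : PLe e g := ⟨h.1.trans h'.1, h.2.trans h'.2⟩

theorem ple_total (h : e.1 = f.1) : PLe e f ∨ PLe f e :=
  (le_total e.2.val f.2.val).imp (fun h' => ⟨h, h'⟩) fun h' => ⟨h.symm, h'⟩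

theorem ProcEdge.ple (h : ProcEdge e f) : PLe e f := ⟨h.1, by have := h.2; omega⟩

theorem ProcEdge.not_ple (h : ProcEdge e f) : ¬ PLe f e := fun h' => by
  have := h.2; have := h'.2; omega

theorem ProcEdge.ple_iff (h : ProcEdge e f) : PLe g f ↔ PLe g e ∨ g = f := by
  constructor
  · intro h'
    by_cases hg : g.2.val ≤ e.2.val
    · exact Or.inl ⟨h'.1.trans h.1.symm, hg⟩
    · exact Or.inr (Event.ext' h'.1 (by have := h.2; have := h'.2; omega))
  · rintro (h' | rfl)
    · exact h'.trans h.ple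
    · exact .refl _

theorem ple_iff_eq_of_first (h : ¬ ∃ f, ProcEdge f e) : PLe g e ↔ g = e := by
  rw [exists_procEdge_left, not_not] at h
  refine ⟨fun h' => Event.ext' h'.1 (by have := h'.2; omega), fun h' => h' ▸ .refl _⟩

theorem reflTransGen_procEdge : Relation.ReflTransGen ProcEdge e f ↔ PLe e f := by
  constructor
  · intro h
    induction h with
    | refl => exact .refl _
    | tail _ h ih => exact ih.trans h.ple
  · rintro ⟨h, h'⟩
    obtain ⟨p, i, hi⟩ := e; obtain ⟨q, j, hj⟩ := f
    obtain rfl : p = q := h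
    simp only at h'
    induction j, h' using Nat.le_induction with
    | base => exact .refl
    | succ j _ ih => exact (ih (Nat.lt_of_succ_lt hj)).tail ⟨rfl, rfl⟩

theorem procInduction {C : Event w → Prop} (h : ∀ e, (∀ f, ProcEdge f e → C f) → C e)
    (e : Event w) : C e := by
  induction hn : e.2.val generalizing e with
  | zero => exact h e fun f hf => absurd hn (by have := hf.2; omega)
  | succ n ih => exact h e fun f hf => ih f (by have := hf.2; omega)

end PLe

namespace MSC
variable {P Lab : Type} {M : MSC P Lab} {e f g : M.E}

theorem le_refl (e : M.E) : M.le e e := .refl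

theorem le.trans (h : M.le e f) (h' : M.le f g) : M.le e g := Relation.ReflTransGen.trans h h'

theorem le_of_ple (h : PLe e f) : M.le e f :=
  Relation.ReflTransGen.mono (fun _ _ => Or.inl) _ _ (reflTransGen_procEdge.2 h)

theorem le_of_msg (h : M.msg e f) : M.le e f := .single (Or.inr h)

theorem le.antisymm (h : M.le e f) (h' : M.le f e) : e = f := by
  rcases Relation.reflTransGen_iff_eq_or_transGen.1 h with rfl | h1
  · rfl
  · exact absurd (h1.trans_left h') (M.acyclic e)

theorem ple_of_le (h : M.le e f) (hp : e.1 = f.1) : PLe e f := by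
  rcases ple_total hp with h' | h'
  · exact h'
  · rw [h.antisymm (le_of_ple h')]; exact .refl _

theorem le_iff (e f : M.E) :
    M.le e f ↔ e = f ∨ (∃ g, ProcEdge g f ∧ M.le e g) ∨ (∃ g, M.msg g f ∧ M.le e g) := by
  constructor
  · intro h
    rcases Relation.ReflTransGen.cases_tail h with h | ⟨g, h, h' | h'⟩
    · exact Or.inl h.symm
    · exact Or.inr (Or.inl ⟨g, h', h⟩)
    · exact Or.inr (Or.inr ⟨g, h', h⟩)
  · rintro (rfl | ⟨g, h, h'⟩ | ⟨g, h, h'⟩)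
    · exact le_refl _
    · exact h'.trans (le_of_ple h.ple)
    · exact h'.trans (le_of_msg h)

theorem le_iff' (e f : M.E) :
    M.le e f ↔ e = f ∨ (∃ g, ProcEdge e g ∧ M.le g f) ∨ (∃ g, M.msg e g ∧ M.le g f) := by
  constructor
  · intro h
    rcases Relation.ReflTransGen.cases_head h with h | ⟨g, h' | h', h⟩
    · exact Or.inl h
    · exact Or.inr (Or.inl ⟨g, h', h⟩)
    · exact Or.inr (Or.inr ⟨g, h', h⟩)
  · rintro (rfl | ⟨g, h, h'⟩ | ⟨g, h, h'⟩)
    · exact le_refl _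
    · exact (le_of_ple h.ple).trans h'
    · exact (le_of_msg h).trans h'

theorem ple_iff_ple {e' f' : M.E} (h : M.msg e f) (h' : M.msg e' f') (h1 : e.1 = e'.1)
    (h2 : f.1 = f'.1) : PLe e e' ↔ PLe f f' := by
  have := M.fifo _ _ _ _ h h' h1 h2
  rwa [reflTransGen_procEdge, reflTransGen_procEdge] at this

theorem causalInduction [Finite P] {C : M.E → Prop}
    (h : ∀ e, (∀ f, ProcEdge f e ∨ M.msg f e → C f) → C e) (e : M.E) : C e := by
  have : IsTrans M.E (Relation.TransGen fun e f => ProcEdge e f ∨ M.msg e f) :=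
    ⟨fun _ _ _ => Relation.TransGen.trans⟩
  have : Std.Irrefl (Relation.TransGen fun e f : M.E => ProcEdge e f ∨ M.msg e f) := ⟨M.acyclic⟩
  have wf := Finite.wellFounded_of_trans_of_irrefl
    (Relation.TransGen fun e f : M.E => ProcEdge e f ∨ M.msg e f)
  exact wf.induction e fun e ih => h e fun f hf => ih f (.single hf)

theorem causalInduction' [Finite P] {C : M.E → Prop}
    (h : ∀ e, (∀ f, ProcEdge e f ∨ M.msg e f → C f) → C e) (e : M.E) : C e := by
  have : IsTrans M.E (flip (Relation.TransGen fun e f => ProcEdge e f ∨ M.msg e f)) :=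
    ⟨fun _ _ _ h h' => Relation.TransGen.trans h' h⟩
  have : Std.Irrefl (flip (Relation.TransGen fun e f : M.E => ProcEdge e f ∨ M.msg e f)) :=
    ⟨M.acyclic⟩
  have wf := Finite.wellFounded_of_trans_of_irrefl
    (flip (Relation.TransGen fun e f : M.E => ProcEdge e f ∨ M.msg e f))
  exact wf.induction e fun e ih => h e fun f hf => ih f (.single hf)

end MSC

open Classical in
/-- The truth value of a proposition as a number. -/
noncomputable def ind (p : Prop) : ℕ := if p then 1 else 0

theorem ind_true {p : Prop} (h : p) : ind p = 1 := if_pos h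
theorem ind_false {p : Prop} (h : ¬ p) : ind p = 0 := if_neg h
theorem ind_le (p : Prop) : ind p ≤ 1 := by unfold ind; split_ifs <;> omega

section Count
variable {k : ℕ} {Lab : Type} {M : MSC (Fin k) Lab}

/-- The number of events with property `Q` up to `e` on the process of `e`. -/
noncomputable def count (Q : M.E → Prop) (e : M.E) : ℕ := {x | Q x ∧ PLe x e}.ncard

theorem count_succ {Q : M.E → Prop} {e f : M.E} (h : ProcEdge f e) :
    count Q e = count Q f + ind (Q e) := by
  unfold count
  by_cases hQ : Q e
  · have : {x | Q x ∧ PLe x e} = insert e {x | Q x ∧ PLe x f} := by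
      ext x
      simp only [Set.mem_ofPred_eq, Set.mem_insert_iff, h.ple_iff]
      constructor
      · tauto
      · rintro (rfl | h) <;> tauto
    rw [this, Set.ncard_insert_of_notMem (fun h' => h.not_ple h'.2) (Set.toFinite _),
      ind_true hQ]
  · rw [ind_false hQ, add_zero]
    congr 1
    ext x
    simp only [Set.mem_ofPred_eq, h.ple_iff]
    constructor
    · rintro ⟨h1, h2 | rfl⟩ <;> tauto
    · tauto

theorem count_first {Q : M.E → Prop} {e : M.E} (h : ¬ ∃ f, ProcEdge f e) :
    count Q e = ind (Q e) := by
  unfold count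
  simp only [ple_iff_eq_of_first h]
  by_cases hQ : Q e
  · have : {x | Q x ∧ x = e} = {e} := by ext x; simp; rintro rfl; exact hQ
    rw [this, ind_true hQ, Set.ncard_singleton]
  · have : {x | Q x ∧ x = e} = ∅ := by ext x; simp; rintro h rfl; exact hQ ‹_›
    rw [this, ind_false hQ, Set.ncard_empty]

theorem exists_count_eq {Q : M.E → Prop} {j : ℕ} (hj : 1 ≤ j) (e : M.E) (h : j ≤ count Q e) :
    ∃ f, Q f ∧ PLe f e ∧ count Q f = j := by
  induction e using procInduction with
  | h e ih =>
    by_cases hQ : count Q e = j ∧ Q e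
    · exact ⟨e, hQ.2, .refl _, hQ.1⟩
    · by_cases he : ∃ f, ProcEdge f e
      · obtain ⟨f, hf⟩ := he
        have hc := count_succ (Q := Q) hf
        have : j ≤ count Q f := by
          by_cases h' : Q e
          · rw [ind_true h'] at hc
            have : count Q e ≠ j := fun h'' => hQ ⟨h'', h'⟩
            omega
          · rw [ind_false h'] at hc; omega
        obtain ⟨g, hg, hg', h''⟩ := ih f hf this
        exact ⟨g, hg, hg'.trans hf.ple, h''⟩
      · have hc := count_first (Q := Q) he
        by_cases h' : Q e
        · rw [ind_true h'] at hc
          exact absurd ⟨by omega, h'⟩ hQ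
        · rw [ind_false h'] at hc; omega

theorem exists_isLast (e : M.E) : ∃ f, IsLast e.1 f ∧ PLe e f := by
  obtain ⟨p, i⟩ := e
  have hi := i.2
  refine ⟨⟨p, ⟨(M.word p).length - 1, by omega⟩⟩, ⟨rfl, ?_⟩, rfl, ?_⟩
  · rw [exists_procEdge_right]; simp only; omega
  · simp only; omega

theorem ple_of_isLast {p : Fin k} {e f : M.E} (h : IsLast p f) (he : e.1 = p) : PLe e f := by
  obtain ⟨g, hg, hg'⟩ := exists_isLast e
  rw [he] at hg
  rwa [h.unique hg]

end Count

/-! ### Causal paths along a fixed sequence of processes -/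

section Signals
variable {k : ℕ} {Lab : Type} {M : MSC (Fin k) Lab}

/-- `Reach w i x e` says that `x` is on process `w 0`, `e` is on process `w i`, and a causal path leads
from `x` to `e` whose messages go from `w 0` to `w 1`, from `w 1` to `w 2`, …, to `w i`. -/
def Reach (M : MSC (Fin k) Lab) (w : ℕ → ℕ) : ℕ → M.E → M.E → Prop
  | 0, x, e => x.1.val = w 0 ∧ PLe x e
  | i + 1, x, e => e.1.val = w (i + 1) ∧ ∃ g h, Reach M w i x g ∧ M.msg g h ∧ PLe h e

variable {w : ℕ → ℕ} {i : ℕ} {x y e f : M.E}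

theorem Reach.proc (h : Reach M w i x e) : e.1.val = w i := by
  cases i with
  | zero => rw [← h.2.1]; exact h.1
  | succ i => exact h.1

theorem Reach.mono (h : Reach M w i x e) (h' : PLe e f) : Reach M w i x f := by
  cases i with
  | zero => exact ⟨h.1, h.2.trans h'⟩
  | succ i =>
    obtain ⟨h1, g, g', h2, h3, h4⟩ := h
    exact ⟨h'.1 ▸ h1, g, g', h2, h3, h4.trans h'⟩

theorem Reach.down (h : Reach M w i x e) (h' : PLe y x) : Reach M w i y e := by
  induction i generalizing e with
  | zero => exact ⟨h'.1 ▸ h.1, h'.trans h.2⟩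
  | succ i ih =>
    obtain ⟨h1, g, g', h2, h3, h4⟩ := h
    exact ⟨h1, g, g', ih h2, h3, h4⟩

theorem Reach.src (h : Reach M w i x e) : x.1.val = w 0 := by
  induction i generalizing e with
  | zero => exact h.1
  | succ i ih =>
    obtain ⟨h1, g, g', h2, h3, h4⟩ := h
    exact ih h2

theorem Reach.le (h : Reach M w i x e) : M.le x e := by
  induction i generalizing e with
  | zero => exact MSC.le_of_ple h.2
  | succ i ih =>
    obtain ⟨h1, g, g', h2, h3, h4⟩ := h
    exact (ih h2).trans ((MSC.le_of_msg h3).trans (MSC.le_of_ple h4))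

/-- Messages are received in the order in which they are sent, so the last message received
on a channel carries the most recent information. -/
theorem reach_succ_iff (hm : M.msg e f) (he : e.1.val = w i) (hf : f.1.val = w (i + 1)) :
    Reach M w (i + 1) x f ↔ Reach M w i x e := by
  constructor
  · rintro ⟨-, g, h, h1, h2, h3⟩
    refine h1.mono ((MSC.ple_iff_ple h2 hm ?_ h3.1).2 h3)
    exact Fin.ext (h1.proc.trans he.symm)
  · intro h
    exact ⟨hf, e, f, h, hm, .refl _⟩

theorem reach_succ_of_not_msg (he : e.1.val = w (i + 1))
    (hn : ¬ ∃ g, M.msg g e ∧ g.1.val = w i) :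
    Reach M w (i + 1) x e ↔ ∃ f, ProcEdge f e ∧ Reach M w (i + 1) x f := by
  constructor
  · rintro ⟨-, g, h, h1, h2, h3⟩
    have hne : h ≠ e := by
      rintro rfl; exact hn ⟨g, h2, h1.proc⟩
    obtain ⟨f, hf⟩ := (exists_procEdge_left e).2 (by
      intro h0
      exact hne (Event.ext' h3.1 (by have := h3.2; omega)))
    refine ⟨f, hf, ?_, g, h, h1, h2, (hf.ple_iff.1 h3).resolve_right hne⟩
    rw [← he, hf.1]
  · rintro ⟨f, hf, h⟩
    exact h.mono hf.ple

/-- Every path to position `m` uses, for each `i < m`, a message from process `w i` to process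
`w (i + 1)`. -/
theorem Reach.exists_send {m : ℕ} (h : Reach M w m x e) (hi : i < m) :
    ∃ g, (∃ g', M.msg g g' ∧ g'.1.val = w (i + 1)) ∧ Reach M w i x g ∧
      ∀ y, Reach M w i y g → Reach M w m y e := by
  induction m generalizing e with
  | zero => omega
  | succ m ih =>
    obtain ⟨h1, g, g', h2, h3, h4⟩ := h
    rcases Nat.lt_succ_iff_lt_or_eq.1 hi with hi | rfl
    · obtain ⟨g1, h5, h6, h7⟩ := ih h2 hi
      exact ⟨g1, h5, h6, fun y hy => ⟨h1, g, g', h7 y hy, h3, h4⟩⟩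
    · refine ⟨g, ⟨g', h3, by rw [h4.1]; exact h1⟩, h2, fun y hy => ⟨h1, g, g', hy, h3, h4⟩⟩

/-- The number of events with property `X` from which `e` is reachable along `w`. -/
noncomputable def reachCount (w : ℕ → ℕ) (X : M.E → Prop) (i : ℕ) (e : M.E) : ℕ :=
  {x | X x ∧ Reach M w i x e}.ncard

/-! ### Forwarding the number of marked events along a sequence of processes -/

/-- The rules by which the number of events marked by `X` on process `w 0` is forwarded along the
sequence of processes `w 0, …, w m`. At an event of process `w i`, `inc i` says that the number known
there grows by one, `tot i` that the next message to `w (i + 1)` sent from there on would announce an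
increment, and `pend i` that this increment is still to be announced after the event. The rule
`disj` says that the number grows by at most one between two messages to the next process. -/
structure SignalRules (M : MSC (Fin k) Lab) (w : ℕ → ℕ) (m : ℕ) (X : M.E → Prop)
    (inc tot pend : ℕ → M.E → Prop) : Prop where
  inc_zero : ∀ e : M.E, e.1.val = w 0 → (inc 0 e ↔ X e)
  inc_succ : ∀ i < m, ∀ e : M.E, e.1.val = w (i + 1) →
    (inc (i + 1) e ↔ ∃ g, M.msg g e ∧ g.1.val = w i ∧ tot i g)
  disj : ∀ i < m, ∀ e : M.E, e.1.val = w i → ¬ ((∃ g, ProcEdge g e ∧ pend i g) ∧ inc i e)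
  tot_iff : ∀ i < m, ∀ e : M.E, e.1.val = w i →
    (tot i e ↔ (∃ g, ProcEdge g e ∧ pend i g) ∨ inc i e)
  pend_iff : ∀ i < m, ∀ e : M.E, e.1.val = w i →
    (pend i e ↔ tot i e ∧ ¬ ∃ h, M.msg e h ∧ h.1.val = w (i + 1))

namespace SignalRules
variable {m : ℕ} {X : M.E → Prop} {inc tot pend : ℕ → M.E → Prop}

theorem ind_arith {a b t s p : Prop} (hd : ¬ (a ∧ b)) (ht : t ↔ a ∨ b) (hp : p ↔ t ∧ ¬ s) :
    ind (t ∧ s) + ind p = ind a + ind b := by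
  rw [hp, ht]
  by_cases a <;> by_cases b <;> by_cases s <;> simp_all [ind]

/-- What is announced and what is pending add up to what is known. -/
theorem count_sent_add (H : SignalRules M w m X inc tot pend) (hi : i < m) (e : M.E)
    (he : e.1.val = w i) :
    count (fun g => tot i g ∧ ∃ h, M.msg g h ∧ h.1.val = w (i + 1)) e + ind (pend i e) =
      count (inc i) e := by
  induction e using procInduction with
  | h e ih =>
    have hd := H.disj i hi e he
    have ht := H.tot_iff i hi e he
    have hp := H.pend_iff i hi e he
    by_cases hf : ∃ f, ProcEdge f e
    · obtain ⟨f, hf⟩ := hf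
      have hf' : (∃ g, ProcEdge g e ∧ pend i g) ↔ pend i f := by
        constructor
        · rintro ⟨g, hg, h⟩; rwa [hf.left_unique hg]
        · intro h; exact ⟨f, hf, h⟩
      rw [hf'] at hd ht
      have := ih f hf (hf.1 ▸ he)
      have := ind_arith hd ht hp
      rw [count_succ hf, count_succ hf]
      omega
    · have hf' : ¬ ∃ g, ProcEdge g e ∧ pend i g := fun ⟨g, hg, _⟩ => hf ⟨g, hg⟩
      have := ind_arith hd ht hp
      rw [ind_false hf'] at this
      rw [count_first hf, count_first hf]
      omega

/-- The increments received up to a receive event are those announced up to its send event. -/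
theorem count_inc_eq_count_sent (H : SignalRules M w m X inc tot pend) (hi : i < m) {e f : M.E}
    (hm : M.msg e f) (he : e.1.val = w i) (hf : f.1.val = w (i + 1)) :
    count (inc (i + 1)) f =
      count (fun g => tot i g ∧ ∃ h, M.msg g h ∧ h.1.val = w (i + 1)) e := by
  unfold count
  symm
  have hr : ∀ g : M.E, (∃ h, M.msg g h ∧ h.1.val = w (i + 1)) → ∃ h, M.msg g h ∧
      h.1.val = w (i + 1) := fun _ h => h
  choose! r hr1 hr2 using hr
  refine Set.ncard_congr (fun g _ => r g) ?_ ?_ ?_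
  · rintro g ⟨⟨h1, h2⟩, h3⟩
    have hg : g.1.val = w i := by rw [h3.1]; exact he
    exact ⟨(H.inc_succ i hi _ (hr2 g h2)).2 ⟨g, hr1 g h2, hg, h1⟩,
      (MSC.ple_iff_ple (hr1 g h2) hm h3.1 (Fin.ext ((hr2 g h2).trans hf.symm))).1 h3⟩
  · rintro g g' ⟨⟨h1, h2⟩, h3⟩ ⟨⟨h1', h2'⟩, h3'⟩ h
    have := hr1 g h2
    rw [h] at this
    exact M.msg_left_unique this (hr1 g' h2')
  · rintro h ⟨h1, h2⟩
    have hh : h.1.val = w (i + 1) := by rw [h2.1]; exact hf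
    obtain ⟨g, h3, h4, h5⟩ := (H.inc_succ i hi h hh).1 h1
    have h6 : ∃ h, M.msg g h ∧ h.1.val = w (i + 1) := ⟨h, h3, hh⟩
    exact ⟨g, ⟨⟨h5, h6⟩, (MSC.ple_iff_ple h3 hm (Fin.ext (h4.trans he.symm)) h2.1).2 h2⟩,
      M.msg_right_unique (hr1 g h6) h3⟩

/-- The number forwarded along `w` is the number of marked events from which there is a path
along `w`. -/
theorem count_inc (H : SignalRules M w m X inc tot pend)
    (hi : i ≤ m) (e : M.E) (he : e.1.val = w i) : count (inc i) e = reachCount w X i e := by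
  induction i generalizing e with
  | zero =>
    unfold count reachCount
    congr 1
    ext x
    simp only [Set.mem_ofPred_eq, Reach]
    constructor
    · rintro ⟨h1, h2⟩
      have hx : x.1.val = w 0 := by rw [h2.1]; exact he
      exact ⟨(H.inc_zero x hx).1 h1, hx, h2⟩
    · rintro ⟨h1, h2, h3⟩
      exact ⟨(H.inc_zero x h2).2 h1, h3⟩
  | succ i ihi =>
    induction e using procInduction with
    | h e ih =>
      by_cases hg : ∃ g, M.msg g e ∧ g.1.val = w i
      · obtain ⟨g, hg, hgi⟩ := hg
        rw [H.count_inc_eq_count_sent hi hg hgi he]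
        have h1 := H.count_sent_add hi g hgi
        have h2 : ¬ pend i g := fun h => ((H.pend_iff i hi g hgi).1 h).2 ⟨e, hg, he⟩
        rw [ind_false h2, add_zero] at h1
        rw [h1, ihi (by omega) g hgi]
        unfold reachCount
        simp only [reach_succ_iff hg hgi he]
      · have hinc : ¬ inc (i + 1) e := fun h => by
          obtain ⟨g, h1, h2, -⟩ := (H.inc_succ i hi e he).1 h
          exact hg ⟨g, h1, h2⟩
        by_cases hf : ∃ f, ProcEdge f e
        · obtain ⟨f, hf⟩ := hf
          rw [count_succ hf, ind_false hinc, add_zero, ih f hf (hf.1 ▸ he)]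
          unfold reachCount
          congr 1
          ext x
          simp only [Set.mem_ofPred_eq]
          rw [reach_succ_of_not_msg he hg]
          constructor
          · rintro ⟨h1, h2⟩; exact ⟨h1, f, hf, h2⟩
          · rintro ⟨h1, g, h2, h3⟩
            rw [← hf.left_unique h2] at h3
            exact ⟨h1, h3⟩
        · rw [count_first hf, ind_false hinc]
          unfold reachCount
          simp only [reach_succ_of_not_msg he hg]
          symm
          rw [Set.ncard_eq_zero]
          ext x
          simp only [Set.mem_ofPred_eq, Set.mem_empty_iff_false, iff_false]
          rintro ⟨-, f, h, -⟩
          exact hf ⟨f, h⟩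

end SignalRules

/-- The rules can be obeyed if any two marked events can be told apart at the end of `w`. -/
theorem signalRules_of_separated {m : ℕ} {X : M.E → Prop} (hX : ∀ x, X x → x.1.val = w 0)
    (hsep : ∀ x y, X x → X y → PLe x y → x ≠ y → ∃ z, Reach M w m x z ∧ ¬ Reach M w m y z) :
    ∃ inc tot pend, SignalRules M w m X inc tot pend := by
  -- `x` has been announced to the next process before `e`, respectively up to `e`
  let send : ℕ → M.E → Prop := fun i g => ∃ g', M.msg g g' ∧ g'.1.val = w (i + 1)
  refine ⟨fun i e => ∃ x, X x ∧ Reach M w i x e ∧ ∀ f, ProcEdge f e → ¬ Reach M w i x f,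
    fun i e => ∃ x, X x ∧ Reach M w i x e ∧ ∀ g, PLe g e → g ≠ e → send i g → ¬ Reach M w i x g,
    fun i e => ∃ x, X x ∧ Reach M w i x e ∧ ∀ g, PLe g e → send i g → ¬ Reach M w i x g, ?_⟩
  refine ⟨?_, ?_, ?_, ?_, ?_⟩
  · intro e he
    constructor
    · rintro ⟨x, h1, ⟨h2, h3⟩, h4⟩
      by_cases hf : ∃ f, ProcEdge f e
      · obtain ⟨f, hf⟩ := hf
        rcases hf.ple_iff.1 h3 with h | rfl
        · exact absurd ⟨h2, h⟩ (h4 f hf)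
        · exact h1
      · rwa [← (ple_iff_eq_of_first hf).1 h3]
    · intro h
      exact ⟨e, h, ⟨he, .refl _⟩, fun f hf hr => hf.not_ple hr.2⟩
  · intro i hi e he
    constructor
    · rintro ⟨x, h1, h2, h3⟩
      by_cases hg : ∃ g, M.msg g e ∧ g.1.val = w i
      · obtain ⟨g, hg, hgi⟩ := hg
        refine ⟨g, hg, hgi, x, h1, (reach_succ_iff hg hgi he).1 h2, ?_⟩
        rintro g1 h4 h5 ⟨g1', h6, h7⟩ h8
        have h9 : PLe g1' e := (MSC.ple_iff_ple h6 hg h4.1 (Fin.ext (h7.trans he.symm))).1 h4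
        have hne : g1' ≠ e := by
          rintro rfl; exact h5 (M.msg_left_unique h6 hg)
        obtain ⟨f, hf⟩ := (exists_procEdge_left e).2 (by
          intro h0
          exact hne (Event.ext' h9.1 (by have := h9.2; omega)))
        refine h3 f hf ⟨hf.1 ▸ he, g1, g1', h8, h6, (hf.ple_iff.1 h9).resolve_right hne⟩
      · obtain ⟨f, hf, h4⟩ := (reach_succ_of_not_msg he hg).1 h2
        exact absurd h4 (h3 f hf)
    · rintro ⟨g, hg, hgi, x, h1, h2, h3⟩
      refine ⟨x, h1, (reach_succ_iff hg hgi he).2 h2, ?_⟩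
      rintro f hf ⟨h4, g1, g1', h5, h6, h7⟩
      have h8 : PLe g1' e := h7.trans hf.ple
      have h9 : PLe g1 g :=
        (MSC.ple_iff_ple h6 hg (Fin.ext (h5.proc.trans hgi.symm)) h8.1).2 h8
      refine h3 g1 h9 ?_ ⟨g1', h6, by rw [h7.1]; exact h4⟩ h5
      rintro rfl
      rw [M.msg_right_unique h6 hg] at h7
      exact hf.not_ple h7
  · rintro i hi e he ⟨⟨f, hf, x, h1, h2, h3⟩, y, h4, h5, h6⟩
    have hxy : PLe x y ∧ x ≠ y := by
      rcases ple_total (Fin.ext ((hX x h1).trans (hX y h4).symm)) with h | h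
      · refine ⟨h, ?_⟩
        rintro rfl
        exact h6 f hf h2
      · exact absurd (h2.down h) (h6 f hf)
    obtain ⟨z, h7, h8⟩ := hsep x y h1 h4 hxy.1 hxy.2
    obtain ⟨g, hg, h9, h10⟩ := h7.exists_send hi
    have h11 : PLe e g := by
      rcases ple_total (e := g) (f := e) (Fin.ext (h9.proc.trans he.symm)) with h | h
      · rcases hf.ple_iff.1 h with h | rfl
        · exact absurd h9 (h3 g h hg)
        · exact h
      · exact h
    exact h8 (h10 y (h5.mono h11))
  · intro i hi e he
    constructor
    · rintro ⟨x, h1, h2, h3⟩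
      by_cases hp : ∃ f, ProcEdge f e ∧ Reach M w i x f
      · obtain ⟨f, hf, h4⟩ := hp
        exact Or.inl ⟨f, hf, x, h1, h4, fun g hg => h3 g (hg.trans hf.ple) (by
          rintro rfl; exact hf.not_ple hg)⟩
      · exact Or.inr ⟨x, h1, h2, fun f hf h => hp ⟨f, hf, h⟩⟩
    · rintro (⟨f, hf, x, h1, h2, h3⟩ | ⟨x, h1, h2, h3⟩)
      · exact ⟨x, h1, h2.mono hf.ple, fun g hg hne => h3 g ((hf.ple_iff.1 hg).resolve_right hne)⟩
      · refine ⟨x, h1, h2, fun g hg hne _ h => ?_⟩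
        by_cases hf : ∃ f, ProcEdge f e
        · obtain ⟨f, hf⟩ := hf
          exact h3 f hf (h.mono ((hf.ple_iff.1 hg).resolve_right hne))
        · exact hne ((ple_iff_eq_of_first hf).1 hg)
  · intro i hi e he
    constructor
    · rintro ⟨x, h1, h2, h3⟩
      exact ⟨⟨x, h1, h2, fun g hg _ => h3 g hg⟩, fun h => h3 e (.refl _) h h2⟩
    · rintro ⟨⟨x, h1, h2, h3⟩, h4⟩
      refine ⟨x, h1, h2, fun g hg hs => ?_⟩
      by_cases hge : g = e
      · subst hge; exact absurd hs h4
      · exact h3 g hg hge hs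

end Signals

/-! ### Two processes that certify incomparable events -/

section PingPong
variable {k : ℕ} {Lab : Type} {M : MSC (Fin k) Lab}

/-- The rules for a process `u` that marks events by `X` and is told by `J` about the events
marked by a partner: `off` says that one more event has been marked here than is known to be marked
there, `par` says that the number of events marked so far is odd. The numbers of marked events
never differ in another way, and every new mark establishes the difference `1`. -/
structure StationRules (M : MSC (Fin k) Lab) (u : ℕ) (X J off par : M.E → Prop) : Prop where
  both : ∀ e : M.E, e.1.val = u → (off e ∧ J e ↔ (∃ g, ProcEdge g e ∧ off g) ∧ X e)
  any : ∀ e : M.E, e.1.val = u → (off e ∨ J e ↔ (∃ g, ProcEdge g e ∧ off g) ∨ X e)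
  mark : ∀ e : M.E, e.1.val = u → X e → off e
  parity : ∀ e : M.E, e.1.val = u → (par e ↔ ¬ ((∃ g, ProcEdge g e ∧ par g) ↔ X e))

theorem exists_procEdge_and {e f : M.E} (h : ProcEdge f e) (Q : M.E → Prop) :
    (∃ g, ProcEdge g e ∧ Q g) ↔ Q f :=
  ⟨fun ⟨_, hg, hq⟩ => h.left_unique hg ▸ hq, fun hq => ⟨f, h, hq⟩⟩

theorem not_exists_procEdge_and {e : M.E} (h : ¬ ∃ f, ProcEdge f e) (Q : M.E → Prop) :
    ¬ ∃ g, ProcEdge g e ∧ Q g := fun ⟨_, hg, _⟩ => h ⟨_, hg⟩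

theorem ind_add_eq_iff {a b c d : Prop} :
    ind a + ind b = ind c + ind d ↔ (a ∧ b ↔ c ∧ d) ∧ (a ∨ b ↔ c ∨ d) := by
  by_cases a <;> by_cases b <;> by_cases c <;> by_cases d <;> simp_all [ind]

theorem odd_add_ind (n : ℕ) (p : Prop) : Odd (n + ind p) ↔ ¬ (Odd n ↔ p) := by
  by_cases h : p
  · rw [ind_true h, Nat.odd_add_one]; simp [h]
  · rw [ind_false h]; simp [h]

namespace StationRules
variable {u : ℕ} {X J off par : M.E → Prop}

/-- The bit `off` is the difference between the numbers of own and of known marks. -/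
theorem count_eq (H : StationRules M u X J off par) (e : M.E) (he : e.1.val = u) :
    count X e = count J e + ind (off e) := by
  induction e using procInduction with
  | h e ih =>
    have hb := ind_add_eq_iff.2 ⟨H.both e he, H.any e he⟩
    by_cases hf : ∃ f, ProcEdge f e
    · obtain ⟨f, hf⟩ := hf
      have := ih f hf (hf.1 ▸ he)
      rw [exists_procEdge_and hf] at hb
      rw [count_succ hf, count_succ hf]
      omega
    · rw [ind_false (not_exists_procEdge_and hf _)] at hb
      rw [count_first hf, count_first hf]
      omega

theorem par_iff (H : StationRules M u X J off par) (e : M.E) (he : e.1.val = u) :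
    par e ↔ Odd (count X e) := by
  induction e using procInduction with
  | h e ih =>
    rw [H.parity e he]
    by_cases hf : ∃ f, ProcEdge f e
    · obtain ⟨f, hf⟩ := hf
      rw [exists_procEdge_and hf, count_succ hf, odd_add_ind, ih f hf (hf.1 ▸ he)]
    · rw [count_first hf, ← zero_add (ind _), odd_add_ind]
      have := not_exists_procEdge_and hf par
      simp [this]

/-- Marks that are never behind and at most one ahead of the known marks of the partner, and exactly
one ahead at each mark, obey the rules. -/
theorem of_count (h1 : ∀ e : M.E, e.1.val = u → count J e ≤ count X e)
    (h2 : ∀ e : M.E, e.1.val = u → count X e ≤ count J e + 1)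
    (h3 : ∀ e : M.E, e.1.val = u → X e → count X e = count J e + 1) :
    StationRules M u X J (fun e => count X e = count J e + 1) (fun e => Odd (count X e)) := by
  have hc : ∀ e : M.E, e.1.val = u →
      count X e = count J e + ind (count X e = count J e + 1) := by
    intro e he
    have := h1 e he
    have := h2 e he
    by_cases h : count X e = count J e + 1
    · rw [ind_true h]; exact h
    · rw [ind_false h]; omega
  have hb : ∀ e : M.E, e.1.val = u → ind (count X e = count J e + 1) + ind (J e) =
      ind (∃ g, ProcEdge g e ∧ count X g = count J g + 1) + ind (X e) := by
    intro e he
    have h := hc e he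
    by_cases hf : ∃ f, ProcEdge f e
    · obtain ⟨f, hf⟩ := hf
      rw [exists_procEdge_and hf]
      have h' := hc f (hf.1 ▸ he)
      have e1 := count_succ (Q := X) hf
      have e2 := count_succ (Q := J) hf
      generalize ind (count X e = count J e + 1) = a at *
      generalize ind (count X f = count J f + 1) = b at *
      omega
    · rw [ind_false (not_exists_procEdge_and hf _)]
      have e1 := count_first (Q := X) hf
      have e2 := count_first (Q := J) hf
      generalize ind (count X e = count J e + 1) = a at *
      omega
  refine ⟨fun e he => (ind_add_eq_iff.1 (hb e he)).1, fun e he => (ind_add_eq_iff.1 (hb e he)).2,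
    h3, fun e he => ?_⟩
  by_cases hf : ∃ f, ProcEdge f e
  · obtain ⟨f, hf⟩ := hf
    rw [exists_procEdge_and hf, count_succ hf, odd_add_ind]
  · have := not_exists_procEdge_and hf fun g => Odd (count X g)
    rw [count_first hf, ← zero_add (ind _), odd_add_ind]
    simp [this]

end StationRules

theorem count_le_ncard (X : M.E → Prop) (e : M.E) : count X e ≤ {x | X x}.ncard :=
  Set.ncard_le_ncard (fun _ h => h.1) (Set.toFinite _)

theorem reachCount_le_ncard (w : ℕ → ℕ) (X : M.E → Prop) (i : ℕ) (e : M.E) :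
    reachCount w X i e ≤ {x | X x}.ncard :=
  Set.ncard_le_ncard (fun _ h => h.1) (Set.toFinite _)

/-- The last event of process number `u`, as a relation. -/
def IsLastOn (u : ℕ) (e : M.E) : Prop := e.1.val = u ∧ ¬ ∃ f, ProcEdge e f

theorem ple_of_isLastOn {u : ℕ} {e l : M.E} (hl : IsLastOn u l) (he : e.1.val = u) : PLe e l :=
  ple_of_isLast (p := l.1) ⟨rfl, hl.2⟩ (Fin.ext (he.trans hl.1.symm))

theorem count_isLastOn {u : ℕ} {X : M.E → Prop} (hX : ∀ x, X x → x.1.val = u) {l : M.E}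
    (hl : IsLastOn u l) : count X l = {x | X x}.ncard := by
  unfold count
  congr 1
  ext x
  simp only [Set.mem_ofPred_eq, and_iff_left_iff_imp]
  exact fun h => ple_of_isLastOn hl (hX x h)

theorem exists_isLastOn {u : ℕ} (e : M.E) (he : e.1.val = u) : ∃ l : M.E, IsLastOn u l := by
  obtain ⟨l, hl, -⟩ := exists_isLast e
  exact ⟨l, by rw [hl.1]; exact he, hl.2⟩

namespace StationRules
variable {u : ℕ} {X J off par : M.E → Prop}

theorem exists_par_iff (H : StationRules M u X J off par) (hX : ∀ x, X x → x.1.val = u) :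
    (∃ l, IsLastOn u l ∧ par l) ↔ Odd {x | X x}.ncard := by
  constructor
  · rintro ⟨l, hl, hp⟩
    rwa [H.par_iff l hl.1, count_isLastOn hX hl] at hp
  · intro h
    obtain ⟨x, hx⟩ : {x | X x}.Nonempty := by
      rw [Set.nonempty_iff_ne_empty]
      intro h'
      rw [h'] at h
      simp at h
    obtain ⟨l, hl⟩ := exists_isLastOn x (hX x hx)
    exact ⟨l, hl, (H.par_iff l hl.1).2 (by rwa [count_isLastOn hX hl])⟩

theorem ncard_le (H : StationRules M u X J off par) (hX : ∀ x, X x → x.1.val = u) {n : ℕ}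
    (hJ : ∀ e : M.E, e.1.val = u → count J e ≤ n) : {x | X x}.ncard ≤ n + 1 := by
  by_cases h : {x | X x}.Nonempty
  · obtain ⟨x, hx⟩ := h
    obtain ⟨l, hl⟩ := exists_isLastOn x (hX x hx)
    rw [← count_isLastOn hX hl, H.count_eq l hl.1]
    have := hJ l hl.1
    have := ind_le (off l)
    omega
  · rw [Set.not_nonempty_iff_eq_empty.1 h]; simp

end StationRules

section
variable {w w' : ℕ → ℕ} {m m' : ℕ}

/-- If both stations and both signals obey the rules, then for each event of the second station with
`off'` there is a marked event of the first station such that neither of the two is reachable from the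
other along the given sequences of processes. -/
theorem exists_unreachable_of_rules {X Y off par off' par' : M.E → Prop}
    {inc tot pend inc' tot' pend' : ℕ → M.E → Prop}
    (hw : w m = w' 0) (hw' : w' m' = w 0)
    (hX : ∀ x, X x → x.1.val = w 0) (hY : ∀ y, Y y → y.1.val = w' 0)
    (S : SignalRules M w m X inc tot pend) (S' : SignalRules M w' m' Y inc' tot' pend')
    (H : StationRules M (w 0) X (inc' m') off par)
    (H' : StationRules M (w' 0) Y (inc m) off' par')
    (hp : (∃ l, IsLastOn (w 0) l ∧ par l) ↔ ∃ l, IsLastOn (w' 0) l ∧ par' l)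
    (e : M.E) (he : e.1.val = w' 0) (ho : off' e) :
    ∃ f, X f ∧ ¬ Reach M w m f e ∧ ¬ Reach M w' m' e f := by
  have hJ : ∀ e : M.E, e.1.val = w 0 → count (inc' m') e = reachCount w' Y m' e :=
    fun e he => S'.count_inc le_rfl e (by rw [he, hw'])
  have hJ' : ∀ e : M.E, e.1.val = w' 0 → count (inc m) e = reachCount w X m e :=
    fun e he => S.count_inc le_rfl e (by rw [he, hw])
  -- the numbers of marks differ by at most one and have the same parity
  have hcard : {x | X x}.ncard = {y | Y y}.ncard := by
    have h1 := H.ncard_le hX (n := {y | Y y}.ncard)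
      fun e he => (hJ e he).trans_le (reachCount_le_ncard _ _ _ _)
    have h2 := H'.ncard_le hY (n := {x | X x}.ncard)
      fun e he => (hJ' e he).trans_le (reachCount_le_ncard _ _ _ _)
    rw [H.exists_par_iff hX, H'.exists_par_iff hY, Nat.odd_iff, Nat.odd_iff] at hp
    omega
  have hj := H'.count_eq e he
  rw [ind_true ho, hJ' e he] at hj
  have hjX : count Y e ≤ {x | X x}.ncard := hcard ▸ count_le_ncard Y e
  -- the witness is the mark of the first station with the number of the current mark of the second
  obtain ⟨f, hf, hfe⟩ : ∃ f, X f ∧ count X f = count Y e := by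
    obtain ⟨x, hx⟩ : {x | X x}.Nonempty := by
      rw [Set.nonempty_iff_ne_empty]
      intro h'
      rw [h', Set.ncard_empty] at hjX
      omega
    obtain ⟨l, hl⟩ := exists_isLastOn x (hX x hx)
    obtain ⟨f, h1, -, h2⟩ := exists_count_eq (Q := X) (j := count Y e) (by omega) l
      (by rw [count_isLastOn hX hl]; exact hjX)
    exact ⟨f, h1, h2⟩
  refine ⟨f, hf, fun hr => ?_, fun hr => ?_⟩
  · have : count X f ≤ reachCount w X m e :=
      Set.ncard_le_ncard (fun x hx => ⟨hx.1, hr.down hx.2⟩) (Set.toFinite _)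
    omega
  · have h1 : count Y e ≤ reachCount w' Y m' f :=
      Set.ncard_le_ncard (fun x hx => ⟨hx.1, hr.down hx.2⟩) (Set.toFinite _)
    have h2 := H.count_eq f (hX f hf)
    rw [ind_true (H.mark f (hX f hf) hf), hJ f (hX f hf)] at h2
    omega

/-- Greedy choice of witnesses: `f j` is the last `T`-event not reachable from `a j`, and
`a (j + 1)` is the first `A`-event that is reachable from `f j`. -/
theorem exists_ladder {A T : M.E → Prop}
    (hA : ∀ a, A a → a.1.val = w' 0) (hT : ∀ f, T f → f.1.val = w 0)
    (h : ∀ a, A a → ∃ f, T f ∧ ¬ Reach M w m f a ∧ ¬ Reach M w' m' a f) (a₀ : M.E) (ha₀ : A a₀) :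
    ∃ (n : ℕ) (a f : ℕ → M.E), a 0 = a₀ ∧
      (∀ j ≤ n, A (a j) ∧ T (f j) ∧ ¬ Reach M w m (f j) (a j) ∧ ¬ Reach M w' m' (a j) (f j)) ∧
      (∀ j < n, Reach M w m (f j) (a (j + 1)) ∧ Reach M w' m' (a j) (f (j + 1))) ∧
      ∀ e, A e → PLe a₀ e → ∃ j ≤ n, PLe (a j) e ∧ ¬ Reach M w m (f j) e := by
  induction hn : (M.word a₀.1).length - a₀.2.val using Nat.strong_induction_on generalizing a₀ with
  | _ N ih =>
    obtain ⟨f₀, ⟨hf₀, hr'⟩, hmax⟩ := Set.exists_max_image {f | T f ∧ ¬ Reach M w' m' a₀ f}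
      (fun f => f.2.val) (Set.toFinite _) (by
        obtain ⟨f, h1, -, h2⟩ := h a₀ ha₀
        exact ⟨f, h1, h2⟩)
    have hr : ¬ Reach M w m f₀ a₀ := by
      obtain ⟨f, h1, h2, h3⟩ := h a₀ ha₀
      refine fun hr => h2 (hr.down ⟨Fin.ext ((hT f h1).trans (hT f₀ hf₀).symm), hmax f ⟨h1, h3⟩⟩)
    by_cases hne : {e | A e ∧ Reach M w m f₀ e}.Nonempty
    · obtain ⟨a₁, ⟨ha₁, hr₁⟩, hmin⟩ := Set.exists_min_image {e | A e ∧ Reach M w m f₀ e}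
        (fun f => f.2.val) (Set.toFinite _) hne
      have h01 : PLe a₀ a₁ ∧ a₀.2.val ≠ a₁.2.val := by
        have hp : a₀.1 = a₁.1 := Fin.ext ((hA _ ha₀).trans (hA _ ha₁).symm)
        refine ⟨(ple_total hp).resolve_right fun h => hr (hr₁.mono h), fun h => ?_⟩
        rw [Event.ext' hp h] at hr
        exact hr hr₁
      obtain ⟨n, a, f, rfl, h1, h2, h3⟩ := ih _ (by
        have := h01.1.2
        have := a₀.2.2
        have e1 : (M.word (a₁).1).length = (M.word a₀.1).length := by rw [h01.1.1]
        have := h01.2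
        omega) a₁ ha₁ rfl
      refine ⟨n + 1, fun j => Nat.casesOn j a₀ a, fun j => Nat.casesOn j f₀ f, rfl, ?_, ?_, ?_⟩
      · rintro (_ | j) hj
        · exact ⟨ha₀, hf₀, hr, hr'⟩
        · exact h1 j (by omega)
      · rintro (_ | j) hj
        · refine ⟨hr₁, ?_⟩
          by_contra hc
          obtain ⟨h4, h5, h6, h7⟩ := h1 0 (by omega)
          refine h6 (hr₁.down ⟨Fin.ext ((hT _ h5).trans (hT _ hf₀).symm), hmax _ ⟨h5, hc⟩⟩)
        · exact h2 j (by omega)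
      · intro e he h0
        by_cases hre : Reach M w m f₀ e
        · obtain ⟨j, hj, h4, h5⟩ := h3 e he
            ⟨Fin.ext ((hA _ ha₁).trans (hA _ he).symm), hmin e ⟨he, hre⟩⟩
          exact ⟨j + 1, by omega, h4, h5⟩
        · exact ⟨0, by omega, h0, hre⟩
    · refine ⟨0, fun _ => a₀, fun _ => f₀, rfl, fun _ _ => ⟨ha₀, hf₀, hr, hr'⟩,
        fun _ h => absurd h (by omega), fun e he h0 => ⟨0, le_rfl, h0, fun hre => hne ⟨e, he, hre⟩⟩⟩

/-- On a ladder, the number of rungs begun at `e` exceeds the number of events known to be marked by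
the partner by at most one. -/
theorem ladder_count {n : ℕ} {a f : ℕ → M.E}
    (ha : ∀ j ≤ n, (a j).1.val = w' 0) (hai : Set.InjOn a {j | j ≤ n})
    (hfi : Set.InjOn f {j | j ≤ n})
    (h1 : ∀ j ≤ n, ¬ Reach M w m (f j) (a j)) (h2 : ∀ j < n, Reach M w m (f j) (a (j + 1)))
    (e : M.E) (he : e.1.val = w' 0) :
    reachCount w (fun x => ∃ j ≤ n, f j = x) m e ≤ count (fun y => ∃ j ≤ n, a j = y) e ∧
    count (fun y => ∃ j ≤ n, a j = y) e ≤ reachCount w (fun x => ∃ j ≤ n, f j = x) m e + 1 ∧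
    ((∃ j ≤ n, PLe (a j) e ∧ ¬ Reach M w m (f j) e) →
      count (fun y => ∃ j ≤ n, a j = y) e = reachCount w (fun x => ∃ j ≤ n, f j = x) m e + 1) := by
  set I : Set ℕ := {j | j ≤ n ∧ PLe (a j) e} with hI
  set K : Set ℕ := {j | j ≤ n ∧ Reach M w m (f j) e} with hK
  have hIf : I.Finite := (Set.finite_le_nat n).subset fun j hj => hj.1
  have hKf : K.Finite := (Set.finite_le_nat n).subset fun j hj => hj.1
  have cI : count (fun y => ∃ j ≤ n, a j = y) e = I.ncard := by
    rw [← Set.InjOn.ncard_image (f := a) (hai.mono fun j hj => hj.1)]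
    unfold count
    congr 1
    ext y
    constructor
    · rintro ⟨⟨j, hj, rfl⟩, h⟩; exact ⟨j, ⟨hj, h⟩, rfl⟩
    · rintro ⟨j, ⟨hj, h⟩, rfl⟩; exact ⟨⟨j, hj, rfl⟩, h⟩
  have cK : reachCount w (fun x => ∃ j ≤ n, f j = x) m e = K.ncard := by
    rw [← Set.InjOn.ncard_image (f := f) (hfi.mono fun j hj => hj.1)]
    unfold reachCount
    congr 1
    ext y
    constructor
    · rintro ⟨⟨j, hj, rfl⟩, h⟩; exact ⟨j, ⟨hj, h⟩, rfl⟩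
    · rintro ⟨j, ⟨hj, h⟩, rfl⟩; exact ⟨⟨j, hj, rfl⟩, h⟩
  have hKI : K ⊆ I := by
    rintro j ⟨hj, hr⟩
    refine ⟨hj, (ple_total (Fin.ext ((ha j hj).trans he.symm))).resolve_right fun h => ?_⟩
    exact h1 j hj (hr.mono h)
  have hle : I.ncard ≤ K.ncard + 1 := by
    have hsub : I ⊆ insert 0 (Nat.succ '' K) := by
      rintro (_ | j) ⟨hj, h⟩
      · exact Set.mem_insert _ _
      · exact Set.mem_insert_of_mem _ ⟨j, ⟨by omega, (h2 j (by omega)).mono h⟩, rfl⟩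
    calc I.ncard ≤ (insert 0 (Nat.succ '' K)).ncard :=
          Set.ncard_le_ncard hsub ((hKf.image _).insert _)
      _ ≤ (Nat.succ '' K).ncard + 1 := Set.ncard_insert_le _ _
      _ ≤ K.ncard + 1 := Nat.add_le_add_right (Set.ncard_image_le hKf) 1
  rw [cI, cK]
  refine ⟨Set.ncard_le_ncard hKI hIf, hle, ?_⟩
  rintro ⟨j, hj, h3, h4⟩
  have : K.ncard < I.ncard :=
    Set.ncard_lt_ncard ⟨hKI, fun h => h4 (h (show j ∈ I from ⟨hj, h3⟩)).2⟩ hIf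
  omega

theorem ple_of_ladder {n : ℕ} {a f : ℕ → M.E} {u : ℕ} (ha : ∀ j ≤ n, (a j).1.val = u)
    (h1 : ∀ j ≤ n, ¬ Reach M w m (f j) (a j)) (h2 : ∀ j < n, Reach M w m (f j) (a (j + 1)))
    {i j : ℕ} (hij : i < j) (hj : j ≤ n) : PLe (a i) (a j) ∧ ¬ PLe (a j) (a i) := by
  have step : ∀ i < n, ¬ PLe (a (i + 1)) (a i) := fun i hi h => h1 i hi.le ((h2 i hi).mono h)
  have step' : ∀ i < n, PLe (a i) (a (i + 1)) := fun i hi => (ple_total (Fin.ext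
    ((ha i hi.le).trans (ha (i + 1) hi).symm))).resolve_right (step i hi)
  induction j, hij using Nat.le_induction with
  | base => exact ⟨step' i (by omega), step i (by omega)⟩
  | succ j _ ih =>
    obtain ⟨h3, h4⟩ := ih (by omega)
    have h5 := step' j (by omega)
    exact ⟨h3.trans h5, fun h => h4 (h5.trans h)⟩

theorem injOn_of_ladder {n : ℕ} {a f : ℕ → M.E} {u : ℕ} (ha : ∀ j ≤ n, (a j).1.val = u)
    (h1 : ∀ j ≤ n, ¬ Reach M w m (f j) (a j)) (h2 : ∀ j < n, Reach M w m (f j) (a (j + 1))) :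
    Set.InjOn a {j | j ≤ n} := by
  intro i hi j hj hij
  rcases lt_trichotomy i j with h | h | h
  · exact absurd (hij ▸ PLe.refl _) (ple_of_ladder ha h1 h2 h hj).2
  · exact h
  · exact absurd (hij ▸ PLe.refl _) (ple_of_ladder ha h1 h2 h hi).2

/-- If each `A`-event has a `T`-event as in the conclusion of `exists_unreachable_of_rules`, then
the rules can be obeyed, with marks on `T`-events only and `off'` on all `A`-events. -/
theorem exists_rules_of_unreachable {A T : M.E → Prop} (hw : w m = w' 0) (hw' : w' m' = w 0)
    (hA : ∀ a, A a → a.1.val = w' 0) (hT : ∀ f, T f → f.1.val = w 0)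
    (h : ∀ a, A a → ∃ f, T f ∧ ¬ Reach M w m f a ∧ ¬ Reach M w' m' a f) :
    ∃ (X Y off par off' par' : M.E → Prop) (inc tot pend inc' tot' pend' : ℕ → M.E → Prop),
      (∀ x, X x → T x) ∧ (∀ y, Y y → A y) ∧
      SignalRules M w m X inc tot pend ∧ SignalRules M w' m' Y inc' tot' pend' ∧
      StationRules M (w 0) X (inc' m') off par ∧ StationRules M (w' 0) Y (inc m) off' par' ∧
      ((∃ l, IsLastOn (w 0) l ∧ par l) ↔ ∃ l, IsLastOn (w' 0) l ∧ par' l) ∧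
      ∀ a, A a → off' a := by
  -- the sets of marks and what is needed about them
  suffices hs : ∃ X Y : M.E → Prop, (∀ x, X x → T x) ∧ (∀ y, Y y → A y) ∧
      {x | X x}.ncard = {y | Y y}.ncard ∧
      (∀ x y, X x → X y → PLe x y → x ≠ y → ∃ z, Reach M w m x z ∧ ¬ Reach M w m y z) ∧
      (∀ x y, Y x → Y y → PLe x y → x ≠ y → ∃ z, Reach M w' m' x z ∧ ¬ Reach M w' m' y z) ∧
      (∀ e : M.E, e.1.val = w 0 → reachCount w' Y m' e ≤ count X e ∧
        count X e ≤ reachCount w' Y m' e + 1 ∧ (X e → count X e = reachCount w' Y m' e + 1)) ∧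
      (∀ e : M.E, e.1.val = w' 0 → reachCount w X m e ≤ count Y e ∧
        count Y e ≤ reachCount w X m e + 1 ∧
        (Y e ∨ A e → count Y e = reachCount w X m e + 1)) by
    obtain ⟨X, Y, hXT, hYA, hc, hsX, hsY, hu, hv⟩ := hs
    obtain ⟨inc, tot, pend, S⟩ :=
      signalRules_of_separated (w := w) (m := m) (fun x hx => hT x (hXT x hx)) hsX
    obtain ⟨inc', tot', pend', S'⟩ :=
      signalRules_of_separated (w := w') (m := m') (fun x hx => hA x (hYA x hx)) hsY
    have hJ : ∀ e : M.E, e.1.val = w 0 → count (inc' m') e = reachCount w' Y m' e :=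
      fun e he => S'.count_inc le_rfl e (by rw [he, hw'])
    have hJ' : ∀ e : M.E, e.1.val = w' 0 → count (inc m) e = reachCount w X m e :=
      fun e he => S.count_inc le_rfl e (by rw [he, hw])
    have H := StationRules.of_count (u := w 0) (X := X) (J := inc' m')
      (fun e he => by rw [hJ e he]; exact (hu e he).1)
      (fun e he => by rw [hJ e he]; exact (hu e he).2.1)
      (fun e he h => by rw [hJ e he]; exact (hu e he).2.2 h)
    have H' := StationRules.of_count (u := w' 0) (X := Y) (J := inc m)
      (fun e he => by rw [hJ' e he]; exact (hv e he).1)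
      (fun e he => by rw [hJ' e he]; exact (hv e he).2.1)
      (fun e he h => by rw [hJ' e he]; exact (hv e he).2.2 (Or.inl h))
    refine ⟨X, Y, _, _, _, _, inc, tot, pend, inc', tot', pend', hXT, hYA, S, S', H, H', ?_, ?_⟩
    · rw [H.exists_par_iff fun x hx => hT x (hXT x hx),
        H'.exists_par_iff fun x hx => hA x (hYA x hx), hc]
    · intro a ha
      rw [hJ' a (hA a ha)]
      exact (hv a (hA a ha)).2.2 (Or.inr ha)
  by_cases hne : {a | A a}.Nonempty
  · obtain ⟨a₀, ha₀, hmin⟩ := Set.exists_min_image {a | A a} (fun f => f.2.val) (Set.toFinite _) hne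
    obtain ⟨n, a, f, -, h1, h2, h3⟩ := exists_ladder hA hT h a₀ ha₀
    have ha : ∀ j ≤ n, (a j).1.val = w' 0 := fun j hj => hA _ (h1 j hj).1
    have hf : ∀ j ≤ n, (f j).1.val = w 0 := fun j hj => hT _ (h1 j hj).2.1
    have h4 : ∀ j ≤ n, ¬ Reach M w m (f j) (a j) := fun j hj => (h1 j hj).2.2.1
    have h5 : ∀ j ≤ n, ¬ Reach M w' m' (a j) (f j) := fun j hj => (h1 j hj).2.2.2
    have h6 : ∀ j < n, Reach M w m (f j) (a (j + 1)) := fun j hj => (h2 j hj).1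
    have h7 : ∀ j < n, Reach M w' m' (a j) (f (j + 1)) := fun j hj => (h2 j hj).2
    have hai := injOn_of_ladder ha h4 h6
    have hfi := injOn_of_ladder hf h5 h7
    refine ⟨fun x => ∃ j ≤ n, f j = x, fun y => ∃ j ≤ n, a j = y, ?_, ?_, ?_, ?_, ?_, ?_, ?_⟩
    · rintro _ ⟨j, hj, rfl⟩; exact (h1 j hj).2.1
    · rintro _ ⟨j, hj, rfl⟩; exact (h1 j hj).1
    · have e1 := hai.ncard_image
      have e2 := hfi.ncard_image
      exact e2.trans e1.symm
    · rintro _ _ ⟨i, hi, rfl⟩ ⟨j, hj, rfl⟩ hle hne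
      have hij : i < j := by
        rcases lt_trichotomy i j with h | h | h
        · exact h
        · exact absurd (by rw [h]) hne
        · exact absurd hle (ple_of_ladder hf h5 h7 h hi).2
      refine ⟨a (i + 1), h6 i (by omega), fun hr => ?_⟩
      refine h4 (i + 1) (by omega) (hr.down ?_)
      rcases Nat.lt_or_eq_of_le (Nat.succ_le_of_lt hij) with h | h
      · exact (ple_of_ladder hf h5 h7 h hj).1
      · rw [← h]; exact .refl _
    · rintro _ _ ⟨i, hi, rfl⟩ ⟨j, hj, rfl⟩ hle hne
      have hij : i < j := by
        rcases lt_trichotomy i j with h | h | h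
        · exact h
        · exact absurd (by rw [h]) hne
        · exact absurd hle (ple_of_ladder ha h4 h6 h hi).2
      refine ⟨f (i + 1), h7 i (by omega), fun hr => ?_⟩
      refine h5 (i + 1) (by omega) (hr.down ?_)
      rcases Nat.lt_or_eq_of_le (Nat.succ_le_of_lt hij) with h | h
      · exact (ple_of_ladder ha h4 h6 h hj).1
      · rw [← h]; exact .refl _
    · intro e he
      obtain ⟨c1, c2, c3⟩ := ladder_count hf hfi hai h5 h7 e he
      refine ⟨c1, c2, ?_⟩
      rintro ⟨j, hj, rfl⟩
      exact c3 ⟨j, hj, .refl _, h5 j hj⟩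
    · intro e he
      obtain ⟨c1, c2, c3⟩ := ladder_count ha hai hfi h4 h6 e he
      refine ⟨c1, c2, ?_⟩
      rintro (⟨j, hj, rfl⟩ | hAe)
      · exact c3 ⟨j, hj, .refl _, h4 j hj⟩
      · exact c3 (h3 e hAe ⟨Fin.ext ((hA _ ha₀).trans he.symm), hmin e hAe⟩)
  · have hA' : ∀ a, ¬ A a := fun a ha => hne ⟨a, ha⟩
    refine ⟨fun _ => False, fun _ => False, ?_, ?_, rfl, ?_, ?_, ?_, ?_⟩ <;>
      simp [count, reachCount, hA']

end
end PingPong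

/-! ### Chains are the sets covered by one path -/

section Path
variable {k : ℕ} {Lab : Type} {M : MSC (Fin k) Lab}

/-- The rules for a path in the graph of a chart: `on` marks the events of the path, `inP` and `inM`
those entered through a process edge or a message edge, `outM` those left through a message edge,
and `st` the events at or after the start of the path on the same process. -/
structure PathRules (M : MSC (Fin k) Lab) (on inP inM outM st : M.E → Prop) : Prop where
  enterP : ∀ e, on e ∧ inP e →
    (∃ g, ProcEdge g e ∧ on g) ∧ ¬ ∃ g, ProcEdge g e ∧ outM g
  enterM : ∀ e, on e ∧ inM e → (∃ g, M.msg g e ∧ on g) ∧ ∃ g, M.msg g e ∧ outM g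
  st_iff : ∀ e, st e ↔ (∃ g, ProcEdge g e ∧ st g) ∨ (on e ∧ ¬ inP e ∧ ¬ inM e)
  start : ∀ e, ¬ ((∃ g, ProcEdge g e ∧ st g) ∧ (on e ∧ ¬ inP e ∧ ¬ inM e))
  unique : ∀ u v : ℕ, (∃ l : M.E, IsLastOn u l ∧ st l) → (∃ l : M.E, IsLastOn v l ∧ st l) → u = v

variable {on inP inM outM st : M.E → Prop}

namespace PathRules

theorem st_mono (H : PathRules M on inP inM outM st) {e f : M.E} (h : PLe e f) (he : st e) :
    st f := by
  induction f using procInduction with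
  | h f ih =>
    by_cases hef : e = f
    · exact hef ▸ he
    · obtain ⟨g, hg⟩ := (exists_procEdge_left f).2 fun h0 =>
        hef (Event.ext' h.1 (by have := h.2; omega))
      exact (H.st_iff f).2 (Or.inl ⟨g, hg, ih g hg ((hg.ple_iff.1 h).resolve_right hef)⟩)

theorem start_unique (H : PathRules M on inP inM outM st) {e f : M.E}
    (he : on e ∧ ¬ inP e ∧ ¬ inM e) (hf : on f ∧ ¬ inP f ∧ ¬ inM f) : e = f := by
  have hse : st e := (H.st_iff e).2 (Or.inr he)
  have hsf : st f := (H.st_iff f).2 (Or.inr hf)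
  have hp : e.1 = f.1 := by
    obtain ⟨l, hl, hel⟩ := exists_isLast e
    obtain ⟨l', hl', hfl⟩ := exists_isLast f
    exact Fin.ext (H.unique e.1.val f.1.val
      ⟨l, ⟨congrArg Fin.val hl.1, hl.2⟩, H.st_mono hel hse⟩
      ⟨l', ⟨congrArg Fin.val hl'.1, hl'.2⟩, H.st_mono hfl hsf⟩)
  have key : ∀ {e f : M.E}, st e → (on f ∧ ¬ inP f ∧ ¬ inM f) → PLe e f → e = f := by
    intro e f hse hf h
    by_contra hef
    obtain ⟨g, hg⟩ := (exists_procEdge_left f).2 fun h0 =>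
      hef (Event.ext' h.1 (by have := h.2; omega))
    exact H.start f ⟨⟨g, hg, H.st_mono ((hg.ple_iff.1 h).resolve_right hef) hse⟩, hf⟩
  rcases ple_total hp with h | h
  · exact key hse hf h
  · exact (key hsf he h).symm

/-- `Depth on inP inM outM n e`: the path reaches `e` after `n` steps. -/
def Depth (on inP inM outM : M.E → Prop) : ℕ → M.E → Prop
  | 0, e => on e ∧ ¬ inP e ∧ ¬ inM e
  | n + 1, e => ∃ g, Depth on inP inM outM n g ∧
      ((ProcEdge g e ∧ ¬ outM g) ∨ (M.msg g e ∧ outM g))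

theorem exists_depth (H : PathRules M on inP inM outM st) (e : M.E) (he : on e) :
    ∃ n, Depth on inP inM outM n e := by
  induction e using MSC.causalInduction with
  | h e ih =>
    by_cases h1 : inP e
    · obtain ⟨⟨g, hg, hon⟩, hout⟩ := H.enterP e ⟨he, h1⟩
      obtain ⟨n, hn⟩ := ih g (Or.inl hg) hon
      exact ⟨n + 1, g, hn, Or.inl ⟨hg, fun h => hout ⟨g, hg, h⟩⟩⟩
    · by_cases h2 : inM e
      · obtain ⟨⟨g, hg, hon⟩, g', hg', hout⟩ := H.enterM e ⟨he, h2⟩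
        obtain ⟨n, hn⟩ := ih g (Or.inr hg) hon
        rw [M.msg_left_unique hg' hg] at hout
        exact ⟨n + 1, g, hn, Or.inr ⟨hg, hout⟩⟩
      · exact ⟨0, he, h1, h2⟩

theorem depth_unique (H : PathRules M on inP inM outM st) {n : ℕ} {e f : M.E}
    (he : Depth on inP inM outM n e) (hf : Depth on inP inM outM n f) : e = f := by
  induction n generalizing e f with
  | zero => exact H.start_unique he hf
  | succ n ih =>
    obtain ⟨g, h1, h2⟩ := he
    obtain ⟨g', h3, h4⟩ := hf
    obtain rfl := ih h1 h3
    rcases h2 with ⟨h2, h5⟩ | ⟨h2, h5⟩ <;> rcases h4 with ⟨h4, h6⟩ | ⟨h4, h6⟩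
    · exact h2.right_unique h4
    · exact absurd h6 h5
    · exact absurd h5 h6
    · exact M.msg_right_unique h2 h4

theorem depth_le (H : PathRules M on inP inM outM st) {n d : ℕ} {e f : M.E}
    (he : Depth on inP inM outM n e) (hf : Depth on inP inM outM (n + d) f) : M.le e f := by
  induction d generalizing f with
  | zero => rw [H.depth_unique he hf]; exact MSC.le_refl _
  | succ d ih =>
    obtain ⟨g, h1, h2⟩ := hf
    refine (ih h1).trans ?_
    rcases h2 with ⟨h2, -⟩ | ⟨h2, -⟩
    · exact MSC.le_of_ple h2.ple
    · exact MSC.le_of_msg h2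

/-- Events on the path are ordered by the number of steps in which the path reaches them. -/
theorem comparable (H : PathRules M on inP inM outM st) {e f : M.E} (he : on e) (hf : on f) :
    M.le e f ∨ M.le f e := by
  obtain ⟨n, hn⟩ := H.exists_depth e he
  obtain ⟨m, hm⟩ := H.exists_depth f hf
  rcases le_total n m with h | h
  · obtain ⟨d, rfl⟩ := Nat.exists_eq_add_of_le h
    exact Or.inl (H.depth_le hn hm)
  · obtain ⟨d, rfl⟩ := Nat.exists_eq_add_of_le h
    exact Or.inr (H.depth_le hm hn)

end PathRules

/-- In a maximal chain, the greatest element below an element is joined to it by an edge. -/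
theorem exists_edge_of_maxChain {K : Set M.E} (hK : IsMaxChain M.le K) {e : M.E} (he : e ∈ K)
    (hne : ∃ c ∈ K, M.le c e ∧ c ≠ e) :
    ∃ g ∈ K, (ProcEdge g e ∨ M.msg g e) ∧ ∀ c ∈ K, M.le c e → c ≠ e → M.le c g := by
  have hcomp : ∀ {x y : M.E}, x ∈ K → y ∈ K → M.le x y ∨ M.le y x := fun {x y} hx hy => by
    by_cases h : x = y
    · exact Or.inl (h ▸ MSC.le_refl _)
    · exact hK.1 hx hy h
  obtain ⟨c, ⟨hc, hce, hcne⟩, hmax⟩ := Set.exists_max_image {c | c ∈ K ∧ M.le c e ∧ c ≠ e}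
    (fun c => {x | M.le x c}.ncard) (Set.toFinite _) hne
  have hgr : ∀ d ∈ K, M.le d e → d ≠ e → M.le d c := by
    intro d hd hde hdne
    by_contra hdc
    have h := (hcomp hd hc).resolve_left hdc
    by_cases hcd : d = c
    · exact hdc (hcd ▸ MSC.le_refl _)
    · have := hmax d ⟨hd, hde, hdne⟩
      have h2 : {x | M.le x c}.ncard < {x | M.le x d}.ncard :=
        Set.ncard_lt_ncard ⟨fun x (hx : M.le x c) => hx.trans h,
          fun h' => hcd ((h' (MSC.le_refl d : d ∈ {x | M.le x d})).antisymm h)⟩ (Set.toFinite _)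
      omega
  have step : ∀ g, (ProcEdge g e ∨ M.msg g e) → M.le c g → g = c := by
    intro g hg hcg
    have hge : M.le g e := Relation.ReflTransGen.single hg
    have hgne : g ≠ e := by
      rintro rfl
      exact M.acyclic g (.single hg)
    have hgK : g ∈ K := by
      have hch : IsChain M.le (insert g K) := hK.1.insert fun x hx _ => by
        by_cases hxe : x = e
        · exact Or.inl (hxe ▸ hge)
        · rcases hcomp hx he with h | h
          · exact Or.inr ((hgr x hx h hxe).trans hcg)
          · exact Or.inl (hge.trans h)
      rw [hK.2 hch (Set.subset_insert _ _)]
      exact Set.mem_insert _ _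
    exact (hgr g hgK hge hgne).antisymm hcg
  refine ⟨c, hc, ?_, hgr⟩
  rcases (MSC.le_iff c e).1 hce with h | ⟨g, hg, h⟩ | ⟨g, hg, h⟩
  · exact absurd h hcne
  · rw [← step g (Or.inl hg) h]; exact Or.inl hg
  · rw [← step g (Or.inr hg) h]; exact Or.inr hg

/-- Every chain is covered by a path. -/
theorem exists_pathRules_of_chain {C : M.E → Prop}
    (hC : ∀ e f, C e → C f → M.le e f ∨ M.le f e) :
    ∃ on inP inM outM st, PathRules M on inP inM outM st ∧ ∀ e, C e → on e := by
  obtain ⟨K, hK, hCK⟩ := IsChain.exists_maxChain (r := M.le) (c := {e | C e})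
    fun e he f hf _ => hC e f he hf
  have hcomp : ∀ {x y : M.E}, x ∈ K → y ∈ K → M.le x y ∨ M.le y x := fun {x y} hx hy => by
    by_cases h : x = y
    · exact Or.inl (h ▸ MSC.le_refl _)
    · exact hK.1 hx hy h
  let Pred : M.E → M.E → Prop := fun g e => g ∈ K ∧ e ∈ K ∧ ∀ c ∈ K, M.le c e → c ≠ e → M.le c g
  have hout : ∀ g e e', ProcEdge g e → Pred g e → M.msg g e' → Pred g e' → False := by
    intro g e e' h1 h2 h3 h4
    have hne : e ≠ e' := by
      rintro rfl
      exact M.msg_ne _ _ h3 h1.1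
    rcases hcomp h2.2.1 h4.2.1 with h | h
    · have := h4.2.2 e h2.2.1 h hne
      exact h1.not_ple (MSC.ple_of_le this h1.1.symm)
    · have := h2.2.2 e' h4.2.1 h hne.symm
      rw [this.antisymm (MSC.le_of_msg h3)] at h3
      exact M.msg_ne _ _ h3 rfl
  let inP : M.E → Prop := fun e => ∃ g, ProcEdge g e ∧ Pred g e
  let inM : M.E → Prop := fun e => ∃ g, M.msg g e ∧ Pred g e
  have hmin : ∀ e, (e ∈ K ∧ ¬ inP e ∧ ¬ inM e) → ∀ c ∈ K, M.le e c := by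
    rintro e ⟨he, h1, h2⟩ c hc
    by_contra hec
    have h := (hcomp he hc).resolve_left hec
    by_cases hce : c = e
    · exact hec (hce ▸ MSC.le_refl _)
    · obtain ⟨g, hg, h3 | h3, h4⟩ := exists_edge_of_maxChain hK he ⟨c, hc, h, hce⟩
      · exact h1 ⟨g, h3, hg, he, h4⟩
      · exact h2 ⟨g, h3, hg, he, h4⟩
  have huniq : ∀ e f, (e ∈ K ∧ ¬ inP e ∧ ¬ inM e) → (f ∈ K ∧ ¬ inP f ∧ ¬ inM f) → e = f :=
    fun e f he hf => (hmin e he f hf.1).antisymm (hmin f hf e he.1)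
  refine ⟨fun e => e ∈ K, inP, inM, fun g => ∃ e, M.msg g e ∧ Pred g e,
    fun e => ∃ s, PLe s e ∧ s ∈ K ∧ ¬ inP s ∧ ¬ inM s, ⟨?_, ?_, ?_, ?_, ?_⟩, fun e he => hCK he⟩
  · rintro e ⟨-, g, hg, hp⟩
    refine ⟨⟨g, hg, hp.1⟩, ?_⟩
    rintro ⟨g', hg', e', h1, h2⟩
    rw [hg'.left_unique hg] at h1 h2
    exact hout g e e' hg hp h1 h2
  · rintro e ⟨-, g, hg, hp⟩
    exact ⟨⟨g, hg, hp.1⟩, g, hg, e, hg, hp⟩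
  · intro e
    constructor
    · rintro ⟨s, h1, h2⟩
      by_cases hse : s = e
      · exact Or.inr (hse ▸ h2)
      · obtain ⟨g, hg⟩ := (exists_procEdge_left e).2 fun h0 =>
          hse (Event.ext' h1.1 (by have := h1.2; omega))
        exact Or.inl ⟨g, hg, s, (hg.ple_iff.1 h1).resolve_right hse, h2⟩
    · rintro (⟨g, hg, s, h1, h2⟩ | h)
      · exact ⟨s, h1.trans hg.ple, h2⟩
      · exact ⟨e, .refl _, h⟩
  · rintro e ⟨⟨g, hg, s, h1, h2⟩, h⟩
    rw [huniq s e h2 h] at h1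
    exact hg.not_ple h1
  · rintro u v ⟨l, hl, s, h1, h2⟩ ⟨l', hl', s', h1', h2'⟩
    rw [huniq s s' h2 h2'] at h1
    rw [← hl.1, ← hl'.1, ← h1.1, ← h1'.1]

end Path

/-! ### Counting up to two in the past and in the future -/

section CountTwo
variable {E : Type} {A B le : E → E → Prop} {Q P1 P2 : E → Prop}

/-- The rules for `P1` and `P2` to say that at least one or at least two `Q`-events are below an
event, where `A` and `B` are the edges that generate the order. -/
structure CountRules (A B : E → E → Prop) (Q P1 P2 : E → Prop) : Prop where
  one : ∀ e, P1 e ↔ Q e ∨ (∃ g, A g e ∧ P1 g) ∨ ∃ g, B g e ∧ P1 g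
  two : ∀ e, P2 e ↔ (∃ g, A g e ∧ P2 g) ∨ (∃ g, B g e ∧ P2 g) ∨
    (Q e ∧ ((∃ g, A g e ∧ P1 g) ∨ ∃ g, B g e ∧ P1 g))

/-- An order generated by edges of two kinds. -/
structure Generated (A B le : E → E → Prop) : Prop where
  le_iff : ∀ x e, le x e ↔ x = e ∨ (∃ g, A g e ∧ le x g) ∨ ∃ g, B g e ∧ le x g
  trans : ∀ x y z, le x y → le y z → le x z
  anti : ∀ x y, le x y → le y x → x = y
  irrefl : ∀ g e, A g e ∨ B g e → g ≠ e
  unique_left : ∀ g g' e, A g e → A g' e → g = g'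
  unique_right : ∀ g g' e, B g e → B g' e → g = g'
  induct : ∀ C : E → Prop, (∀ e, (∀ f, A f e ∨ B f e → C f) → C e) → ∀ e, C e

theorem Generated.of_edge (H : Generated A B le) {g e : E} (h : A g e ∨ B g e) : le g e := by
  rcases h with h | h
  · exact (H.le_iff g e).2 (Or.inr (Or.inl ⟨g, h, (H.le_iff g g).2 (Or.inl rfl)⟩))
  · exact (H.le_iff g e).2 (Or.inr (Or.inr ⟨g, h, (H.le_iff g g).2 (Or.inl rfl)⟩))

theorem countRules_sem (H : Generated A B le) (hQ : ∀ f g, Q f → Q g → le f g ∨ le g f) :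
    CountRules A B Q (fun e => ∃ f, Q f ∧ le f e)
      (fun e => ∃ f g, f ≠ g ∧ Q f ∧ Q g ∧ le f e ∧ le g e) := by
  have lift : ∀ {x g e}, A g e ∨ B g e → le x g → le x e := fun h h' =>
    H.trans _ _ _ h' (H.of_edge h)
  constructor
  · intro e
    constructor
    · rintro ⟨f, hf, hfe⟩
      rcases (H.le_iff f e).1 hfe with rfl | ⟨g, hg, h⟩ | ⟨g, hg, h⟩
      · exact Or.inl hf
      · exact Or.inr (Or.inl ⟨g, hg, f, hf, h⟩)
      · exact Or.inr (Or.inr ⟨g, hg, f, hf, h⟩)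
    · rintro (h | ⟨g, hg, f, hf, h⟩ | ⟨g, hg, f, hf, h⟩)
      · exact ⟨e, h, (H.le_iff e e).2 (Or.inl rfl)⟩
      · exact ⟨f, hf, lift (Or.inl hg) h⟩
      · exact ⟨f, hf, lift (Or.inr hg) h⟩
  · intro e
    constructor
    · rintro ⟨f, g, hne, hf, hg, hfe, hge⟩
      wlog hfg : le f g generalizing f g
      · exact this g f hne.symm hg hf hge hfe ((hQ f g hf hg).resolve_left hfg)
      rcases (H.le_iff g e).1 hge with rfl | ⟨x, hx, h⟩ | ⟨x, hx, h⟩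
      · right; right
        refine ⟨hg, ?_⟩
        rcases (H.le_iff f g).1 hfe with h | ⟨x, hx, h⟩ | ⟨x, hx, h⟩
        · exact absurd h hne
        · exact Or.inl ⟨x, hx, f, hf, h⟩
        · exact Or.inr ⟨x, hx, f, hf, h⟩
      · exact Or.inl ⟨x, hx, f, g, hne, hf, hg, H.trans _ _ _ hfg h, h⟩
      · exact Or.inr (Or.inl ⟨x, hx, f, g, hne, hf, hg, H.trans _ _ _ hfg h, h⟩)
    · have self : ∀ {x f}, (A x e ∨ B x e) → le f x → f ≠ e := by
        rintro x f hx h rfl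
        exact H.irrefl x f hx ((H.anti _ _ (H.of_edge hx) h))
      rintro (⟨x, hx, f, g, hne, hf, hg, h1, h2⟩ | ⟨x, hx, f, g, hne, hf, hg, h1, h2⟩ |
        ⟨h, ⟨x, hx, f, hf, h1⟩ | ⟨x, hx, f, hf, h1⟩⟩)
      · exact ⟨f, g, hne, hf, hg, lift (Or.inl hx) h1, lift (Or.inl hx) h2⟩
      · exact ⟨f, g, hne, hf, hg, lift (Or.inr hx) h1, lift (Or.inr hx) h2⟩
      · exact ⟨f, e, self (Or.inl hx) h1, hf, h, lift (Or.inl hx) h1,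
          (H.le_iff e e).2 (Or.inl rfl)⟩
      · exact ⟨f, e, self (Or.inr hx) h1, hf, h, lift (Or.inr hx) h1,
          (H.le_iff e e).2 (Or.inl rfl)⟩

theorem CountRules.sem (H : Generated A B le) (hQ : ∀ f g, Q f → Q g → le f g ∨ le g f)
    (R : CountRules A B Q P1 P2) (e : E) :
    (P1 e ↔ ∃ f, Q f ∧ le f e) ∧
      (P2 e ↔ ∃ f g, f ≠ g ∧ Q f ∧ Q g ∧ le f e ∧ le g e) := by
  have S := countRules_sem H hQ
  refine H.induct (fun e => (P1 e ↔ ∃ f, Q f ∧ le f e) ∧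
      (P2 e ↔ ∃ f g, f ≠ g ∧ Q f ∧ Q g ∧ le f e ∧ le g e)) (fun e ih => ?_) e
  have cA : ∀ {C D : E → Prop}, (∀ f, A f e ∨ B f e → (C f ↔ D f)) →
      ((∃ g, A g e ∧ C g) ↔ ∃ g, A g e ∧ D g) := fun h =>
    exists_congr fun g => and_congr_right fun hg => h g (Or.inl hg)
  have cB : ∀ {C D : E → Prop}, (∀ f, A f e ∨ B f e → (C f ↔ D f)) →
      ((∃ g, B g e ∧ C g) ↔ ∃ g, B g e ∧ D g) := fun h =>
    exists_congr fun g => and_congr_right fun hg => h g (Or.inr hg)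
  have h1 := fun f hf => (ih f hf).1
  have h2 := fun f hf => (ih f hf).2
  rw [R.one, S.one, R.two, S.two, cA h1, cA h2, cB h1, cB h2]
  exact ⟨Iff.rfl, Iff.rfl⟩

/-- Counting up to two suffices to see whether there is a `Q`-event below `e` other than `e` and its
neighbours. -/
theorem CountRules.other_iff (H : Generated A B le) (hQ : ∀ f g, Q f → Q g → le f g ∨ le g f)
    (R : CountRules A B Q P1 P2) (e : E) (hAB : ∀ g g', A g e → B g' e → ¬ (Q g ∧ Q g')) :
    (((∃ g, A g e ∧ P2 g) ∨ ∃ g, B g e ∧ P2 g) ∨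
      (((∃ g, A g e ∧ P1 g) ∨ ∃ g, B g e ∧ P1 g) ∧
        ¬ (∃ g, A g e ∧ Q g) ∧ ¬ ∃ g, B g e ∧ Q g)) ↔
    ∃ f, Q f ∧ le f e ∧ f ≠ e ∧ ¬ A f e ∧ ¬ B f e := by
  have s1 := fun e => (R.sem H hQ e).1
  have s2 := fun e => (R.sem H hQ e).2
  have refl : ∀ x, le x x := fun x => (H.le_iff x x).2 (Or.inl rfl)
  have self : ∀ {x f}, (A x e ∨ B x e) → le f x → f ≠ e := by
    rintro x f hx h rfl
    exact H.irrefl x f hx ((H.anti _ _ (H.of_edge hx) h))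
  have lift : ∀ {x g}, A g e ∨ B g e → le x g → le x e := fun h h' =>
    H.trans _ _ _ h' (H.of_edge h)
  have pick : ∀ {x f g}, (A x e ∨ B x e) → f ≠ g → Q f → Q g → le f x → le g x →
      ∃ f, Q f ∧ le f e ∧ f ≠ e ∧ ¬ A f e ∧ ¬ B f e := by
    intro x f g hx hne hf hg h1 h2
    by_cases hf' : A f e ∨ B f e
    · refine ⟨g, hg, lift hx h2, self hx h2, fun h => ?_, fun h => ?_⟩
      · rcases hf' with h' | h'
        · exact hne (H.unique_left _ _ _ h' h)
        · exact hAB g f h h' ⟨hg, hf⟩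
      · rcases hf' with h' | h'
        · exact hAB f g h' h ⟨hf, hg⟩
        · exact hne (H.unique_right _ _ _ h' h)
    · exact ⟨f, hf, lift hx h1, self hx h1, fun h => hf' (Or.inl h), fun h => hf' (Or.inr h)⟩
  constructor
  · rintro ((⟨x, hx, h⟩ | ⟨x, hx, h⟩) | ⟨h, h1, h2⟩)
    · obtain ⟨f, g, hne, hf, hg, h1, h2⟩ := (s2 x).1 h
      exact pick (Or.inl hx) hne hf hg h1 h2
    · obtain ⟨f, g, hne, hf, hg, h1, h2⟩ := (s2 x).1 h
      exact pick (Or.inr hx) hne hf hg h1 h2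
    · obtain ⟨x, hx, h⟩ : ∃ x, (A x e ∨ B x e) ∧ P1 x := by
        rcases h with ⟨x, hx, h⟩ | ⟨x, hx, h⟩
        · exact ⟨x, Or.inl hx, h⟩
        · exact ⟨x, Or.inr hx, h⟩
      obtain ⟨f, hf, h3⟩ := (s1 x).1 h
      exact ⟨f, hf, lift hx h3, self hx h3, fun h => h1 ⟨f, h, hf⟩, fun h => h2 ⟨f, h, hf⟩⟩
  · rintro ⟨f, hf, hfe, hne, hA, hB⟩
    -- a `Q`-neighbour of `e` makes two `Q`-events below some neighbour
    have key : ∀ y, (A y e ∨ B y e) → Q y → (∃ g, A g e ∧ P2 g) ∨ ∃ g, B g e ∧ P2 g := by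
      intro y hy hQy
      have hfy : f ≠ y := by
        rintro rfl
        rcases hy with h | h
        · exact hA h
        · exact hB h
      have step : ∀ x, (A x e ∨ B x e) → le f x → ∃ x, (A x e ∨ B x e) ∧ P2 x := by
        intro x hx h
        rcases hQ f y hf hQy with h' | h'
        · exact ⟨y, hy, (s2 y).2 ⟨f, y, hfy, hf, hQy, h', refl y⟩⟩
        · exact ⟨x, hx, (s2 x).2 ⟨f, y, hfy, hf, hQy, h, H.trans _ _ _ h' h⟩⟩
      obtain ⟨x, hx, h⟩ : ∃ x, (A x e ∨ B x e) ∧ P2 x := by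
        rcases (H.le_iff f e).1 hfe with h | ⟨g, hg, h⟩ | ⟨g, hg, h⟩
        · exact absurd h hne
        · exact step g (Or.inl hg) h
        · exact step g (Or.inr hg) h
      rcases hx with hx | hx
      · exact Or.inl ⟨x, hx, h⟩
      · exact Or.inr ⟨x, hx, h⟩
    by_cases h1 : ∃ g, A g e ∧ Q g
    · obtain ⟨g, hg, hg'⟩ := h1
      exact Or.inl (key g (Or.inl hg) hg')
    · by_cases h2 : ∃ g, B g e ∧ Q g
      · obtain ⟨g, hg, hg'⟩ := h2
        exact Or.inl (key g (Or.inr hg) hg')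
      · refine Or.inr ⟨?_, h1, h2⟩
        rcases (H.le_iff f e).1 hfe with h | ⟨g, hg, h⟩ | ⟨g, hg, h⟩
        · exact absurd h hne
        · exact Or.inl ⟨g, hg, (s1 g).2 ⟨f, hf, h⟩⟩
        · exact Or.inr ⟨g, hg, (s1 g).2 ⟨f, hf, h⟩⟩

end CountTwo

section Past
variable {k : ℕ} {Lab : Type} {M : MSC (Fin k) Lab}

theorem generated_past : Generated (fun g e : M.E => ProcEdge g e) (fun g e => M.msg g e) M.le where
  le_iff := MSC.le_iff
  trans _ _ _ := MSC.le.trans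
  anti _ _ := MSC.le.antisymm
  irrefl := by
    rintro g e (h | h) rfl
    · exact h.not_ple (.refl _)
    · exact M.msg_ne _ _ h rfl
  unique_left _ _ _ h h' := h.left_unique h'
  unique_right _ _ _ h h' := M.msg_left_unique h h'
  induct _ h := MSC.causalInduction h

theorem generated_future : Generated (fun g e : M.E => ProcEdge e g) (fun g e => M.msg e g)
    (fun x e => M.le e x) where
  le_iff x e := by
    rw [MSC.le_iff']; simp only [eq_comm]
  trans _ _ _ h h' := MSC.le.trans h' h
  anti _ _ h h' := MSC.le.antisymm h' h
  irrefl := by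
    rintro g e (h | h) rfl
    · exact h.not_ple (.refl _)
    · exact M.msg_ne _ _ h rfl
  unique_left _ _ _ h h' := h.right_unique h'
  unique_right _ _ _ h h' := M.msg_right_unique h h'
  induct _ h := MSC.causalInduction' h

theorem le_total_of_proc {e f : M.E} (h : e.1 = f.1) : M.le e f ∨ M.le f e :=
  (ple_total h).imp MSC.le_of_ple MSC.le_of_ple

/-! ### Every causal path can be shortened to one without repeated processes -/

theorem Reach.congr {w w' : ℕ → ℕ} {i : ℕ} {x e : M.E} (h : ∀ j ≤ i, w j = w' j)
    (hr : Reach M w i x e) : Reach M w' i x e := by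
  induction i generalizing e with
  | zero => exact ⟨by rw [← h 0 le_rfl]; exact hr.1, hr.2⟩
  | succ i ih =>
    obtain ⟨h1, g, g', h2, h3, h4⟩ := hr
    exact ⟨by rw [← h _ le_rfl]; exact h1, g, g', ih (fun j hj => h j (by omega)) h2, h3, h4⟩

theorem Reach.exists_prefix {w : ℕ → ℕ} {i m : ℕ} {x e : M.E} (h : Reach M w m x e) (hi : i ≤ m) :
    ∃ g, Reach M w i x g ∧ M.le g e := by
  induction m generalizing e with
  | zero => exact ⟨e, by rwa [Nat.le_zero.1 hi], MSC.le_refl _⟩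
  | succ m ih =>
    rcases Nat.lt_or_eq_of_le hi with hi | rfl
    · obtain ⟨h1, g, g', h2, h3, h4⟩ := h
      obtain ⟨g1, h5, h6⟩ := ih h2 (Nat.le_of_lt_succ hi)
      exact ⟨g1, h5, h6.trans ((MSC.le_of_msg h3).trans (MSC.le_of_ple h4))⟩
    · exact ⟨e, h, MSC.le_refl _⟩

theorem exists_reach {x e : M.E} (h : M.le x e) :
    ∃ L : List ℕ, L ≠ [] ∧ L.Nodup ∧ (∀ r ∈ L, r < k) ∧
      Reach M (fun i => L.getD i 0) (L.length - 1) x e := by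
  induction h with
  | refl => exact ⟨[x.1.val], by simp, by simp, by simp, by simp [Reach, PLe.refl]⟩
  | @tail b c hb hbc ih =>
    obtain ⟨L, h1, h2, h3, h4⟩ := ih
    have hL := List.length_pos_iff.2 h1
    rcases hbc with hbc | hbc
    · exact ⟨L, h1, h2, h3, h4.mono hbc.ple⟩
    · by_cases hc : c.1.val ∈ L
      · obtain ⟨i, hi, hic⟩ := List.getElem_of_mem hc
        obtain ⟨g, h5, h6⟩ := h4.exists_prefix (i := i) (by omega)
        have hg : g.1 = c.1 := by
          refine Fin.ext (h5.proc.trans ?_)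
          rw [← hic]; simp [hi]
        have h7 : Reach M (fun i => L.getD i 0) i x c :=
          h5.mono (MSC.ple_of_le (h6.trans (MSC.le_of_msg hbc)) hg)
        refine ⟨L.take (i + 1), ?_, h2.sublist (List.take_sublist _ _),
          fun r hr => h3 r (List.mem_of_mem_take hr), ?_⟩
        · rw [← List.length_pos_iff, List.length_take]; omega
        · have : (L.take (i + 1)).length - 1 = i := by rw [List.length_take]; omega
          rw [this]
          refine h7.congr fun j hj => ?_
          have h8 : j < (L.take (i + 1)).length := by rw [List.length_take]; omega
          have h9 : j < L.length := by omega
          simp only [List.getD_eq_getElem _ _ h8, List.getD_eq_getElem _ _ h9, List.getElem_take]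
      · refine ⟨L ++ [c.1.val], by simp, ?_, ?_, ?_⟩
        · rw [List.nodup_append]
          simp only [h2, List.nodup_singleton, List.mem_singleton, true_and]
          rintro a ha _ rfl rfl
          exact hc ha
        · intro r hr
          rcases List.mem_append.1 hr with hr | hr
          · exact h3 r hr
          · rw [List.mem_singleton.1 hr]; exact c.1.2
        · have : (L ++ [c.1.val]).length - 1 = (L.length - 1) + 1 := by simp; omega
          rw [this]
          have e1 : (L.length - 1) + 1 = L.length := by omega
          refine ⟨?_, b, c, h4.congr fun j hj => ?_, hbc, .refl _⟩
          · simp [e1]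
          · have h9 : j < L.length := by omega
            exact (List.getD_append _ _ _ _ h9).symm

/-- Lists of length at most `k` of numbers below `k`. -/
def words (k : ℕ) : List (List ℕ) :=
  (List.range (k + 1)).flatMap fun l => tuples (List.range k) l

theorem mem_words {w : List ℕ} : w ∈ words k ↔ w.length ≤ k ∧ ∀ r ∈ w, r < k := by
  simp only [words, List.mem_flatMap, List.mem_range, mem_tuples]
  constructor
  · rintro ⟨l, hl, rfl, h⟩
    exact ⟨by omega, h⟩
  · rintro ⟨h1, h2⟩
    exact ⟨_, by omega, rfl, h2⟩

/-- The process at position `i` of a word. -/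
def wordAt (w : List ℕ) (i : ℕ) : ℕ := w.getD i 0

/-- The word `w` is not empty and leads from process `p` to process `q`. -/
def Leads (w : List ℕ) (p q : ℕ) : Prop :=
  w ≠ [] ∧ wordAt w 0 = p ∧ wordAt w (w.length - 1) = q

theorem exists_reach_word {x e : M.E} (h : M.le x e) :
    ∃ w ∈ words k, Leads w x.1.val e.1.val ∧ Reach M (wordAt w) (w.length - 1) x e := by
  obtain ⟨L, h1, h2, h3, h4⟩ := exists_reach h
  refine ⟨L, mem_words.2 ⟨?_, h3⟩, ⟨h1, h4.src.symm, h4.proc.symm⟩, h4⟩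
  have := (h2.subperm (l₂ := List.range k) fun r hr => List.mem_range.2 (h3 r hr)).length_le
  simpa using this

theorem exists_word {p q : ℕ} (hp : p < k) (hq : q < k) (hpq : p ≠ q) :
    ∃ w ∈ words k, Leads w p q :=
  ⟨[p, q], mem_words.2 ⟨by simp; omega, by simp [hp, hq]⟩, by simp [Leads, wordAt]⟩

/-- The events of process `q` that are incomparable to `e` form an interval whose ends are
witnessed by two fixed process sequences; hence events that are unreachable for each pair of such
sequences yield an incomparable one. -/
theorem exists_incomparable {p q : ℕ} (hp : p < k) (hq : q < k) (hpq : p ≠ q) {T : M.E → Prop}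
    (hT : ∀ f, T f → f.1.val = q)
    {e : M.E} (he : e.1.val = p)
    (h : ∀ w ∈ words k, ∀ w' ∈ words k, Leads w q p → Leads w' p q →
      ∃ f, T f ∧ ¬ Reach M (wordAt w) (w.length - 1) f e ∧
        ¬ Reach M (wordAt w') (w'.length - 1) e f) :
    ∃ f, T f ∧ ¬ M.le f e ∧ ¬ M.le e f := by
  have h1 : ∃ w ∈ words k, Leads w q p ∧ ∀ f : M.E, f.1.val = q → M.le f e →
      Reach M (wordAt w) (w.length - 1) f e := by
    by_cases hne : {f : M.E | f.1.val = q ∧ M.le f e}.Nonempty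
    · obtain ⟨f₀, ⟨hf, hfe⟩, hmax⟩ := Set.exists_max_image _ (fun f => f.2.val)
        (Set.toFinite _) hne
      obtain ⟨w, hw, hl, hr⟩ := exists_reach_word hfe
      refine ⟨w, hw, by rwa [hf, he] at hl, fun f hf' hfe' => hr.down ?_⟩
      exact ⟨Fin.ext (hf'.trans hf.symm), hmax f ⟨hf', hfe'⟩⟩
    · obtain ⟨w, hw, hl⟩ := exists_word hq hp hpq.symm
      exact ⟨w, hw, hl, fun f hf hfe => absurd ⟨f, hf, hfe⟩ hne⟩
  have h2 : ∃ w ∈ words k, Leads w p q ∧ ∀ f : M.E, f.1.val = q → M.le e f →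
      Reach M (wordAt w) (w.length - 1) e f := by
    by_cases hne : {f : M.E | f.1.val = q ∧ M.le e f}.Nonempty
    · obtain ⟨f₀, ⟨hf, hfe⟩, hmin⟩ := Set.exists_min_image _ (fun f => f.2.val)
        (Set.toFinite _) hne
      obtain ⟨w, hw, hl, hr⟩ := exists_reach_word hfe
      refine ⟨w, hw, by rwa [hf, he] at hl, fun f hf' hfe' => hr.mono ?_⟩
      exact ⟨Fin.ext (hf.trans hf'.symm), hmin f ⟨hf', hfe'⟩⟩
    · obtain ⟨w, hw, hl⟩ := exists_word hp hq hpq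
      exact ⟨w, hw, hl, fun f hf hfe => absurd ⟨f, hf, hfe⟩ hne⟩
  obtain ⟨w, hw, hl, hr⟩ := h1
  obtain ⟨w', hw', hl', hr'⟩ := h2
  obtain ⟨f, hf, h3, h4⟩ := h w hw w' hw' hl hl'
  exact ⟨f, hf, fun hle => h3 (hr f (hT f hf) hle), fun hle => h4 (hr' f (hT f hf) hle)⟩

end Past

/-! ### Evaluation of two-variable formulas from types -/

@[fun_prop] theorem primrec_testBit {α : Type} [Primcodable α] {f g : α → ℕ} (h : Primrec f)
    (h' : Primrec g) : Primrec fun a => (f a).testBit (g a) := by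
  simp only [Nat.testBit_eq_decide_div_mod_eq]
  fun_prop

@[fun_prop] theorem primrec_boolNot {α : Type} [Primcodable α] {f : α → Bool} (h : Primrec f) :
    Primrec fun a => !f a := Primrec.not.comp h

@[fun_prop] theorem primrec_boolOr {α : Type} [Primcodable α] {f g : α → Bool} (h : Primrec f)
    (h' : Primrec g) : Primrec fun a => f a || g a := Primrec.or.comp h h'

/-- The eight mutually exclusive ways in which an event `f` can be related to an event `e`:
`f` equals `e`, is its process predecessor or successor, the source or target of its message edge,
or is below `e`, above `e` or incomparable with `e` without any of these. -/
def MSC.Rel {P Lab : Type} (M : MSC P Lab) (ρ : ℕ) (e f : M.E) : Prop :=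
  match ρ with
  | 0 => f = e
  | 1 => ProcEdge f e
  | 2 => ProcEdge e f
  | 3 => M.msg f e
  | 4 => M.msg e f
  | 5 => M.le f e ∧ f ≠ e ∧ ¬ProcEdge f e ∧ ¬M.msg f e
  | 6 => M.le e f ∧ f ≠ e ∧ ¬ProcEdge e f ∧ ¬M.msg e f
  | 7 => ¬M.le f e ∧ ¬M.le e f
  | _ => False

/-- The relation code seen from the other event. -/
def invRel (ρ : ℕ) : ℕ :=
  if ρ = 1 then 2 else if ρ = 2 then 1 else if ρ = 3 then 4 else if ρ = 4 then 3
  else if ρ = 5 then 6 else if ρ = 6 then 5 else ρ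

@[fun_prop] theorem primrec_invRel {α : Type} [Primcodable α] {f : α → ℕ} (h : Primrec f) :
    Primrec fun a => invRel (f a) := by
  unfold invRel; fun_prop

section Rel
variable {P Lab : Type} {M : MSC P Lab}

theorem MSC.Rel.lt {ρ : ℕ} {e f : M.E} (h : M.Rel ρ e f) : ρ < 8 := by
  by_contra hc
  obtain ⟨c, rfl⟩ := Nat.exists_eq_add_of_le (Nat.le_of_not_lt hc)
  have : 8 + c = c + 8 := by omega
  rw [this] at h
  exact h

theorem MSC.exists_rel (M : MSC P Lab) (e f : M.E) : ∃ ρ, M.Rel ρ e f := by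
  by_cases h0 : f = e; · exact ⟨0, h0⟩
  by_cases h1 : ProcEdge f e; · exact ⟨1, h1⟩
  by_cases h2 : ProcEdge e f; · exact ⟨2, h2⟩
  by_cases h3 : M.msg f e; · exact ⟨3, h3⟩
  by_cases h4 : M.msg e f; · exact ⟨4, h4⟩
  by_cases h5 : M.le f e; · exact ⟨5, h5, h0, h1, h3⟩
  by_cases h6 : M.le e f; · exact ⟨6, h6, h0, h2, h4⟩
  exact ⟨7, h5, h6⟩

theorem MSC.Rel.inv {ρ : ℕ} {e f : M.E} (h : M.Rel ρ e f) : M.Rel (invRel ρ) f e := by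
  have := h.lt
  interval_cases ρ <;> simp_all [MSC.Rel, invRel] <;> aesop

theorem MSC.Rel.facts {ρ : ℕ} {e f : M.E} (h : M.Rel ρ e f) :
    (ρ = 0 ↔ e = f) ∧ (ρ = 2 ↔ ProcEdge e f) ∧ (ρ = 4 ↔ M.msg e f) ∧
      (ρ = 0 ∨ ρ = 2 ∨ ρ = 4 ∨ ρ = 6 ↔ M.le e f) := by
  have pe : ∀ {a b : M.E}, ProcEdge a b → M.le a b := fun h => MSC.le_of_ple h.ple
  have me : ∀ {a b : M.E}, M.msg a b → M.le a b := fun h => MSC.le_of_msg h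
  have as : ∀ {a b : M.E}, M.le a b → M.le b a → a = b := fun h h' => MSC.le.antisymm h h'
  have p0 : ∀ a : M.E, ¬ProcEdge a a := fun a h => by have := h.2; omega
  have m0 : ∀ a : M.E, ¬M.msg a a := fun a h => M.msg_ne a a h rfl
  have pm : ∀ {a b : M.E}, ProcEdge a b → ¬M.msg a b := fun h h' => M.msg_ne _ _ h' h.1
  have r : M.le e e := MSC.le_refl e
  by_cases hef : e = f
  · subst hef
    have := h.lt
    interval_cases ρ <;> simp_all [MSC.Rel]
  have := h.lt
  have a1 : M.le e f → ¬ M.le f e := fun h h' => hef (as h h')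
  have a2 : ProcEdge e f → M.le e f := pe
  have a3 : ProcEdge f e → M.le f e := pe
  have a4 : M.msg e f → M.le e f := me
  have a5 : M.msg f e → M.le f e := me
  have a6 : ProcEdge e f → ¬M.msg e f := pm
  clear pe me as p0 m0 pm
  have hef' : f ≠ e := fun h => hef h.symm
  interval_cases ρ <;> simp only [MSC.Rel] at h <;> simp <;> tauto

end Rel

/-- The relation code between the values of the variables `x` and `y`, where `ρ` is the one
between the values of `0` and `1`. -/
def varRel (ρ x y : ℕ) : ℕ := if x = y then 0 else if x = 0 then ρ else invRel ρ

@[fun_prop] theorem primrec_varRel {α : Type} [Primcodable α] {f g h : α → ℕ} (hf : Primrec f)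
    (hg : Primrec g) (hh : Primrec h) : Primrec fun a => varRel (f a) (g a) (h a) := by
  unfold varRel; fun_prop

/-- One step of the evaluation of a formula in prefix notation from right to left: `σ` is the
symbol read, `rest` the string to the right of it, and `st` the stack of truth values that `rest`
evaluates to. Atoms push their truth value. For monadic atoms and quantified formulas it is looked
up in the bit strings `b₀` and `b₁` that are the types of the values of the variables `0` and `1`,
at the position of the symbol or, for `x ∈ X`, at the first occurrence of `X` in the formula. -/
def evalStep (code : List (ℕ × ℕ)) (b₀ b₁ : ℕ → Bool) (ρ : ℕ) (σ : ℕ × ℕ) (rest : List (ℕ × ℕ))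
    (st : List Bool) : List Bool :=
  if σ.1 = 0 ∨ σ.1 = 1 then
    (if rest.headI.2 = 0 then b₀ (code.length - (rest.length + 1))
      else b₁ (code.length - (rest.length + 1))) :: st
  else if σ.1 = 4 then
    if σ.2 = 0 then
      (if rest.headI.2 = 0 then b₀ (code.idxOf (3, rest.tail.headI.2))
        else b₁ (code.idxOf (3, rest.tail.headI.2))) :: st
    else if σ.2 = 1 then decide (varRel ρ rest.headI.2 rest.tail.headI.2 = 0) :: st
    else if σ.2 = 2 then decide (varRel ρ rest.headI.2 rest.tail.headI.2 = 2) :: st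
    else if σ.2 = 3 then decide (varRel ρ rest.headI.2 rest.tail.headI.2 = 4) :: st
    else if σ.2 = 4 then
      decide (varRel ρ rest.headI.2 rest.tail.headI.2 = 0 ∨
        varRel ρ rest.headI.2 rest.tail.headI.2 = 2 ∨
        varRel ρ rest.headI.2 rest.tail.headI.2 = 4 ∨
        varRel ρ rest.headI.2 rest.tail.headI.2 = 6) :: st
    else if σ.2 = 5 then (st.headI || st.tail.headI) :: st.tail.tail
    else if σ.2 = 6 then (!st.headI) :: st.tail
    else if rest.headI.1 = 3 then st
    else (if rest.headI.2 = 0 then b₁ (code.length - (rest.length + 1))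
      else b₀ (code.length - (rest.length + 1))) :: st.tail
  else st

/-- The stack of truth values to which a suffix of the string `code` evaluates. -/
def evalStack (code : List (ℕ × ℕ)) (b₀ b₁ : ℕ → Bool) (ρ : ℕ) (l : List (ℕ × ℕ)) : List Bool :=
  List.rec [] (fun σ rest st => evalStep code b₀ b₁ ρ σ rest st) l

@[fun_prop] theorem primrec_evalStack {α : Type} [Primcodable α] {code l : α → List (ℕ × ℕ)}
    {t₀ t₁ ρ : α → ℕ} (hc : Primrec code) (h₀ : Primrec t₀) (h₁ : Primrec t₁) (hρ : Primrec ρ)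
    (hl : Primrec l) :
    Primrec fun a => evalStack (code a) (t₀ a).testBit (t₁ a).testBit (ρ a) (l a) := by
  unfold evalStack
  refine Primrec.list_rec (h := fun a (y : (ℕ × ℕ) × List (ℕ × ℕ) × List Bool) =>
    evalStep (code a) (t₀ a).testBit (t₁ a).testBit (ρ a) y.1 y.2.1 y.2.2) hl
    (Primrec.const []) ?_
  unfold Primrec₂ evalStep
  fun_prop

/-- The evaluation of a suffix depends, apart from the bits at symbols other than quantifiers,
only on bits at positions in this suffix. -/
theorem evalStack_congr {code : List (ℕ × ℕ)} {b₀ b₁ b₀' b₁' : ℕ → Bool} (ρ : ℕ)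
    {l : List (ℕ × ℕ)} (hl : l.length ≤ code.length)
    (h : ∀ j, code.getD j (0, 0) ≠ (4, 7) ∨ code.length - l.length ≤ j →
      b₀ j = b₀' j ∧ b₁ j = b₁' j) :
    evalStack code b₀ b₁ ρ l = evalStack code b₀' b₁' ρ l := by
  induction l with
  | nil => rfl
  | cons σ l ih =>
    have ih' := ih (by simp at hl; omega) fun j hj => h j (hj.imp_right fun h => by simp; omega)
    have hidx : ∀ X, code.getD (code.idxOf (3, X)) (0, 0) ≠ (4, 7) := by
      intro X
      by_cases hX : (3, X) ∈ code
      · rw [List.getD_eq_getElem _ _ (List.idxOf_lt_length_of_mem hX), List.getElem_idxOf]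
        simp
      · rw [List.idxOf_of_notMem hX]; simp
    have hpos := h (code.length - (l.length + 1)) (Or.inr (by simp))
    change evalStep code b₀ b₁ ρ σ l (evalStack code b₀ b₁ ρ l) =
      evalStep code b₀' b₁' ρ σ l (evalStack code b₀' b₁' ρ l)
    rw [ih']
    unfold evalStep
    rw [hpos.1, hpos.2, (h _ (Or.inl (hidx _))).1, (h _ (Or.inl (hidx _))).2]

/-- The truth of the formula quantified at position `i`, where the quantified variable has type
`b'` and the other one `b`, and `ρ` relates the latter to the former. -/
def quantTruth (code : List (ℕ × ℕ)) (i : ℕ) (b b' : ℕ → Bool) (ρ : ℕ) : Bool :=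
  if (code.getD (i + 1) (0, 0)).2 = 0 then
    (evalStack code b' b (invRel ρ) (code.drop (i + 2))).headI
  else (evalStack code b b' ρ (code.drop (i + 2))).headI

@[fun_prop] theorem primrec_quantTruth {α : Type} [Primcodable α] {code : α → List (ℕ × ℕ)}
    {i t t' ρ : α → ℕ} (hc : Primrec code) (hi : Primrec i) (h₀ : Primrec t) (h₁ : Primrec t')
    (hρ : Primrec ρ) :
    Primrec fun a => quantTruth (code a) (i a) (t a).testBit (t' a).testBit (ρ a) := by
  unfold quantTruth
  fun_prop

/-- The position `i` carries a first-order quantifier. -/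
def QuantAt (code : List (ℕ × ℕ)) (i : ℕ) : Prop :=
  code.getD i (0, 0) = (4, 7) ∧ (code.getD (i + 1) (0, 0)).1 = 2

section Typing
variable {k s : ℕ} {M : MSC (Fin k) (Fin s)}

/-- The bits at quantifiers are truth values of the quantified formulas. -/
def QuantCorrect (code : List (ℕ × ℕ)) (B : M.E → ℕ → Bool) (i : ℕ) : Prop :=
  ∀ e, B e i ↔ ∃ ρ f, M.Rel ρ e f ∧ quantTruth code i (B e) (B f) ρ

/-- Bits at symbols other than quantifiers can be extended by correct bits at quantifiers. -/
theorem exists_quantCorrect (code : List (ℕ × ℕ)) (U : M.E → ℕ → Bool) :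
    ∃ B : M.E → ℕ → Bool, (∀ e j, code.getD j (0, 0) ≠ (4, 7) → B e j = U e j) ∧
      ∀ i, QuantAt code i → QuantCorrect code B i := by
  classical
  suffices H : ∀ m ≤ code.length, ∃ B : M.E → ℕ → Bool,
      (∀ e j, code.getD j (0, 0) ≠ (4, 7) → B e j = U e j) ∧
      ∀ i, code.length - m ≤ i → QuantAt code i → QuantCorrect code B i by
    obtain ⟨B, h1, h2⟩ := H _ le_rfl
    exact ⟨B, h1, fun i => h2 i (by omega)⟩
  intro m
  induction m with
  | zero =>
    refine fun _ => ⟨U, fun _ _ _ => rfl, fun i hi h => ?_⟩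
    have := h.1
    rw [List.getD_eq_default _ _ (by omega)] at this
    simp at this
  | succ m ih =>
    intro hm
    obtain ⟨B, h1, h2⟩ := ih (by omega)
    set p := code.length - (m + 1) with hp
    by_cases hq : QuantAt code p
    swap
    · refine ⟨B, h1, fun i hi h => ?_⟩
      by_cases hip : i = p
      · exact absurd (hip ▸ h) hq
      · exact h2 i (by omega) h
    let B' : M.E → ℕ → Bool := fun e => Function.update (B e) p
      (decide (∃ ρ f, M.Rel ρ e f ∧ quantTruth code p (B e) (B f) ρ))
    have hB' : ∀ e j, j ≠ p → B' e j = B e j := fun e j hj => Function.update_of_ne hj _ _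
    have hloc : ∀ i ≥ p, ∀ e f ρ, quantTruth code i (B' e) (B' f) ρ =
        quantTruth code i (B e) (B f) ρ := by
      intro i hi e f ρ
      have hne : ∀ j, code.getD j (0, 0) ≠ (4, 7) ∨
          code.length - (code.drop (i + 2)).length ≤ j → j ≠ p := by
        rintro j (h | h) rfl
        · exact h hq.1
        · simp at h; omega
      unfold quantTruth
      rw [evalStack_congr (b₀ := B' f) (b₁ := B' e) _ (by simp)
        fun j hj => ⟨hB' f j (hne j hj), hB' e j (hne j hj)⟩,
        evalStack_congr (b₀ := B' e) (b₁ := B' f) _ (by simp)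
        fun j hj => ⟨hB' e j (hne j hj), hB' f j (hne j hj)⟩]
    refine ⟨B', fun e j hj => ?_, fun i hi h e => ?_⟩
    · rw [hB' e j (by rintro rfl; exact hj hq.1), h1 e j hj]
    · simp only [hloc i hi]
      by_cases hip : i = p
      · subst hip
        simp [B']
      · rw [hB' e i hip]
        exact h2 i (by omega) h e

/-- Bits at process names and letters are correct. -/
def MonadicCorrect (code : List (ℕ × ℕ)) (B : M.E → ℕ → Bool) : Prop :=
  ∀ e i, ((code.getD i (0, 0)).1 = 0 → i < code.length →
      (B e i ↔ e.1.val = (code.getD i (0, 0)).2)) ∧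
    ((code.getD i (0, 0)).1 = 1 → (B e i ↔ (M.label e).val = (code.getD i (0, 0)).2))

theorem MSO.code_or (φ ψ : MSO (Fin k) (Fin s)) : (φ.or ψ).code = (4, 5) :: (φ.code ++ ψ.code) := by
  simp [MSO.code, MSO.toSymbols, Symbol.code]

theorem MSO.code_not (φ : MSO (Fin k) (Fin s)) : φ.not.code = (4, 6) :: φ.code := rfl

theorem MSO.code_exFO (x : ℕ) (φ : MSO (Fin k) (Fin s)) :
    (φ.exFO x).code = (4, 7) :: (2, x) :: φ.code := rfl

theorem MSO.code_exSO (x : ℕ) (φ : MSO (Fin k) (Fin s)) :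
    (φ.exSO x).code = (4, 7) :: (3, x) :: φ.code := rfl

theorem evalStack_cons (code : List (ℕ × ℕ)) (b₀ b₁ : ℕ → Bool) (ρ : ℕ) (σ : ℕ × ℕ)
    (l : List (ℕ × ℕ)) : evalStack code b₀ b₁ ρ (σ :: l) =
      evalStep code b₀ b₁ ρ σ l (evalStack code b₀ b₁ ρ l) := rfl

theorem varRel_spec {ρ x y : ℕ} {v : ℕ → M.E} (h : M.Rel ρ (v 0) (v 1)) (hx : x < 2)
    (hy : y < 2) : M.Rel (varRel ρ x y) (v x) (v y) := by
  unfold varRel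
  interval_cases x <;> interval_cases y <;> simp
  · rfl
  · exact h
  · exact h.inv
  · rfl

open Classical in
/-- Evaluation from correct types yields the truth values of two-variable formulas. -/
theorem evalStack_eq {code : List (ℕ × ℕ)} {B : M.E → ℕ → Bool} (hm : MonadicCorrect code B)
    (hq : ∀ i, QuantAt code i → QuantCorrect code B i) (χ : MSO (Fin k) (Fin s)) (hχ : χ.IsFO2)
    (pre rest : List (ℕ × ℕ)) (hcode : code = pre ++ (χ.code ++ rest)) (v : ℕ → M.E) (ρ : ℕ)
    (hρ : M.Rel ρ (v 0) (v 1)) :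
    evalStack code (B (v 0)) (B (v 1)) ρ (χ.code ++ rest) =
      decide (χ.Sat M v fun X => {e | B e (code.idxOf (3, X))}) ::
        evalStack code (B (v 0)) (B (v 1)) ρ rest := by
  induction χ generalizing pre rest v ρ with
  | proc p x =>
    have h := (hm (v x) pre.length).1 (by simp [hcode, MSO.code, MSO.toSymbols, Symbol.code])
      (by simp [hcode, MSO.code, MSO.toSymbols])
    have hl : code.length - (rest.length + 1 + 1) = pre.length := by
      simp [hcode, MSO.code, MSO.toSymbols]
    have hg : (code.getD pre.length (0, 0)).2 = p := by
      simp [hcode, MSO.code, MSO.toSymbols, Symbol.code]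
    rw [hg] at h
    change evalStack _ _ _ _ ((0, p.val) :: (2, x) :: rest) = _
    simp only [MSO.IsFO2] at hχ
    interval_cases x <;>
    simp [evalStack_cons, evalStep, hl, MSO.Sat, Fin.ext_iff, ← h]
  | label a x =>
    have h := (hm (v x) pre.length).2 (by simp [hcode, MSO.code, MSO.toSymbols, Symbol.code])
    have hl : code.length - (rest.length + 1 + 1) = pre.length := by
      simp [hcode, MSO.code, MSO.toSymbols]
    have hg : (code.getD pre.length (0, 0)).2 = a := by
      simp [hcode, MSO.code, MSO.toSymbols, Symbol.code]
    rw [hg] at h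
    change evalStack _ _ _ _ ((1, a.val) :: (2, x) :: rest) = _
    simp only [MSO.IsFO2] at hχ
    interval_cases x <;>
    simp [evalStack_cons, evalStep, hl, MSO.Sat, Fin.ext_iff, ← h]
  | mem x X =>
    change evalStack _ _ _ _ ((4, 0) :: (2, x) :: (3, X) :: rest) = _
    simp only [MSO.IsFO2] at hχ
    interval_cases x <;> simp [evalStack_cons, evalStep] <;> rw [Bool.eq_iff_iff] <;>
      simp <;> rfl
  | eq x y =>
    change evalStack _ _ _ _ ((4, 1) :: (2, x) :: (2, y) :: rest) = _
    simp [evalStack_cons, evalStep, MSO.Sat, (varRel_spec hρ hχ.1 hχ.2).facts.1]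
    congr
  | edge x y =>
    change evalStack _ _ _ _ ((4, 2) :: (2, x) :: (2, y) :: rest) = _
    simp [evalStack_cons, evalStep, MSO.Sat, (varRel_spec hρ hχ.1 hχ.2).facts.2.1]
    congr
  | msg x y =>
    change evalStack _ _ _ _ ((4, 3) :: (2, x) :: (2, y) :: rest) = _
    simp [evalStack_cons, evalStep, MSO.Sat, (varRel_spec hρ hχ.1 hχ.2).facts.2.2.1]
    congr
  | le x y =>
    change evalStack _ _ _ _ ((4, 4) :: (2, x) :: (2, y) :: rest) = _
    simp only [evalStack_cons, evalStep, List.headI_cons, List.tail_cons]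
    simp only [(varRel_spec hρ hχ.1 hχ.2).facts.2.2.2]
    simp [MSO.Sat]
    congr
  | or φ ψ ih1 ih2 =>
    rw [MSO.code_or, List.cons_append, List.append_assoc, evalStack_cons,
      ih1 hχ.1 (pre ++ [(4, 5)]) _ (by simp [hcode, MSO.code_or]) v ρ hρ,
      ih2 hχ.2 (pre ++ (4, 5) :: φ.code) _ (by simp [hcode, MSO.code_or]) v ρ hρ]
    simp [evalStep]
    rw [Bool.eq_iff_iff]
    simp
    rfl
  | not φ ih =>
    rw [MSO.code_not, List.cons_append, evalStack_cons,
      ih hχ (pre ++ [(4, 6)]) _ (by simp [hcode, MSO.code_not]) v ρ hρ]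
    simp only [evalStep, MSO.Sat]
    by_cases h : φ.Sat M v fun X => {e | B e (code.idxOf (3, X))} <;> simp [h]
  | exSO X φ => exact hχ.elim
  | exFO x φ ih =>
    have hc : code = (pre ++ [(4, 7), (2, x)]) ++ (φ.code ++ rest) := by
      simp [hcode, MSO.code_exFO]
    have hl : code.length - (φ.code.length + rest.length + 1 + 1) = pre.length := by
      simp [hcode, MSO.code_exFO]
    have hdrop : code.drop (pre.length + 2) = φ.code ++ rest := by
      rw [hc]; exact List.drop_left' (by simp)
    have h := hq pre.length (by simp [QuantAt, hcode, MSO.code_exFO])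
    have hg : (code.getD (pre.length + 1) (0, 0)).2 = x := by
      simp [hcode, MSO.code_exFO]
    have key : ∀ y, y < 2 → y ≠ x → (B (v y) pre.length ↔
        (φ.exFO x).Sat M v fun X => {e | B e (code.idxOf (3, X))}) := by
      intro y hy hyx
      rw [h (v y)]
      have hx := hχ.1
      have step : ∀ ρ' f, M.Rel ρ' (v y) f → (quantTruth code pre.length (B (v y)) (B f) ρ' ↔
          φ.Sat M (Function.update v x f) fun X => {e | B e (code.idxOf (3, X))}) := by
        intro ρ' f hf
        unfold quantTruth
        rw [hdrop, hg]
        have hy' : y = if x = 0 then 1 else 0 := by split_ifs <;> omega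
        by_cases h0 : x = 0
        · subst h0
          obtain rfl : y = 1 := by simpa using hy'
          have := ih hχ.2 _ _ hc (Function.update v 0 f) _ hf.inv
          simp only [Function.update_self, ne_eq, one_ne_zero, not_false_eq_true,
            Function.update_of_ne] at this
          simp [this]
        · obtain rfl : x = 1 := by omega
          obtain rfl : y = 0 := by simpa using hy'
          have := ih hχ.2 _ _ hc (Function.update v 1 f) _ hf
          simp only [Function.update_self, ne_eq, zero_ne_one, not_false_eq_true,
            Function.update_of_ne] at this
          simp [this]
      constructor
      · rintro ⟨ρ', f, hf, ht⟩
        exact ⟨f, (step ρ' f hf).1 ht⟩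
      · rintro ⟨f, ht⟩
        obtain ⟨ρ', hf⟩ := M.exists_rel (v y) f
        exact ⟨ρ', f, hf, (step ρ' f hf).2 ht⟩
    rw [MSO.code_exFO, List.cons_append, List.cons_append, evalStack_cons, evalStack_cons,
      ih hχ.2 _ _ hc v ρ hρ]
    have hx := hχ.1
    have k1 : ∀ h0 : x = 0, _ := fun h0 => key 1 (by omega) (by omega)
    have k0 : ∀ h0 : x ≠ 0, _ := fun h0 => key 0 (by omega) (by omega)
    by_cases h0 : x = 0
    · simp only [← k1 h0]
      simp [evalStep, h0, hl]
    · simp only [← k0 h0]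
      simp [evalStep, h0, hl]

/-- The part of a formula below the second-order quantifiers in front of it. -/
def MSO.matrix : MSO (Fin k) (Fin s) → MSO (Fin k) (Fin s)
  | .exSO _ φ => φ.matrix
  | φ => φ

theorem MSO.sat_congr {χ : MSO (Fin k) (Fin s)} {v v' : ℕ → M.E} {V V' : ℕ → Set M.E}
    (hv : ∀ x ∈ χ.freeFO, v x = v' x) (hV : ∀ X ∈ χ.freeSO, V X = V' X) :
    χ.Sat M v V ↔ χ.Sat M v' V' := by
  induction χ generalizing v v' V V' with
  | or φ ψ ih1 ih2 =>
    exact or_congr (ih1 (fun x h => hv x (Or.inl h)) fun x h => hV x (Or.inl h))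
      (ih2 (fun x h => hv x (Or.inr h)) fun x h => hV x (Or.inr h))
  | not φ ih => exact not_congr (ih hv hV)
  | exFO x φ ih =>
    refine exists_congr fun e => ih (fun y hy => ?_) hV
    by_cases h : y = x
    · subst h; simp
    · simpa [h] using hv y ⟨hy, h⟩
  | exSO x φ ih =>
    refine exists_congr fun e => ih hv (fun y hy => ?_)
    by_cases h : y = x
    · subst h; simp
    · simpa [h] using hV y ⟨hy, h⟩
  | proc p x => simp [Sat, hv x rfl]
  | label p x => simp [Sat, hv x rfl]
  | mem x X => simp [Sat, hv x rfl, hV X rfl]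
  | _ x y => simp [Sat, hv x (Or.inl rfl), hv y (Or.inr rfl)]

theorem MSO.freeFO_matrix (φ : MSO (Fin k) (Fin s)) : φ.matrix.freeFO = φ.freeFO := by
  induction φ with
  | exSO X φ ih => exact ih
  | _ => rfl

theorem MSO.IsEMSO2.matrix {φ : MSO (Fin k) (Fin s)} (h : φ.IsEMSO2) : φ.matrix.IsFO2 := by
  induction φ with
  | exSO X φ ih => exact ih h
  | _ => exact h

theorem MSO.sat_iff_matrix (φ : MSO (Fin k) (Fin s)) (v : ℕ → M.E) (V : ℕ → Set M.E) :
    φ.Sat M v V ↔ ∃ V', (∀ X ∈ φ.freeSO, V X = V' X) ∧ φ.matrix.Sat M v V' := by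
  induction φ generalizing V with
  | exSO X φ ih =>
    constructor
    · rintro ⟨S, h⟩
      obtain ⟨V', h1, h2⟩ := (ih _).1 h
      refine ⟨V', fun Y hY => ?_, h2⟩
      simpa [show Y ≠ X from hY.2] using h1 Y hY.1
    · rintro ⟨V', h1, h2⟩
      refine ⟨V' X, (ih _).2 ⟨V', fun Y hY => ?_, h2⟩⟩
      by_cases h : Y = X
      · subst h; simp
      · simpa [h] using h1 Y ⟨hY, h⟩
  | _ => exact ⟨fun h => ⟨V, fun _ _ => rfl, h⟩,
      fun ⟨V', h1, h2⟩ => (sat_congr (fun _ _ => rfl) h1).2 h2⟩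

theorem MSO.mem_code_of_mem_freeSO {χ : MSO (Fin k) (Fin s)} {X : ℕ} (h : X ∈ χ.freeSO) :
    (3, X) ∈ χ.code := by
  induction χ with
  | or φ ψ ih1 ih2 =>
    rw [code_or]
    rcases h with h | h
    · simp [ih1 h]
    · simp [ih2 h]
  | not φ ih => simp [code_not, ih h]
  | exFO x φ ih => simp [code_exFO, ih h]
  | exSO x φ ih => simp [code_exSO, ih h.1]
  | mem x Y => obtain rfl : X = Y := h; simp [code, toSymbols, Symbol.code]
  | _ => exact h.elim

theorem MSO.code_matrix (φ : MSO (Fin k) (Fin s)) : ∃ pre, φ.code = pre ++ φ.matrix.code ∧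
    ∀ code b₀ b₁ ρ, evalStack code b₀ b₁ ρ φ.code = evalStack code b₀ b₁ ρ φ.matrix.code := by
  induction φ with
  | exSO X φ ih =>
    obtain ⟨pre, h1, h2⟩ := ih
    refine ⟨(4, 7) :: (3, X) :: pre, by simp [code_exSO, h1, matrix], fun c b₀ b₁ ρ => ?_⟩
    change _ = evalStack c b₀ b₁ ρ φ.matrix.code
    rw [← h2, code_exSO, evalStack_cons, evalStack_cons]
    simp [evalStep]
  | _ => exact ⟨[], rfl, fun _ _ _ _ => rfl⟩

/-- An assignment of types to the events, coded as bit strings, that is correct for the formula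
`code`. -/
structure Typing (M : MSC (Fin k) (Fin s)) (code : List (ℕ × ℕ)) (T : M.E → ℕ) : Prop where
  lt : ∀ e, T e < 2 ^ code.length
  monadic : MonadicCorrect code fun e => (T e).testBit
  quant : ∀ i, QuantAt code i → QuantCorrect code (fun e => (T e).testBit) i
  top : ∀ e, (evalStack code (T e).testBit (T e).testBit 0 code).headI

/-- A sentence holds in a chart if and only if the events have correct types. -/
theorem mem_language_iff_typing {φ : MSO (Fin k) (Fin s)} (hφ : φ.IsEMSO2) (hs : φ.IsSentence)
    (M : MSC (Fin k) (Fin s)) : M ∈ φ.language ↔ ∃ T, Typing M φ.code T := by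
  classical
  obtain ⟨pre, hpre, heval⟩ := φ.code_matrix
  obtain ⟨p0, hp0⟩ := M.nonempty
  have e0 : M.E := ⟨p0, ⟨0, List.length_pos_iff.2 hp0⟩⟩
  have htop : ∀ B : M.E → ℕ → Bool, MonadicCorrect φ.code B →
      (∀ i, QuantAt φ.code i → QuantCorrect φ.code B i) → ∀ e,
      ((evalStack φ.code (B e) (B e) 0 φ.code).headI ↔
        φ.matrix.Sat M (fun _ => e) fun X => {e | B e (φ.code.idxOf (3, X))}) := by
    intro B hm hq e
    have := evalStack_eq hm hq φ.matrix hφ.matrix pre [] (by simpa using hpre) (fun _ => e) 0 rfl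
    rw [List.append_nil] at this
    rw [heval, this]
    simp
  have hfree : ∀ v v' : ℕ → M.E, ∀ V, φ.matrix.Sat M v V → φ.matrix.Sat M v' V := by
    intro v v' V h
    refine (MSO.sat_congr (fun x hx => ?_) fun _ _ => rfl).1 h
    rw [MSO.freeFO_matrix, hs.1] at hx
    exact hx.elim
  constructor
  · intro h
    obtain ⟨V, -, hV⟩ := (φ.sat_iff_matrix _ _).1 (h (fun _ => e0) fun _ => ∅)
    obtain ⟨B, hB1, hB2⟩ := exists_quantCorrect (M := M) φ.code fun e i =>
      decide (i < φ.code.length) &&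
      if (φ.code.getD i (0, 0)).1 = 0 then decide (e.1.val = (φ.code.getD i (0, 0)).2)
      else if (φ.code.getD i (0, 0)).1 = 1 then
        decide ((M.label e).val = (φ.code.getD i (0, 0)).2)
      else decide (e ∈ V (φ.code.getD i (0, 0)).2)
    let T : M.E → ℕ := fun e => Nat.ofBits fun i : Fin φ.code.length => B e i
    have hT : ∀ e, (T e).testBit = B e := by
      intro e
      funext i
      by_cases hi : i < φ.code.length
      · exact Nat.testBit_ofBits_lt _ i hi
      · rw [hB1 e i (by rw [List.getD_eq_default _ _ (by omega)]; simp)]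
        simp only [hi, decide_false, Bool.false_and]
        exact Nat.testBit_ofBits_ge _ i (by omega)
    have hm : MonadicCorrect φ.code B := by
      refine fun e i => ⟨fun h hi => ?_, fun h => ?_⟩
      · rw [hB1 e i (fun hc => by rw [hc] at h; cases h), if_pos h]
        simp [hi]
      · have hi : i < φ.code.length := by
          by_contra hc
          rw [List.getD_eq_default _ _ (by omega)] at h
          simp at h
        rw [hB1 e i (fun hc => by rw [hc] at h; cases h), if_neg (by omega), if_pos h]
        simp [hi]
    refine ⟨T, fun e => Nat.ofBits_lt_two_pow _, ?_, ?_, fun e => ?_⟩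
    · simpa only [hT] using hm
    · simpa only [hT] using hB2
    · simp only [hT]
      refine (htop B hm hB2 e).2 ((MSO.sat_congr (fun _ _ => rfl) fun X hX => ?_).1
        (hfree _ (fun _ => e) V hV))
      have hmem : (3, X) ∈ φ.code := by
        rw [hpre]
        exact List.mem_append_right _ (MSO.mem_code_of_mem_freeSO hX)
      have hlt := List.idxOf_lt_length_of_mem hmem
      have hg : φ.code.getD (φ.code.idxOf (3, X)) (0, 0) = (3, X) := by
        rw [List.getD_eq_getElem _ _ hlt, List.getElem_idxOf]
      ext f
      rw [Set.mem_ofPred_eq, hB1 f _ (by rw [hg]; simp), hg]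
      simp [hlt]
  · rintro ⟨T, hT⟩ v V
    refine (φ.sat_iff_matrix _ _).2 ⟨fun X => {e | (T e).testBit (φ.code.idxOf (3, X))},
      fun X hX => ?_, hfree (fun _ => e0) _ _ ?_⟩
    · rw [hs.2] at hX; exact hX.elim
    · exact (htop _ hT.monadic hT.quant e0).1 (hT.top e0)

end Typing

/-! ### The annotation of an event -/

/-- Names of the bits of an annotation: a kind, a half (`0` or `1`) or a threshold, a type, two
process sequences, and a process or position. -/
abbrev Var : Type := ℕ × ℕ × ℕ × (List ℕ × List ℕ) × ℕ

/-- The event is on process `q`. -/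
abbrev vProc (q : ℕ) : Var := (0, 0, 0, ([], []), q)

/-- The event is on process `q` and has type `t`. -/
abbrev vCell (q t : ℕ) : Var := (1, 0, t, ([], []), q)

/-- More than `b` events on process `q` of type `t` are less than or equal to the event. -/
abbrev vPast (b q t : ℕ) : Var := (2, b, t, ([], []), q)

/-- More than `b` events on process `q` of type `t` are greater than or equal to the event. -/
abbrev vFut (b q t : ℕ) : Var := (3, b, t, ([], []), q)

/-- Some event on process `q` of type `t` is incomparable to the event. -/
abbrev vOther (q t : ℕ) : Var := (4, 0, t, ([], []), q)

/-- The data of `PathRules`, numbered by `c`, for a path through all the events on process `q` of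
type `t` and all the events of process `p` that are comparable to each of them. -/
abbrev vPath (c p q t : ℕ) : Var := (5 + c, 0, t, ([p], []), q)

/-- The data of `StationRules` and `SignalRules`, numbered by `c`, for the events on one process of
type `t` and the process sequences `W` and `W'` that lead to another process and back. The half `0`
is where the events of type `t` are, and the half `1` is the other process; `W` starts in the
process of the half. The position on `W` is `i`. -/
abbrev vHalf (c h t : ℕ) (W W' : List ℕ) (i : ℕ) : Var := (10 + c, h, t, (W, W'), i)

/-- All the bits. -/
def vars (k n : ℕ) : List Var :=
  (List.range 16).flatMap fun c => (List.range 2).flatMap fun h => (List.range (2 ^ n)).flatMap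
    fun t => (words k).flatMap fun W => (words k).flatMap fun W' => (List.range k).map
      fun i => (c, h, t, (W, W'), i)

theorem mem_vars {k n c h t i : ℕ} {W W' : List ℕ} : (c, h, t, (W, W'), i) ∈ vars k n ↔
    c < 16 ∧ h < 2 ∧ t < 2 ^ n ∧ W ∈ words k ∧ W' ∈ words k ∧ i < k := by
  simp only [vars, List.mem_flatMap, List.mem_map, List.mem_range, Prod.mk.injEq]
  constructor
  · rintro ⟨_, h1, _, h2, _, h3, _, h4, _, h5, _, h6, rfl, rfl, rfl, ⟨rfl, rfl⟩, rfl⟩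
    exact ⟨h1, h2, h3, h4, h5, h6⟩
  · rintro ⟨h1, h2, h3, h4, h5, h6⟩
    exact ⟨_, h1, _, h2, _, h3, _, h4, _, h5, _, h6, rfl, rfl, rfl, ⟨rfl, rfl⟩, rfl⟩

theorem length_vars (k n : ℕ) :
    (vars k n).length = 32 * 2 ^ n * (words k).length ^ 2 * k := by
  simp only [vars, List.length_flatMap, List.length_map, List.length_range, List.map_const',
    List.sum_replicate, smul_eq_mul]
  ring

/-- What can be observed at an event: its own bits, those of the neighbouring events, and those of
the sender of the message it receives if this sender is on a given process. -/
structure View where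
  /-- the bits of the event -/
  own : Var → Prop
  /-- the bits of the previous event of the process -/
  prev : Var → Prop
  /-- the bits of the next event of the process -/
  next : Var → Prop
  /-- the bits of the sender of the message received -/
  snd : Var → Prop
  /-- the bits of the receiver of the message sent -/
  rcv : Var → Prop
  /-- the bits of the sender of the message received if it is on the given process -/
  sndOn : ℕ → Var → Prop

/-- The observations in a chart whose events carry the bits `B`. -/
def semView {P Lab : Type} (M : MSC P Lab) (B : M.E → Var → Prop) (e : M.E) : View where
  own := B e
  prev v := ∃ g, ProcEdge g e ∧ B g v
  next v := ∃ g, ProcEdge e g ∧ B g v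
  snd v := ∃ g, M.msg g e ∧ B g v
  rcv v := ∃ g, M.msg e g ∧ B g v
  sndOn r v := ∃ g, M.msg g e ∧ B g (vProc r) ∧ B g v

/-- The observations made from the arguments of a local condition. -/
def argView (vs : List Var) (x : LocalArgs) : View where
  own v := x.2.2.1.testBit (vs.idxOf v)
  prev v := x.2.2.2.1.testBit (vs.idxOf v)
  next v := x.2.2.2.2.1.testBit (vs.idxOf v)
  snd v := x.2.2.2.2.2.1.testBit (vs.idxOf v)
  rcv v := x.2.2.2.2.2.2.testBit (vs.idxOf v)
  sndOn r v := x.2.2.2.2.2.1.testBit (vs.idxOf (vProc r)) ∧ x.2.2.2.2.2.1.testBit (vs.idxOf v)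

theorem valueAt_iff {α : Type} {γ : α → ℕ} {R : α → Prop} (hu : ∀ f g, R f → R g → f = g)
    {C : ℕ → Prop} (hC : ¬ C 0) : C (valueAt γ R) ↔ ∃ f, R f ∧ C (γ f) := by
  by_cases h : ∃ f, R f
  · obtain ⟨f, hf⟩ := h
    rw [valueAt_eq hf fun g hg => hu g f hg hf]
    exact ⟨fun h => ⟨f, hf, h⟩, fun ⟨g, hg, h⟩ => hu g f hg hf ▸ h⟩
  · rw [valueAt_none h]
    exact iff_of_false hC fun ⟨f, hf, _⟩ => h ⟨f, hf⟩

theorem argView_localArgs {k s : ℕ} {M : MSC (Fin k) (Fin s)} (γ : M.E → ℕ) (vs : List Var)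
    (e : M.E) : argView vs (localArgs γ e) =
      semView M (fun e v => (γ e).testBit (vs.idxOf v)) e := by
  have h1 := fun v => valueAt_iff (γ := γ) (R := fun f => ProcEdge f e)
    (fun f g h h' => h.left_unique h') (C := fun x => x.testBit (vs.idxOf v)) (by simp)
  have h2 := fun v => valueAt_iff (γ := γ) (R := fun f => ProcEdge e f)
    (fun f g h h' => h.right_unique h') (C := fun x => x.testBit (vs.idxOf v)) (by simp)
  have h3 := fun v => valueAt_iff (γ := γ) (R := fun f => M.msg f e)
    (fun f g h h' => M.msg_left_unique h h') (C := fun x => x.testBit (vs.idxOf v)) (by simp)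
  have h4 := fun v => valueAt_iff (γ := γ) (R := fun f => M.msg e f)
    (fun f g h h' => M.msg_right_unique h h') (C := fun x => x.testBit (vs.idxOf v)) (by simp)
  have h5 := fun r v => valueAt_iff (γ := γ) (R := fun f => M.msg f e)
    (fun f g h h' => M.msg_left_unique h h')
    (C := fun x => x.testBit (vs.idxOf (vProc r)) ∧ x.testBit (vs.idxOf v)) (by simp)
  unfold argView semView
  rw [View.mk.injEq]
  exact ⟨rfl, funext fun v => propext (h1 v), funext fun v => propext (h2 v),
    funext fun v => propext (h3 v), funext fun v => propext (h4 v),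
    funext fun r => funext fun v => propext (h5 r v)⟩

/-! ### The local and global conditions -/

/-- Some event of type `t` is in relation `ρ` to the event that is viewed. -/
def relRule (k : ℕ) (V : View) (ρ t : ℕ) : Prop :=
  SomeIn (List.range k) fun q =>
    (ρ = 0 ∧ V.own (vCell q t)) ∨ (ρ = 1 ∧ V.prev (vCell q t)) ∨ (ρ = 2 ∧ V.next (vCell q t)) ∨
    (ρ = 3 ∧ V.snd (vCell q t)) ∨ (ρ = 4 ∧ V.rcv (vCell q t)) ∨
    (ρ = 5 ∧ ((V.prev (vPast 1 q t) ∨ V.snd (vPast 1 q t)) ∨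
      ((V.prev (vPast 0 q t) ∨ V.snd (vPast 0 q t)) ∧
        ¬ V.prev (vCell q t) ∧ ¬ V.snd (vCell q t)))) ∨
    (ρ = 6 ∧ ((V.next (vFut 1 q t) ∨ V.rcv (vFut 1 q t)) ∨
      ((V.next (vFut 0 q t) ∨ V.rcv (vFut 0 q t)) ∧
        ¬ V.next (vCell q t) ∧ ¬ V.rcv (vCell q t)))) ∨
    (ρ = 7 ∧ V.own (vOther q t))

/-- The type `t` is correct, as far as process, label and related types tell. -/
def TypeOk (k : ℕ) (code : List (ℕ × ℕ)) (p a : ℕ) (V : View) (t : ℕ) : Prop :=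
  (AllIn (List.range code.length) fun i =>
    Imp ((code.getD i (0, 0)).1 = 0) (t.testBit i ↔ p = (code.getD i (0, 0)).2) ∧
    Imp ((code.getD i (0, 0)).1 = 1) (t.testBit i ↔ a = (code.getD i (0, 0)).2) ∧
    Imp (code.getD i (0, 0) = (4, 7) ∧ (code.getD (i + 1) (0, 0)).1 = 2)
      (t.testBit i ↔ SomeIn (List.range 8) fun ρ => SomeIn (List.range (2 ^ code.length)) fun t' =>
        relRule k V ρ t' ∧ quantTruth code i t.testBit t'.testBit ρ)) ∧
  (evalStack code t.testBit t.testBit 0 code).headI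

/-- The event has a unique type, which is correct. -/
def typeRule (k : ℕ) (code : List (ℕ × ℕ)) (p a : ℕ) (V : View) : Prop :=
  (AllIn (List.range k) fun q => (V.own (vProc q) ↔ p = q)) ∧
  SomeIn (List.range (2 ^ code.length)) fun t =>
    (AllIn (List.range k) fun q => AllIn (List.range (2 ^ code.length)) fun t' =>
      (V.own (vCell q t') ↔ p = q ∧ t' = t)) ∧ TypeOk k code p a V t

/-- The bits `vPast` and `vFut` satisfy the counting rules. -/
def countRule (k n : ℕ) (V : View) : Prop :=
  AllIn (List.range k) fun q => AllIn (List.range (2 ^ n)) fun t =>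
    ((V.own (vPast 0 q t) ↔ V.own (vCell q t) ∨ V.prev (vPast 0 q t) ∨ V.snd (vPast 0 q t)) ∧
    (V.own (vPast 1 q t) ↔ V.prev (vPast 1 q t) ∨ V.snd (vPast 1 q t) ∨
      (V.own (vCell q t) ∧ (V.prev (vPast 0 q t) ∨ V.snd (vPast 0 q t))))) ∧
    (V.own (vFut 0 q t) ↔ V.own (vCell q t) ∨ V.next (vFut 0 q t) ∨ V.rcv (vFut 0 q t)) ∧
    (V.own (vFut 1 q t) ↔ V.next (vFut 1 q t) ∨ V.rcv (vFut 1 q t) ∨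
      (V.own (vCell q t) ∧ (V.next (vFut 0 q t) ∨ V.rcv (vFut 0 q t))))

/-- The bits `vPath` satisfy the path rules, and all the events that have to be on the path are on
it. -/
def pathRule (k n p : ℕ) (V : View) : Prop :=
  AllIn (List.range k) fun p' => AllIn (List.range k) fun q => AllIn (List.range (2 ^ n)) fun t =>
    Imp (p' ≠ q) (
      (Imp (V.own (vPath 0 p' q t) ∧ V.own (vPath 1 p' q t))
        (V.prev (vPath 0 p' q t) ∧ ¬ V.prev (vPath 3 p' q t))) ∧
      (Imp (V.own (vPath 0 p' q t) ∧ V.own (vPath 2 p' q t))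
        (V.snd (vPath 0 p' q t) ∧ V.snd (vPath 3 p' q t))) ∧
      (V.own (vPath 4 p' q t) ↔ V.prev (vPath 4 p' q t) ∨
        (V.own (vPath 0 p' q t) ∧ ¬ V.own (vPath 1 p' q t) ∧ ¬ V.own (vPath 2 p' q t))) ∧
      (¬ (V.prev (vPath 4 p' q t) ∧
        (V.own (vPath 0 p' q t) ∧ ¬ V.own (vPath 1 p' q t) ∧ ¬ V.own (vPath 2 p' q t)))) ∧
      (Imp (p = p' ∧ ¬ V.own (vOther q t)) (V.own (vPath 0 p' q t))) ∧
      (Imp (V.own (vCell q t)) (V.own (vPath 0 p' q t))))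

/-- `W` leads from one process to another one, and `W'` leads back. -/
def RoundTrip (W W' : List ℕ) : Prop :=
  Leads W (wordAt W 0) (wordAt W' 0) ∧ Leads W' (wordAt W' 0) (wordAt W 0) ∧
    wordAt W 0 ≠ wordAt W' 0

/-- The bits of a half satisfy the signal rules. -/
def signalRule (p h t : ℕ) (W W' : List ℕ) (V : View) : Prop :=
  (Imp (p = wordAt W 0) (V.own (vHalf 3 h t W W' 0) ↔ V.own (vHalf 0 h t W W' 0))) ∧
  AllIn (List.range (W.length - 1)) fun i =>
    (Imp (p = wordAt W (i + 1))
      (V.own (vHalf 3 h t W W' (i + 1)) ↔ V.sndOn (wordAt W i) (vHalf 4 h t W W' i))) ∧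
    Imp (p = wordAt W i)
      (¬ (V.prev (vHalf 5 h t W W' i) ∧ V.own (vHalf 3 h t W W' i)) ∧
      (V.own (vHalf 4 h t W W' i) ↔ V.prev (vHalf 5 h t W W' i) ∨ V.own (vHalf 3 h t W W' i)) ∧
      (V.own (vHalf 5 h t W W' i) ↔
        V.own (vHalf 4 h t W W' i) ∧ ¬ V.rcv (vProc (wordAt W (i + 1)))))

/-- The bits of a half satisfy the station rules, where the signals of the other half arrive. -/
def stationRule (p h t : ℕ) (W W' : List ℕ) (V : View) : Prop :=
  Imp (p = wordAt W 0)
    ((V.own (vHalf 1 h t W W' 0) ∧ V.own (vHalf 3 (1 - h) t W' W (W'.length - 1)) ↔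
      V.prev (vHalf 1 h t W W' 0) ∧ V.own (vHalf 0 h t W W' 0)) ∧
    (V.own (vHalf 1 h t W W' 0) ∨ V.own (vHalf 3 (1 - h) t W' W (W'.length - 1)) ↔
      V.prev (vHalf 1 h t W W' 0) ∨ V.own (vHalf 0 h t W W' 0)) ∧
    (Imp (V.own (vHalf 0 h t W W' 0)) (V.own (vHalf 1 h t W W' 0))) ∧
    (V.own (vHalf 2 h t W W' 0) ↔ ¬ (V.prev (vHalf 2 h t W W' 0) ↔ V.own (vHalf 0 h t W W' 0))))

/-- The signal rules and the station rules hold for both halves, only events of type `t` are marked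
in the half `0`, and all the events with an incomparable event of type `t` differ in the half
`1`. -/
def halfRule (k n p : ℕ) (V : View) : Prop :=
  (AllIn (List.range k) fun q => AllIn (List.range (2 ^ n)) fun t =>
    Imp (V.own (vOther q t)) (p ≠ q)) ∧
  AllIn (words k) fun W => AllIn (words k) fun W' => Imp (RoundTrip W W')
    (AllIn (List.range (2 ^ n)) fun t =>
      (AllIn (List.range 2) fun h => signalRule p h t W W' V ∧ stationRule p h t W W' V ∧
        Imp (V.own (vHalf 0 h t W W' 0)) (p = wordAt W 0)) ∧
      Imp (V.own (vHalf 0 0 t W W' 0)) (V.own (vCell (wordAt W 0) t)) ∧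
      Imp (p = wordAt W 0 ∧ V.own (vOther (wordAt W' 0) t)) (V.own (vHalf 1 1 t W W' 0)))

/-- The local condition on an event on process `p` with label `a`. -/
def Local (k : ℕ) (code : List (ℕ × ℕ)) (p a : ℕ) (V : View) : Prop :=
  typeRule k code p a V ∧ countRule k code.length V ∧ pathRule k code.length p V ∧
    halfRule k code.length p V

/-- The bits of the last event of each process. -/
def semLast {k : ℕ} {Lab : Type} (M : MSC (Fin k) Lab) (B : M.E → Var → Prop) (u : ℕ) (v : Var) :
    Prop :=
  ∃ l : M.E, IsLastOn u l ∧ B l v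

/-- The bits in a list of annotations. -/
def argLast (vs : List Var) (g : List ℕ) (u : ℕ) (v : Var) : Prop :=
  (g.getD u 0).testBit (vs.idxOf v)

theorem argLast_ofFn {k s : ℕ} {M : MSC (Fin k) (Fin s)} (γ : M.E → ℕ) (vs : List Var) :
    argLast vs (List.ofFn fun p => valueAt γ (fun e : M.E => IsLast p e)) =
      semLast M fun e v => (γ e).testBit (vs.idxOf v) := by
  funext u v
  refine propext ?_
  unfold argLast semLast
  by_cases hu : u < k
  · have := valueAt_iff (γ := γ) (R := fun e : M.E => IsLast (⟨u, hu⟩ : Fin k) e)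
      (fun f g h h' => IsLast.unique h h') (C := fun x => x.testBit (vs.idxOf v)) (by simp)
    rw [List.getD_eq_getElem _ _ (by simpa using hu), List.getElem_ofFn, this]
    simp [IsLast, IsLastOn, Fin.ext_iff]
  · rw [List.getD_eq_default _ _ (by simpa using hu)]
    refine iff_of_false (by simp) ?_
    rintro ⟨l, hl, -⟩
    exact hu (hl.1 ▸ l.1.2)

/-- The global condition: paths have at most one start, and the parities of the two halves agree. -/
def Global (k n : ℕ) (G : ℕ → Var → Prop) : Prop :=
  (AllIn (List.range k) fun p => AllIn (List.range k) fun q => AllIn (List.range (2 ^ n)) fun t =>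
    AllIn (List.range k) fun u => AllIn (List.range k) fun v =>
      Imp (p ≠ q ∧ G u (vPath 4 p q t) ∧ G v (vPath 4 p q t)) (u = v)) ∧
  AllIn (words k) fun W => AllIn (words k) fun W' => Imp (RoundTrip W W')
    (AllIn (List.range (2 ^ n)) fun t =>
      (G (wordAt W 0) (vHalf 2 0 t W W' 0) ↔ G (wordAt W' 0) (vHalf 2 1 t W' W 0)))

section Primrec
variable {α : Type} [Primcodable α] {k n p a t h u : α → ℕ} {code : α → List (ℕ × ℕ)}
  {x : α → LocalArgs} {vs : α → List Var} {W W' : α → List ℕ}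

@[fun_prop] theorem primrec_words (hk : Primrec k) : Primrec fun a => words (k a) := by
  unfold words; fun_prop

@[fun_prop] theorem primrec_vars (hk : Primrec k) (hn : Primrec n) :
    Primrec fun a => vars (k a) (n a) := by
  unfold vars; fun_prop

@[fun_prop] theorem primrec_wordAt (hW : Primrec W) (hn : Primrec n) :
    Primrec fun a => wordAt (W a) (n a) := by
  unfold wordAt; fun_prop

@[fun_prop] theorem primrecPred_roundTrip (hW : Primrec W) (hW' : Primrec W') :
    PrimrecPred fun a => RoundTrip (W a) (W' a) := by
  unfold RoundTrip Leads; fun_prop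

@[fun_prop] theorem primrecPred_argView_own {v : α → Var} (hvs : Primrec vs) (hx : Primrec x)
    (hv : Primrec v) : PrimrecPred fun a => (argView (vs a) (x a)).own (v a) := by
  unfold argView; fun_prop

@[fun_prop] theorem primrecPred_relRule (hk : Primrec k) (hv : Primrec vs) (hx : Primrec x)
    (hu : Primrec u) (ht : Primrec t) :
    PrimrecPred fun a => relRule (k a) (argView (vs a) (x a)) (u a) (t a) := by
  unfold relRule argView; fun_prop

@[fun_prop] theorem primrecPred_typeOk (hk : Primrec k) (hc : Primrec code) (hp : Primrec p)
    (ha : Primrec a) (hv : Primrec vs) (hx : Primrec x) (ht : Primrec t) :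
    PrimrecPred fun y => TypeOk (k y) (code y) (p y) (a y) (argView (vs y) (x y)) (t y) := by
  unfold TypeOk; fun_prop

@[fun_prop] theorem primrecPred_typeRule (hk : Primrec k) (hc : Primrec code) (hp : Primrec p)
    (ha : Primrec a) (hv : Primrec vs) (hx : Primrec x) :
    PrimrecPred fun y => typeRule (k y) (code y) (p y) (a y) (argView (vs y) (x y)) := by
  unfold typeRule; fun_prop

@[fun_prop] theorem primrecPred_countRule (hk : Primrec k) (hn : Primrec n) (hv : Primrec vs)
    (hx : Primrec x) : PrimrecPred fun y => countRule (k y) (n y) (argView (vs y) (x y)) := by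
  unfold countRule argView; fun_prop

@[fun_prop] theorem primrecPred_pathRule (hk : Primrec k) (hn : Primrec n) (hp : Primrec p)
    (hv : Primrec vs) (hx : Primrec x) :
    PrimrecPred fun y => pathRule (k y) (n y) (p y) (argView (vs y) (x y)) := by
  unfold pathRule argView; fun_prop

@[fun_prop] theorem primrecPred_signalRule (hp : Primrec p) (hh : Primrec h) (ht : Primrec t)
    (hW : Primrec W) (hW' : Primrec W') (hv : Primrec vs) (hx : Primrec x) :
    PrimrecPred fun y => signalRule (p y) (h y) (t y) (W y) (W' y) (argView (vs y) (x y)) := by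
  unfold signalRule argView; fun_prop

@[fun_prop] theorem primrecPred_stationRule (hp : Primrec p) (hh : Primrec h) (ht : Primrec t)
    (hW : Primrec W) (hW' : Primrec W') (hv : Primrec vs) (hx : Primrec x) :
    PrimrecPred fun y => stationRule (p y) (h y) (t y) (W y) (W' y) (argView (vs y) (x y)) := by
  unfold stationRule argView; fun_prop

@[fun_prop] theorem primrecPred_halfRule (hk : Primrec k) (hn : Primrec n) (hp : Primrec p)
    (hv : Primrec vs) (hx : Primrec x) :
    PrimrecPred fun y => halfRule (k y) (n y) (p y) (argView (vs y) (x y)) := by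
  unfold halfRule; fun_prop

theorem primrecPred_local (hk : Primrec k) (hc : Primrec code) (hp : Primrec p)
    (ha : Primrec a) (hv : Primrec vs) (hx : Primrec x) :
    PrimrecPred fun y => Local (k y) (code y) (p y) (a y) (argView (vs y) (x y)) := by
  unfold Local; fun_prop

theorem primrecPred_global {g : α → List ℕ} (hk : Primrec k) (hn : Primrec n) (hv : Primrec vs)
    (hg : Primrec g) :
    PrimrecPred fun y => Global (k y) (n y) (argLast (vs y) (g y)) := by
  unfold Global argLast; fun_prop

end Primrec

/-! ### Annotations that satisfy the conditions are correct types -/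

section Annotation
variable {k s : ℕ} {M : MSC (Fin k) (Fin s)} {B : M.E → Var → Prop} {n : ℕ} {T : M.E → ℕ}

theorem wordAt_lt {W : List ℕ} (hk : 0 < k) (hW : W ∈ words k) (i : ℕ) : wordAt W i < k := by
  unfold wordAt
  by_cases hi : i < W.length
  · rw [List.getD_eq_getElem _ _ hi]
    exact (mem_words.1 hW).2 _ (List.getElem_mem hi)
  · rw [List.getD_eq_default _ _ (by omega)]
    exact hk

theorem MSC.E.pos (e : M.E) : 0 < k := Nat.zero_lt_of_lt e.1.2

theorem RoundTrip.symm {W W' : List ℕ} (h : RoundTrip W W') : RoundTrip W' W :=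
  ⟨h.2.1, h.1, h.2.2.symm⟩

theorem signalRules_iff (hproc : ∀ e, ∀ q < k, (B e (vProc q) ↔ e.1.val = q)) {W W' : List ℕ}
    (hW : W ∈ words k) (h t : ℕ) :
    (∀ e : M.E, signalRule e.1.val h t W W' (semView M B e)) ↔
      SignalRules M (wordAt W) (W.length - 1) (fun e => B e (vHalf 0 h t W W' 0))
        (fun i e => B e (vHalf 3 h t W W' i)) (fun i e => B e (vHalf 4 h t W W' i))
        (fun i e => B e (vHalf 5 h t W W' i)) := by
  have hs : ∀ (e : M.E) r, (B e (vProc (wordAt W r)) ↔ e.1.val = wordAt W r) := fun e r =>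
    hproc e _ (wordAt_lt e.pos hW r)
  constructor
  · intro H
    refine ⟨fun e he => (H e).1 he, fun i hi e he => ?_, fun i hi e he => ?_, fun i hi e he => ?_,
      fun i hi e he => ?_⟩
    · have := ((H e).2 i (List.mem_range.2 hi)).1 he
      simpa only [semView, hs] using this
    · exact (((H e).2 i (List.mem_range.2 hi)).2 he).1
    · exact (((H e).2 i (List.mem_range.2 hi)).2 he).2.1
    · have := (((H e).2 i (List.mem_range.2 hi)).2 he).2.2
      simpa only [semView, hs] using this
  · intro H e
    refine ⟨fun he => H.inc_zero e he, fun i hi => ⟨fun he => ?_, fun he => ⟨?_, ?_, ?_⟩⟩⟩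
    · simpa only [semView, hs] using H.inc_succ i (List.mem_range.1 hi) e he
    · exact H.disj i (List.mem_range.1 hi) e he
    · exact H.tot_iff i (List.mem_range.1 hi) e he
    · simpa only [semView, hs] using H.pend_iff i (List.mem_range.1 hi) e he

theorem stationRules_iff (W W' : List ℕ) (h t : ℕ) :
    (∀ e : M.E, stationRule e.1.val h t W W' (semView M B e)) ↔
      StationRules M (wordAt W 0) (fun e => B e (vHalf 0 h t W W' 0))
        (fun e => B e (vHalf 3 (1 - h) t W' W (W'.length - 1)))
        (fun e => B e (vHalf 1 h t W W' 0)) (fun e => B e (vHalf 2 h t W W' 0)) :=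
  ⟨fun H => ⟨fun e he => (H e he).1, fun e he => (H e he).2.1, fun e he => (H e he).2.2.1,
    fun e he => (H e he).2.2.2⟩,
  fun H e he => ⟨H.both e he, H.any e he, H.mark e he, H.parity e he⟩⟩

/-- The bits other than those that only serve to check them are correct for the types `T`. -/
structure BitsCorrect (M : MSC (Fin k) (Fin s)) (n : ℕ) (T : M.E → ℕ) (B : M.E → Var → Prop) :
    Prop where
  cell : ∀ e, ∀ q < k, ∀ t < 2 ^ n, (B e (vCell q t) ↔ e.1.val = q ∧ t = T e)
  past : ∀ q < k, ∀ t < 2 ^ n, CountRules (fun g e : M.E => ProcEdge g e) (fun g e => M.msg g e)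
    (fun e => B e (vCell q t)) (fun e => B e (vPast 0 q t)) (fun e => B e (vPast 1 q t))
  fut : ∀ q < k, ∀ t < 2 ^ n, CountRules (fun g e : M.E => ProcEdge e g) (fun g e => M.msg e g)
    (fun e => B e (vCell q t)) (fun e => B e (vFut 0 q t)) (fun e => B e (vFut 1 q t))
  other : ∀ e, ∀ q < k, ∀ t < 2 ^ n, (B e (vOther q t) ↔
    ∃ f : M.E, (f.1.val = q ∧ t = T f) ∧ ¬ M.le f e ∧ ¬ M.le e f)

/-- The related types are recognized correctly. -/
theorem BitsCorrect.relRule_iff (H : BitsCorrect M n T B) (e : M.E) {ρ t : ℕ} (ht : t < 2 ^ n) :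
    relRule k (semView M B e) ρ t ↔ ∃ f, T f = t ∧ M.Rel ρ e f := by
  have hc : ∀ q < k, ∀ f g : M.E, B f (vCell q t) → B g (vCell q t) → f.1 = g.1 :=
    fun q hq f g hf hg => Fin.ext (((H.cell f q hq t ht).1 hf).1.trans
      ((H.cell g q hq t ht).1 hg).1.symm)
  have h5 := fun q (hq : q < k) => (H.past q hq t ht).other_iff generated_past
    (fun f g hf hg => le_total_of_proc (hc q hq f g hf hg)) e fun g g' hg hg' hQ =>
      M.msg_ne _ _ hg' ((hc q hq g' g hQ.2 hQ.1).trans hg.1)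
  have h6 := fun q (hq : q < k) => (H.fut q hq t ht).other_iff generated_future
    (fun f g hf hg => le_total_of_proc (hc q hq g f hg hf)) e fun g g' hg hg' hQ =>
      M.msg_ne _ _ hg' (hg.1.trans (hc q hq g g' hQ.1 hQ.2))
  constructor
  · rintro ⟨q, hq, h⟩
    have hq := List.mem_range.1 hq
    rcases h with ⟨rfl, h⟩ | ⟨rfl, h⟩ | ⟨rfl, h⟩ | ⟨rfl, h⟩ | ⟨rfl, h⟩ | ⟨rfl, h⟩ | ⟨rfl, h⟩ | ⟨rfl, h⟩
    · exact ⟨e, ((H.cell e q hq t ht).1 h).2.symm, rfl⟩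
    · obtain ⟨g, hg, h⟩ := h
      exact ⟨g, ((H.cell g q hq t ht).1 h).2.symm, hg⟩
    · obtain ⟨g, hg, h⟩ := h
      exact ⟨g, ((H.cell g q hq t ht).1 h).2.symm, hg⟩
    · obtain ⟨g, hg, h⟩ := h
      exact ⟨g, ((H.cell g q hq t ht).1 h).2.symm, hg⟩
    · obtain ⟨g, hg, h⟩ := h
      exact ⟨g, ((H.cell g q hq t ht).1 h).2.symm, hg⟩
    · obtain ⟨g, h, hg⟩ := (h5 q hq).1 h
      exact ⟨g, ((H.cell g q hq t ht).1 h).2.symm, hg⟩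
    · obtain ⟨g, h, hg⟩ := (h6 q hq).1 h
      exact ⟨g, ((H.cell g q hq t ht).1 h).2.symm, hg⟩
    · obtain ⟨g, h, hg⟩ := (H.other e q hq t ht).1 h
      exact ⟨g, h.2.symm, hg⟩
  · rintro ⟨f, hf, h⟩
    have hcell : B f (vCell f.1.val t) := (H.cell f _ f.1.2 t ht).2 ⟨rfl, hf.symm⟩
    refine ⟨f.1.val, List.mem_range.2 f.1.2, ?_⟩
    have hρ := h.lt
    interval_cases ρ
    · obtain rfl : f = e := h
      exact Or.inl ⟨rfl, hcell⟩
    · exact Or.inr (Or.inl ⟨rfl, f, h, hcell⟩)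
    · exact Or.inr (Or.inr (Or.inl ⟨rfl, f, h, hcell⟩))
    · exact Or.inr (Or.inr (Or.inr (Or.inl ⟨rfl, f, h, hcell⟩)))
    · exact Or.inr (Or.inr (Or.inr (Or.inr (Or.inl ⟨rfl, f, h, hcell⟩))))
    · exact Or.inr (Or.inr (Or.inr (Or.inr (Or.inr (Or.inl ⟨rfl, (h5 _ f.1.2).2 ⟨f, hcell, h⟩⟩)))))
    · exact Or.inr (Or.inr (Or.inr (Or.inr (Or.inr (Or.inr (Or.inl
        ⟨rfl, (h6 _ f.1.2).2 ⟨f, hcell, h⟩⟩))))))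
    · exact Or.inr (Or.inr (Or.inr (Or.inr (Or.inr (Or.inr (Or.inr
        ⟨rfl, (H.other e _ f.1.2 t ht).2 ⟨f, ⟨rfl, hf.symm⟩, h⟩⟩))))))

/-- Given that related types are recognized, the local check of types is correct. -/
theorem BitsCorrect.typing_iff {code : List (ℕ × ℕ)} (H : BitsCorrect M code.length T B)
    (hT : ∀ e, T e < 2 ^ code.length) :
    (∀ e, TypeOk k code e.1.val (M.label e).val (semView M B e) (T e)) ↔ Typing M code T := by
  have hq : ∀ e i, ((SomeIn (List.range 8) fun ρ => SomeIn (List.range (2 ^ code.length)) fun t' =>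
      relRule k (semView M B e) ρ t' ∧ quantTruth code i (T e).testBit t'.testBit ρ) ↔
      ∃ ρ f, M.Rel ρ e f ∧ quantTruth code i (T e).testBit (T f).testBit ρ) := by
    intro e i
    constructor
    · rintro ⟨ρ, -, t', ht', h1, h2⟩
      obtain ⟨f, rfl, hf⟩ := (H.relRule_iff e (List.mem_range.1 ht')).1 h1
      exact ⟨ρ, f, hf, h2⟩
    · rintro ⟨ρ, f, h1, h2⟩
      exact ⟨ρ, List.mem_range.2 h1.lt, T f, List.mem_range.2 (hT f),
        (H.relRule_iff e (hT f)).2 ⟨f, rfl, h1⟩, h2⟩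
  have hlt : ∀ i, (code.getD i (0, 0)).1 ≠ 0 → i ∈ List.range code.length := by
    intro i hi
    rw [List.mem_range]
    by_contra hc
    rw [List.getD_eq_default _ _ (by omega)] at hi
    exact hi rfl
  constructor
  · intro h
    refine ⟨hT, fun e i => ⟨fun h0 hi => ?_, fun h1 => ?_⟩, fun i hi e => ?_, fun e => (h e).2⟩
    · exact ((h e).1 i (List.mem_range.2 hi)).1 h0
    · exact ((h e).1 i (hlt i (by rw [h1]; simp))).2.1 h1
    · rw [← hq]
      exact ((h e).1 i (hlt i (by rw [hi.1]; simp))).2.2 hi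
  · intro h e
    refine ⟨fun i hi => ⟨fun h0 => ?_, fun h1 => ?_, fun hi => ?_⟩, h.top e⟩
    · exact (h.monadic e i).1 h0 (List.mem_range.1 hi)
    · exact (h.monadic e i).2 h1
    · rw [hq]
      exact h.quant i hi e

theorem countRules_iff : (∀ e : M.E, countRule k n (semView M B e)) ↔
    ∀ q < k, ∀ t < 2 ^ n, CountRules (fun g e : M.E => ProcEdge g e) (fun g e => M.msg g e)
      (fun e => B e (vCell q t)) (fun e => B e (vPast 0 q t)) (fun e => B e (vPast 1 q t)) ∧
    CountRules (fun g e : M.E => ProcEdge e g) (fun g e => M.msg e g)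
      (fun e => B e (vCell q t)) (fun e => B e (vFut 0 q t)) (fun e => B e (vFut 1 q t)) := by
  constructor
  · intro h q hq t ht
    have := fun e => h e q (List.mem_range.2 hq) t (List.mem_range.2 ht)
    exact ⟨⟨fun e => (this e).1.1, fun e => (this e).1.2⟩,
      ⟨fun e => (this e).2.1, fun e => (this e).2.2⟩⟩
  · intro h e q hq t ht
    have := h q (List.mem_range.1 hq) t (List.mem_range.1 ht)
    exact ⟨⟨this.1.one e, this.1.two e⟩, ⟨this.2.one e, this.2.two e⟩⟩

/-- The guessed types are correct: the path rules refute wrong negative answers about incomparable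
events, and the rules of the halves refute wrong positive ones. -/
theorem exists_typing_of_annotation {code : List (ℕ × ℕ)}
    (hL : ∀ e, Local k code e.1.val (M.label e).val (semView M B e))
    (hG : Global k code.length (semLast M B)) : ∃ T, Typing M code T := by
  have hproc : ∀ e, ∀ q < k, (B e (vProc q) ↔ e.1.val = q) := fun e q hq =>
    (hL e).1.1 q (List.mem_range.2 hq)
  choose T hT hcell hok using fun e => (hL e).1.2
  replace hT : ∀ e, T e < 2 ^ code.length := fun e => List.mem_range.1 (hT e)
  replace hcell : ∀ e, ∀ q < k, ∀ t < 2 ^ code.length,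
      (B e (vCell q t) ↔ e.1.val = q ∧ t = T e) := fun e q hq t ht =>
    hcell e q (List.mem_range.2 hq) t (List.mem_range.2 ht)
  have hcount := countRules_iff.1 fun e => (hL e).2.1
  refine ⟨T, (BitsCorrect.typing_iff (B := B) ⟨hcell, fun q hq t ht => (hcount q hq t ht).1,
    fun q hq t ht => (hcount q hq t ht).2, fun e q hq t ht => ⟨fun h => ?_, ?_⟩⟩ hT).1 hok⟩
  · have hne : e.1.val ≠ q := (hL e).2.2.2.1 q (List.mem_range.2 hq) t (List.mem_range.2 ht) h
    refine exists_incomparable (T := fun f => f.1.val = q ∧ t = T f) e.1.2 hq hne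
      (fun f hf => hf.1) rfl fun w hw w' hw' hl hl' => ?_
    obtain ⟨hl0, rfl, hl1⟩ := hl
    obtain ⟨hl0', hl1', hl2'⟩ := hl'
    have hr : RoundTrip w w' := ⟨⟨hl0, rfl, hl1.trans hl1'.symm⟩, ⟨hl0', rfl, hl2'⟩,
      fun h => hne (hl1'.symm.trans h.symm)⟩
    have h0 := fun e => ((hL e).2.2.2.2 w hw w' hw' hr t (List.mem_range.2 ht))
    have h1 := fun e => ((hL e).2.2.2.2 w' hw' w hw hr.symm t (List.mem_range.2 ht))
    obtain ⟨f, hf, hf'⟩ := exists_unreachable_of_rules hr.1.2.2 hr.2.1.2.2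
      (fun x hx => ((h0 x).1 0 (by simp)).2.2 hx) (fun x hx => ((h1 x).1 1 (by simp)).2.2 hx)
      ((signalRules_iff hproc hw 0 t).1 fun e => ((h0 e).1 0 (by simp)).1)
      ((signalRules_iff hproc hw' 1 t).1 fun e => ((h1 e).1 1 (by simp)).1)
      ((stationRules_iff w w' 0 t).1 fun e => ((h0 e).1 0 (by simp)).2.1)
      ((stationRules_iff w' w 1 t).1 fun e => ((h1 e).1 1 (by simp)).2.1)
      (hG.2 w hw w' hw' hr t (List.mem_range.2 ht)) e hl1'.symm
      ((h1 e).2.2 ⟨hl1'.symm, h⟩)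
    exact ⟨f, (hcell f _ hq t ht).1 ((h0 f).2.1 hf), hf'⟩
  · rintro ⟨f, hf, h1, h2⟩
    by_contra hc
    have hne : e.1.val ≠ q := fun h => by
      rcases le_total_of_proc (M := M) (e := e) (f := f) (Fin.ext (h.trans hf.1.symm)) with h | h
      · exact h2 h
      · exact h1 h
    have hp := fun e' => (hL e').2.2.1 e.1.val (List.mem_range.2 e.1.2) q (List.mem_range.2 hq) t
      (List.mem_range.2 ht) hne
    have R : PathRules M (fun x => B x (vPath 0 e.1.val q t)) (fun x => B x (vPath 1 e.1.val q t))
        (fun x => B x (vPath 2 e.1.val q t)) (fun x => B x (vPath 3 e.1.val q t))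
        (fun x => B x (vPath 4 e.1.val q t)) :=
      ⟨fun x => (hp x).1, fun x => (hp x).2.1, fun x => (hp x).2.2.1, fun x => (hp x).2.2.2.1,
        fun u v hu hv => hG.1 e.1.val (List.mem_range.2 e.1.2) q (List.mem_range.2 hq) t
          (List.mem_range.2 ht) u (List.mem_range.2 (by
            obtain ⟨l, hl, -⟩ := hu; exact hl.1 ▸ l.1.2)) v (List.mem_range.2 (by
            obtain ⟨l, hl, -⟩ := hv; exact hl.1 ▸ l.1.2)) ⟨hne, hu, hv⟩⟩
    rcases R.comparable ((hp e).2.2.2.2.1 ⟨rfl, hc⟩)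
      ((hp f).2.2.2.2.2 ((hcell f q hq t ht).2 hf)) with h | h
    · exact h2 h
    · exact h1 h

end Annotation

/-! ### Correct types extend to annotations that satisfy the conditions -/

section Congr
variable {k : ℕ} {Lab : Type} {M : MSC (Fin k) Lab}

theorem SignalRules.congr {w : ℕ → ℕ} {m : ℕ} {X X' : M.E → Prop}
    {inc inc' tot tot' pend pend' : ℕ → M.E → Prop} (S : SignalRules M w m X inc tot pend)
    (hX : ∀ e, X' e ↔ X e) (hi : ∀ i ≤ m, ∀ e, inc' i e ↔ inc i e)
    (ht : ∀ i ≤ m, ∀ e, tot' i e ↔ tot i e) (hp : ∀ i ≤ m, ∀ e, pend' i e ↔ pend i e) :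
    SignalRules M w m X' inc' tot' pend' := by
  refine ⟨fun e he => ?_, fun i him e he => ?_, fun i him e he => ?_, fun i him e he => ?_,
    fun i him e he => ?_⟩
  · rw [hi 0 (Nat.zero_le _), hX]; exact S.inc_zero e he
  · simp only [hi (i + 1) him, ht i him.le]; exact S.inc_succ i him e he
  · simp only [hi i him.le, hp i him.le]; exact S.disj i him e he
  · simp only [hi i him.le, ht i him.le, hp i him.le]; exact S.tot_iff i him e he
  · simp only [ht i him.le, hp i him.le]; exact S.pend_iff i him e he

theorem StationRules.congr {u : ℕ} {X X' J J' off off' par par' : M.E → Prop}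
    (S : StationRules M u X J off par) (hX : ∀ e, X' e ↔ X e) (hJ : ∀ e, J' e ↔ J e)
    (ho : ∀ e, off' e ↔ off e) (hp : ∀ e, par' e ↔ par e) : StationRules M u X' J' off' par' := by
  obtain rfl : X' = X := funext fun e => propext (hX e)
  obtain rfl : J' = J := funext fun e => propext (hJ e)
  obtain rfl : off' = off := funext fun e => propext (ho e)
  obtain rfl : par' = par := funext fun e => propext (hp e)
  exact S

end Congr

section Completeness
variable {k s : ℕ} {M : MSC (Fin k) (Fin s)} {n : ℕ} {T : M.E → ℕ}

/-- The event `e` is incomparable to some event on process `q` of type `t`. -/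
def HasOther (M : MSC (Fin k) (Fin s)) (T : M.E → ℕ) (q t : ℕ) (e : M.E) : Prop :=
  ∃ f : M.E, (f.1.val = q ∧ t = T f) ∧ ¬ M.le f e ∧ ¬ M.le e f

/-- The families `F` describe paths through the events that have to be on a path. -/
def PathData (M : MSC (Fin k) (Fin s)) (T : M.E → ℕ) (p q t : ℕ) (F : ℕ → M.E → Prop) : Prop :=
  PathRules M (F 0) (F 1) (F 2) (F 3) (F 4) ∧
    (∀ e, e.1.val = p → ¬ HasOther M T q t e → F 0 e) ∧
    ∀ e, e.1.val = q → t = T e → F 0 e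

theorem exists_pathData (T : M.E → ℕ) (p q t : ℕ) : ∃ F, PathData M T p q t F := by
  have hcross : ∀ e f : M.E, ¬ HasOther M T q t e → f.1.val = q → t = T f →
      M.le e f ∨ M.le f e := by
    intro e f he hf ht
    by_contra hc
    exact he ⟨f, ⟨hf, ht⟩, fun h => hc (Or.inr h), fun h => hc (Or.inl h)⟩
  obtain ⟨on, inP, inM, outM, st, h, hon⟩ := exists_pathRules_of_chain (M := M)
    (C := fun e => (e.1.val = p ∧ ¬ HasOther M T q t e) ∨ (e.1.val = q ∧ t = T e)) (by
      rintro e f (he | he) (hf | hf)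
      · exact le_total_of_proc (Fin.ext (he.1.trans hf.1.symm))
      · exact hcross e f he.2 hf.1 hf.2
      · exact (hcross f e hf.2 he.1 he.2).symm
      · exact le_total_of_proc (Fin.ext (he.1.trans hf.1.symm)))
  exact ⟨fun c => [on, inP, inM, outM, st].getD c fun _ => False, h,
    fun e h1 h2 => hon e (Or.inl ⟨h1, h2⟩), fun e h1 h2 => hon e (Or.inr ⟨h1, h2⟩)⟩

/-- The families `F h` describe the two halves for the process sequences `W` and `W'`. -/
structure HalfData (M : MSC (Fin k) (Fin s)) (T : M.E → ℕ) (t : ℕ) (W W' : List ℕ)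
    (F : ℕ → ℕ → ℕ → M.E → Prop) : Prop where
  signal : SignalRules M (wordAt W) (W.length - 1) (F 0 0 0) (F 0 3) (F 0 4) (F 0 5)
  signal' : SignalRules M (wordAt W') (W'.length - 1) (F 1 0 0) (F 1 3) (F 1 4) (F 1 5)
  station : StationRules M (wordAt W 0) (F 0 0 0) (F 1 3 (W'.length - 1)) (F 0 1 0) (F 0 2 0)
  station' : StationRules M (wordAt W' 0) (F 1 0 0) (F 0 3 (W.length - 1)) (F 1 1 0) (F 1 2 0)
  parity : (∃ l, IsLastOn (wordAt W 0) l ∧ F 0 2 0 l) ↔ ∃ l, IsLastOn (wordAt W' 0) l ∧ F 1 2 0 l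
  mark : ∀ x, F 0 0 0 x → x.1.val = wordAt W 0 ∧ t = T x
  mark' : ∀ x, F 1 0 0 x → x.1.val = wordAt W' 0
  off : ∀ e : M.E, e.1.val = wordAt W' 0 → HasOther M T (wordAt W 0) t e → F 1 1 0 e

theorem exists_halfData (T : M.E → ℕ) (t : ℕ) (W W' : List ℕ) :
    ∃ F, RoundTrip W W' → HalfData M T t W W' F := by
  by_cases hr : RoundTrip W W'
  swap
  · exact ⟨fun _ _ _ _ => False, fun h => absurd h hr⟩
  obtain ⟨X, Y, off, par, off', par', inc, tot, pend, inc', tot', pend', hX, hY, S, S', H, H', hp,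
    ho⟩ := exists_rules_of_unreachable (M := M)
    (A := fun a => a.1.val = wordAt W' 0 ∧ HasOther M T (wordAt W 0) t a)
    (T := fun f => f.1.val = wordAt W 0 ∧ t = T f) hr.1.2.2 hr.2.1.2.2 (fun a h => h.1)
    (fun a h => h.1) (by
      rintro a ⟨-, f, hf, h1, h2⟩
      exact ⟨f, hf, fun h => h1 h.le, fun h => h2 h.le⟩)
  refine ⟨fun h c i => (([[fun _ => X, fun _ => off, fun _ => par, inc, tot, pend],
    [fun _ => Y, fun _ => off', fun _ => par', inc', tot', pend']].getD h []).getD c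
      fun _ _ => False) i, fun _ => ⟨S, S', H, H', hp, hX, fun x hx => (hY x hx).1,
    fun e h1 h2 => ho e ⟨h1, h2⟩⟩⟩

/-- The meaning of the bits, where `Q` and `F` provide the data of paths and halves. -/
def bitMeaning (M : MSC (Fin k) (Fin s)) (T : M.E → ℕ) (Q : ℕ → ℕ → ℕ → ℕ → M.E → Prop)
    (F : ℕ → List ℕ → List ℕ → ℕ → ℕ → ℕ → M.E → Prop) (e : M.E) : Var → Prop
  | (c, h, t, (W, W'), i) =>
    if c = 0 then e.1.val = i
    else if c = 1 then e.1.val = i ∧ t = T e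
    else if c = 2 then
      if h = 0 then ∃ f : M.E, (f.1.val = i ∧ t = T f) ∧ M.le f e
      else ∃ f g : M.E, f ≠ g ∧ (f.1.val = i ∧ t = T f) ∧ (g.1.val = i ∧ t = T g) ∧
        M.le f e ∧ M.le g e
    else if c = 3 then
      if h = 0 then ∃ f : M.E, (f.1.val = i ∧ t = T f) ∧ M.le e f
      else ∃ f g : M.E, f ≠ g ∧ (f.1.val = i ∧ t = T f) ∧ (g.1.val = i ∧ t = T g) ∧
        M.le e f ∧ M.le e g
    else if c = 4 then HasOther M T i t e
    else if c < 10 then Q W.headI i t (c - 5) e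
    else if h = 0 then F t W W' h (c - 10) i e
    else F t W' W h (c - 10) i e

section Bits
variable {Q : ℕ → ℕ → ℕ → ℕ → M.E → Prop} {F : ℕ → List ℕ → List ℕ → ℕ → ℕ → ℕ → M.E → Prop}
  {e : M.E} {q t : ℕ}

/-- The bits in `vars k n` that hold at an event. -/
def annotBits (M : MSC (Fin k) (Fin s)) (n : ℕ) (T : M.E → ℕ) (Q : ℕ → ℕ → ℕ → ℕ → M.E → Prop)
    (F : ℕ → List ℕ → List ℕ → ℕ → ℕ → ℕ → M.E → Prop) (e : M.E) (v : Var) : Prop :=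
  v ∈ vars k n ∧ bitMeaning M T Q F e v

theorem nil_mem_words (k : ℕ) : [] ∈ words k := mem_words.2 (by simp)

theorem annotBits_proc (hq : q < k) : annotBits M n T Q F e (vProc q) ↔ e.1.val = q :=
  and_iff_right (mem_vars.2 ⟨by simp, by simp, by positivity, nil_mem_words k, nil_mem_words k, hq⟩)

theorem annotBits_cell (hq : q < k) (ht : t < 2 ^ n) :
    annotBits M n T Q F e (vCell q t) ↔ e.1.val = q ∧ t = T e :=
  and_iff_right (mem_vars.2 ⟨by simp, by simp, ht, nil_mem_words k, nil_mem_words k, hq⟩)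

theorem annotBits_other (hq : q < k) (ht : t < 2 ^ n) :
    annotBits M n T Q F e (vOther q t) ↔ HasOther M T q t e :=
  and_iff_right (mem_vars.2 ⟨by simp, by simp, ht, nil_mem_words k, nil_mem_words k, hq⟩)

theorem annotBits_path {c p : ℕ} (hc : c < 5) (hp : p < k) (hq : q < k) (ht : t < 2 ^ n) :
    annotBits M n T Q F e (vPath c p q t) ↔ Q p q t c e := by
  have h1 : [p] ∈ words k := mem_words.2 (by simp; omega)
  refine (and_iff_right (mem_vars.2 ⟨by omega, by simp, ht, h1, nil_mem_words k, hq⟩)).trans ?_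
  interval_cases c <;> exact Iff.rfl

theorem annotBits_half {h c i : ℕ} (hh : h < 2) (hc : c < 6) (ht : t < 2 ^ n) {W W' : List ℕ}
    (hW : W ∈ words k) (hW' : W' ∈ words k) (hi : i < k) :
    annotBits M n T Q F e (vHalf c h t W W' i) ↔
      if h = 0 then F t W W' h c i e else F t W' W h c i e := by
  refine (and_iff_right (mem_vars.2 ⟨by omega, hh, ht, hW, hW', hi⟩)).trans ?_
  interval_cases c <;> exact Iff.rfl

theorem bitsCorrect_annotBits : BitsCorrect M n T (annotBits M n T Q F) := by
  have hm : ∀ q < k, ∀ t < 2 ^ n, ∀ c < 16, ∀ h < 2, (c, h, t, ([], []), q) ∈ vars k n :=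
    fun q hq t ht c hc h hh => mem_vars.2 ⟨hc, hh, ht, nil_mem_words k, nil_mem_words k, hq⟩
  refine ⟨fun e q hq t ht => annotBits_cell hq ht, fun q hq t ht => ?_, fun q hq t ht => ?_,
    fun e q hq t ht => annotBits_other hq ht⟩
  · have H := countRules_sem (generated_past (M := M)) (Q := fun f => f.1.val = q ∧ t = T f)
      fun f g hf hg => le_total_of_proc (Fin.ext (hf.1.trans hg.1.symm))
    have e0 : (fun e => annotBits M n T Q F e (vCell q t)) = fun e => e.1.val = q ∧ t = T e :=
      funext fun e => propext (annotBits_cell hq ht)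
    have e1 : (fun e => annotBits M n T Q F e (vPast 0 q t)) =
        fun e => ∃ f : M.E, (f.1.val = q ∧ t = T f) ∧ M.le f e :=
      funext fun e => propext (and_iff_right (hm q hq t ht 2 (by simp) 0 (by simp)))
    have e2 : (fun e => annotBits M n T Q F e (vPast 1 q t)) = fun e => ∃ f g : M.E, f ≠ g ∧
        (f.1.val = q ∧ t = T f) ∧ (g.1.val = q ∧ t = T g) ∧ M.le f e ∧ M.le g e :=
      funext fun e => propext (and_iff_right (hm q hq t ht 2 (by simp) 1 (by simp)))
    rw [e0, e1, e2]
    exact H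
  · have H := countRules_sem (generated_future (M := M)) (Q := fun f => f.1.val = q ∧ t = T f)
      fun f g hf hg => le_total_of_proc (Fin.ext (hg.1.trans hf.1.symm))
    have e0 : (fun e => annotBits M n T Q F e (vCell q t)) = fun e => e.1.val = q ∧ t = T e :=
      funext fun e => propext (annotBits_cell hq ht)
    have e1 : (fun e => annotBits M n T Q F e (vFut 0 q t)) =
        fun e => ∃ f : M.E, (f.1.val = q ∧ t = T f) ∧ M.le e f :=
      funext fun e => propext (and_iff_right (hm q hq t ht 3 (by simp) 0 (by simp)))
    have e2 : (fun e => annotBits M n T Q F e (vFut 1 q t)) = fun e => ∃ f g : M.E, f ≠ g ∧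
        (f.1.val = q ∧ t = T f) ∧ (g.1.val = q ∧ t = T g) ∧ M.le e f ∧ M.le e g :=
      funext fun e => propext (and_iff_right (hm q hq t ht 3 (by simp) 1 (by simp)))
    rw [e0, e1, e2]
    exact H

theorem pathRule_annotBits (hQ : ∀ p q t, PathData M T p q t (Q p q t)) (e : M.E) :
    pathRule k n e.1.val (semView M (annotBits M n T Q F) e) := by
  intro p hp q hq t ht hpq
  have hp := List.mem_range.1 hp
  have hq := List.mem_range.1 hq
  have ht := List.mem_range.1 ht
  obtain ⟨R, h1, h2⟩ := hQ p q t
  have b : ∀ c < 5, ∀ e, (annotBits M n T Q F e (vPath c p q t) ↔ Q p q t c e) :=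
    fun c hc e => annotBits_path hc hp hq ht
  have b0 := b 0 (by simp)
  have b1 := b 1 (by simp)
  have b2 := b 2 (by simp)
  have b3 := b 3 (by simp)
  have b4 := b 4 (by simp)
  refine ⟨?_, ?_, ?_, ?_, ?_, ?_⟩
  · simpa only [semView, Imp, b0, b1, b3] using R.enterP e
  · simpa only [semView, Imp, b0, b2, b3] using R.enterM e
  · simpa only [semView, b0, b1, b2, b4] using R.st_iff e
  · simpa only [semView, b0, b1, b2, b4] using R.start e
  · rintro ⟨h, ho⟩
    exact (b0 e).2 (h1 e h fun h => ho ((annotBits_other hq ht).2 h))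
  · intro h
    have := (annotBits_cell hq ht).1 h
    exact (b0 e).2 (h2 e this.1 this.2)

end Bits

/-- Correct types extend to bits that satisfy the local and the global condition. -/
theorem exists_annotation {code : List (ℕ × ℕ)} (hT : Typing M code T) :
    ∃ B : M.E → Var → Prop, (∀ e v, B e v → v ∈ vars k code.length) ∧
      (∀ e, B e (vProc e.1.val)) ∧
      (∀ e, Local k code e.1.val (M.label e).val (semView M B e)) ∧
      Global k code.length (semLast M B) := by
  choose Q hQ using exists_pathData (M := M) T
  choose F hF using exists_halfData (M := M) T
  have bc : BitsCorrect M code.length T (annotBits M code.length T Q F) := bitsCorrect_annotBits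
  have hpath := pathRule_annotBits (n := code.length) (F := F) hQ
  have b0 : ∀ e, ∀ q < k, (annotBits M code.length T Q F e (vProc q) ↔ e.1.val = q) :=
    fun e q hq => annotBits_proc hq
  have b5 : ∀ e, ∀ p < k, ∀ q < k, ∀ t < 2 ^ code.length,
      (annotBits M code.length T Q F e (vPath 4 p q t) ↔ Q p q t 4 e) :=
    fun e p hp q hq t ht => annotBits_path (by simp) hp hq ht
  have bh : ∀ h < 2, ∀ c < 6, ∀ e, ∀ t < 2 ^ code.length, ∀ W ∈ words k, ∀ W' ∈ words k, ∀ i < k,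
      (annotBits M code.length T Q F e (vHalf c h t W W' i) ↔
        if h = 0 then F t W W' h c i e else F t W' W h c i e) :=
    fun h hh c hc e t ht W hW W' hW' i hi => annotBits_half hh hc ht hW hW' hi
  have hsub : ∀ e v, annotBits M code.length T Q F e v → v ∈ vars k code.length := fun e v h => h.1
  generalize annotBits M code.length T Q F = B at *
  have h0 : ∀ c < 6, ∀ e, ∀ t < 2 ^ code.length, ∀ W ∈ words k, ∀ W' ∈ words k, ∀ i < k,
      (B e (vHalf c 0 t W W' i) ↔ F t W W' 0 c i e) := by simpa using bh 0 (by simp)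
  have h1 : ∀ c < 6, ∀ e, ∀ t < 2 ^ code.length, ∀ W ∈ words k, ∀ W' ∈ words k, ∀ i < k,
      (B e (vHalf c 1 t W W' i) ↔ F t W' W 1 c i e) := by simpa using bh 1 (by simp)
  have hlen : ∀ W ∈ words k, 0 < k → W.length - 1 < k := fun W hW hk => by
    have := (mem_words.1 hW).1
    omega
  have hsig0 : ∀ t < 2 ^ code.length, ∀ W ∈ words k, ∀ W' ∈ words k, RoundTrip W W' →
      ∀ e : M.E, signalRule e.1.val 0 t W W' (semView M B e) := by
    intro t ht W hW W' hW' hr e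
    refine (signalRules_iff b0 hW 0 t).2 ((hF t W W' hr).signal.congr ?_ ?_ ?_ ?_) e
    · exact fun e => h0 0 (by simp) e t ht W hW W' hW' 0 e.pos
    all_goals
      exact fun i hi e => h0 _ (by simp) e t ht W hW W' hW' i (hi.trans_lt (hlen W hW e.pos))
  have hsig1 : ∀ t < 2 ^ code.length, ∀ W ∈ words k, ∀ W' ∈ words k, RoundTrip W W' →
      ∀ e : M.E, signalRule e.1.val 1 t W W' (semView M B e) := by
    intro t ht W hW W' hW' hr e
    refine (signalRules_iff b0 hW 1 t).2 ((hF t W' W hr.symm).signal'.congr ?_ ?_ ?_ ?_) e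
    · exact fun e => h1 0 (by simp) e t ht W hW W' hW' 0 e.pos
    all_goals
      exact fun i hi e => h1 _ (by simp) e t ht W hW W' hW' i (hi.trans_lt (hlen W hW e.pos))
  have hst0 : ∀ t < 2 ^ code.length, ∀ W ∈ words k, ∀ W' ∈ words k, RoundTrip W W' →
      ∀ e : M.E, stationRule e.1.val 0 t W W' (semView M B e) := by
    intro t ht W hW W' hW' hr e
    refine (stationRules_iff W W' 0 t).2 ((hF t W W' hr).station.congr ?_ ?_ ?_ ?_) e
    · exact fun e => h0 0 (by simp) e t ht W hW W' hW' 0 e.pos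
    · exact fun e => h1 3 (by simp) e t ht W' hW' W hW _ (hlen W' hW' e.pos)
    all_goals exact fun e => h0 _ (by simp) e t ht W hW W' hW' 0 e.pos
  have hst1 : ∀ t < 2 ^ code.length, ∀ W ∈ words k, ∀ W' ∈ words k, RoundTrip W W' →
      ∀ e : M.E, stationRule e.1.val 1 t W W' (semView M B e) := by
    intro t ht W hW W' hW' hr e
    refine (stationRules_iff W W' 1 t).2 ((hF t W' W hr.symm).station'.congr ?_ ?_ ?_ ?_) e
    · exact fun e => h1 0 (by simp) e t ht W hW W' hW' 0 e.pos
    · exact fun e => h0 3 (by simp) e t ht W' hW' W hW _ (hlen W' hW' e.pos)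
    all_goals exact fun e => h1 _ (by simp) e t ht W hW W' hW' 0 e.pos
  refine ⟨B, hsub, fun e => (b0 e _ e.1.2).2 rfl, fun e => ⟨⟨fun q hq => ?_, T e,
    List.mem_range.2 (hT.lt e), fun q hq t ht => ?_, ?_⟩, ?_, ?_, ?_, ?_⟩, ?_, ?_⟩
  · exact b0 e q (List.mem_range.1 hq)
  · exact bc.cell e q (List.mem_range.1 hq) t (List.mem_range.1 ht)
  · exact (bc.typing_iff hT.lt).2 hT e
  · exact countRules_iff.2 (fun q hq t ht => ⟨bc.past q hq t ht, bc.fut q hq t ht⟩) e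
  · exact hpath e
  · rintro q hq t ht h rfl
    obtain ⟨f, hf, h1, h2⟩ := (bc.other e _ e.1.2 t (List.mem_range.1 ht)).1 h
    rcases le_total_of_proc (M := M) (e := e) (f := f) (Fin.ext hf.1.symm) with h | h
    · exact h2 h
    · exact h1 h
  · intro W hW W' hW' hr t ht
    have ht := List.mem_range.1 ht
    refine ⟨fun h hh => ?_, fun h => ?_, fun ⟨hp, h⟩ => ?_⟩
    · have hh := List.mem_range.1 hh
      interval_cases h
      · refine ⟨hsig0 t ht W hW W' hW' hr e, hst0 t ht W hW W' hW' hr e, fun h => ?_⟩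
        exact ((hF t W W' hr).mark e ((h0 0 (by simp) e t ht W hW W' hW' 0 e.pos).1 h)).1
      · refine ⟨hsig1 t ht W hW W' hW' hr e, hst1 t ht W hW W' hW' hr e, fun h => ?_⟩
        exact (hF t W' W hr.symm).mark' e ((h1 0 (by simp) e t ht W hW W' hW' 0 e.pos).1 h)
    · exact (bc.cell e _ (wordAt_lt e.pos hW 0) t ht).2
        ((hF t W W' hr).mark e ((h0 0 (by simp) e t ht W hW W' hW' 0 e.pos).1 h))
    · exact (h1 1 (by simp) e t ht W hW W' hW' 0 e.pos).2
        ((hF t W' W hr.symm).off e hp ((bc.other e _ (wordAt_lt e.pos hW' 0) t ht).1 h))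
  · rintro p hp q hq t ht u hu v hv ⟨hpq, ⟨l, hl, hb⟩, ⟨l', hl', hb'⟩⟩
    have b54 := fun e => b5 e p (List.mem_range.1 hp) q (List.mem_range.1 hq) t
      (List.mem_range.1 ht)
    exact (hQ p q t).1.unique u v ⟨l, hl, (b54 l).1 hb⟩ ⟨l', hl', (b54 l').1 hb'⟩
  · intro W hW W' hW' hr t ht
    have ht := List.mem_range.1 ht
    have a0 := fun e : M.E => h0 2 (by simp) e t ht W hW W' hW' 0 e.pos
    have a1 := fun e : M.E => h1 2 (by simp) e t ht W' hW' W hW 0 e.pos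
    simpa only [semLast, a0, a1] using (hF t W W' hr).parity

end Completeness

/-! ### The machine of a formula -/

/-- The machine that guesses annotations and checks the local and the global condition. -/
noncomputable def formulaMachine (k s : ℕ) (code : List (ℕ × ℕ)) : CFMCode :=
  annotationMachine k s (2 ^ (vars k code.length).length)
    (fun x => Local k code x.1 x.2.1 (argView (vars k code.length) x))
    fun g => Global k code.length (argLast (vars k code.length) g)

theorem primrec_formulaMachine :
    Primrec fun x : ℕ × ℕ × List (ℕ × ℕ) => formulaMachine x.1 x.2.1 x.2.2 := by
  unfold formulaMachine
  refine primrec_annotationMachine (by fun_prop) (by fun_prop) (by fun_prop) ?_ ?_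
  · exact primrecPred_local (by fun_prop) (by fun_prop) (by fun_prop) (by fun_prop) (by fun_prop)
      (by fun_prop)
  · exact primrecPred_global (by fun_prop) (by fun_prop) (by fun_prop) (by fun_prop)

/-- The bits of an annotation are stored as the binary digits of a number, in the order of `vars`. -/
theorem formulaMachine_language {k s : ℕ} {φ : MSO (Fin k) (Fin s)} (h : φ.IsEMSO2)
    (h' : φ.IsSentence) :
    ((formulaMachine k s φ.code).toCFM k s).language = φ.language := by
  ext M
  rw [mem_language_iff_typing h h' M]
  constructor
  · rintro ⟨r, hr⟩
    obtain ⟨γ, h1, h2⟩ := exists_annotation_of_run r hr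
    simp only [argView_localArgs] at h1
    rw [argLast_ofFn] at h2
    exact exists_typing_of_annotation h1 h2
  · rintro ⟨T, hT⟩
    obtain ⟨B, hB, hproc, hL, hG⟩ := exists_annotation hT
    classical
    set vs := vars k φ.code.length
    let γ : M.E → ℕ := fun e => Nat.ofBits fun i : Fin vs.length => decide (B e vs[i])
    have hγ : (fun e v => ((γ e).testBit (vs.idxOf v) : Prop)) = B := by
      funext e v
      refine propext ?_
      by_cases hv : v ∈ vs
      · have := Nat.testBit_ofBits_lt (fun i : Fin vs.length => decide (B e vs[i])) (vs.idxOf v)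
          (List.idxOf_lt_length_of_mem hv)
        rw [this]
        simp
      · have := Nat.testBit_ofBits_ge (fun i : Fin vs.length => decide (B e vs[i])) (vs.idxOf v)
          (by rw [List.idxOf_of_notMem hv])
        rw [this]
        exact iff_of_false (by simp) fun h => hv (hB e v h)
    refine exists_run_of_annotation γ (fun e => Nat.ofBits_lt_two_pow _) (fun e h0 => ?_)
      (fun e => ?_) ?_
    · have := congrFun (congrFun hγ e) (vProc e.1.val)
      rw [h0] at this
      have h := hproc e
      rw [← this] at h
      simp at h
    · rw [argView_localArgs, hγ]
      exact hL e
    · rw [argLast_ofFn, hγ]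
      exact hG

/-- There are `k ^ l` words of each length `l ≤ k`. -/
theorem length_words_le {k : ℕ} (hk : 0 < k) : (words k).length ≤ (k + 1) * k ^ k := by
  have : ∀ l ∈ List.range (k + 1), (tuples (List.range k) l).length ≤ k ^ k := fun l hl => by
    rw [length_tuples, List.length_range]
    exact Nat.pow_le_pow_right hk (by simpa [Nat.lt_succ_iff] using hl)
  rw [words, List.length_flatMap]
  refine (List.sum_le_card_nsmul _ (k ^ k) (by simpa using this)).trans ?_
  simp

theorem two_mul_length_vars_lt {k n : ℕ} (hk : 0 < k) :
    2 * (vars k n).length + 1 ≤ 2 ^ (n + 9) * k ^ (5 * k) := by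
  have h1 : 1 ≤ 2 ^ n * k ^ (5 * k) := Nat.one_le_iff_ne_zero.2 (by positivity)
  have h2 : (words k).length ^ 2 * k ≤ 4 * k ^ (5 * k) := by
    calc (words k).length ^ 2 * k ≤ ((2 * k) * k ^ k) ^ 2 * k := by
          gcongr
          exact (length_words_le hk).trans (by gcongr; omega)
      _ = 4 * k ^ (2 * k + 3) := by ring
      _ ≤ 4 * k ^ (5 * k) := by gcongr; omega
  rw [length_vars]
  have h3 := Nat.mul_le_mul_left (2 ^ n) h2
  have h4 : 2 ^ (n + 9) = 512 * 2 ^ n := by ring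
  rw [h4]
  nlinarith

theorem MSO.length_code {k s : ℕ} (φ : MSO (Fin k) (Fin s)) : φ.code.length = φ.size := by
  simp [MSO.code, MSO.size]

theorem MSO.size_pos {k s : ℕ} (φ : MSO (Fin k) (Fin s)) : 1 ≤ φ.size := by
  cases φ <;> simp [MSO.size, MSO.toSymbols]

theorem card_formulaMachine_le {k s : ℕ} (φ : MSO (Fin k) (Fin s)) (p : Fin k) :
    (Nat.card (((formulaMachine k s φ.code).toCFM k s).State p) : ℝ) ≤
      (2 : ℝ) ^ ((2 : ℝ) ^ ((10 : ℝ) * ((φ.size : ℝ) + (k : ℝ) * Real.logb 2 (k : ℝ)))) := by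
  have hk : 0 < k := Nat.zero_lt_of_lt p.2
  have hk' : (0 : ℝ) < k := by exact_mod_cast hk
  have hn : (1 : ℝ) ≤ φ.size := by exact_mod_cast φ.size_pos
  have hlog : 0 ≤ (k : ℝ) * Real.logb 2 k :=
    mul_nonneg hk'.le (Real.logb_nonneg (by norm_num) (by exact_mod_cast hk))
  set m := (vars k φ.code.length).length with hm
  have h1 : (2 ^ m) ^ 2 + 1 ≤ 2 ^ (2 * m + 1) := by
    have : 1 ≤ 2 ^ (2 * m) := Nat.one_le_two_pow
    rw [← pow_mul, pow_succ, mul_comm m 2]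
    omega
  have h2 : ((2 * m + 1 : ℕ) : ℝ) ≤
      (2 : ℝ) ^ ((10 : ℝ) * ((φ.size : ℝ) + (k : ℝ) * Real.logb 2 (k : ℝ))) := by
    have h3 : ((2 * m + 1 : ℕ) : ℝ) ≤ ((2 ^ (φ.size + 9) * k ^ (5 * k) : ℕ) : ℝ) := by
      have := two_mul_length_vars_lt (n := φ.code.length) hk
      rw [← hm, φ.length_code] at this
      exact_mod_cast this
    refine h3.trans ?_
    -- powers of `k` contribute the term `k * log k` to the exponent
    have h4 : (k : ℝ) ^ (5 * k) = (2 : ℝ) ^ (Real.logb 2 k * ((5 * k : ℕ) : ℝ)) := by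
      rw [Real.rpow_mul (by norm_num), Real.rpow_logb (by norm_num) (by norm_num) hk',
        Real.rpow_natCast]
    push_cast
    rw [h4, ← Real.rpow_natCast, ← Real.rpow_add (by norm_num)]
    refine Real.rpow_le_rpow_of_exponent_le (by norm_num) ?_
    push_cast
    -- the constant `9` is at most nine times the size of the formula
    nlinarith
  rw [formulaMachine, annotationMachine_card]
  calc (((2 ^ m) ^ 2 + 1 : ℕ) : ℝ) ≤ ((2 ^ (2 * m + 1) : ℕ) : ℝ) := by exact_mod_cast h1
    _ = (2 : ℝ) ^ ((2 * m + 1 : ℕ) : ℝ) := by rw [Real.rpow_natCast]; push_cast; rfl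
    _ ≤ _ := Real.rpow_le_rpow_of_exponent_le (by norm_num) h2

end CFMLogic

open CFMLogic
theorem mainTheorem2 :
    ∃ (C : ℕ) (F : ℕ × ℕ × List (ℕ × ℕ) → CFMCode), Computable F ∧
      ∀ (k s : ℕ) (φ : MSO (Fin k) (Fin s)), φ.IsEMSO2 → φ.IsSentence →
        (CFMCode.toCFM k s (F (k, s, φ.code))).language = φ.language ∧
        ∀ p : Fin k,
          (Nat.card ((CFMCode.toCFM k s (F (k, s, φ.code))).State p) : ℝ) ≤
            (2 : ℝ) ^ ((2 : ℝ) ^ ((C : ℝ) * ((φ.size : ℝ) + (k : ℝ) * Real.logb 2 (k : ℝ)))) := by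
  refine ⟨10, fun x => formulaMachine x.1 x.2.1 x.2.2, primrec_formulaMachine.to_comp,
    fun k s φ h h' => ⟨formulaMachine_language h h', fun p => ?_⟩⟩
  exact_mod_cast card_formulaMachine_le φ p
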